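/- **Theorem (plug-in SDR / reach estimator).** *Definitions.* For $K\subset\mathbb R^D$ let $\mathrm d_K(x,y)\in[0,\infty]$ be the infimum of the lengths of continuous paths in $K$ from $x$ to $y$, let $K^{\varepsilon}$ be the closed $\varepsilon$-offset of $K$, let $\mathrm{rch}(K)$ be its reach, and let $\mathrm d_{\mathrm H}$ be the Hausdorff distance. For $r>0$ and $\|x-y\|\le 2r$ put $\mathrm d_{\mathcal S(r)}(x,y)=2r\arcsin(\|x-y\|/2r)$. The spherical distortion radius of $K$ with a distance $\mathrm d$ at scale $\delta$ is $$\mathrm{sdr}_\delta(K,\mathrm d)=\sup\{r>0:\ \mathrm d(x,y)\le \mathrm d_{\mathcal S(r)}(x,y)\ \text{ for all } x,y\in K \text{ with } \delta\le\|x-y\|<2r\}\in[0,\infty].$$ *Model.* Let $1\le d$, $k\ge2$, $\mathrm{rch}_{\min}>0$, $f_{\min}>0$, $f_{\max}\in\mathbb R$ and $\mathbf L=(L_2,\dots,L_k)$ with $L_2>0$. Let $\mathcal C$ be the class of compact connected $d$-dimensional $\mathcal C^k$ submanifolds $M\subset\mathbb R^D$ without boundary with $\mathrm{rch}(M)\ge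 \mathrm{rch}_{\min}$ such that every $x\in M$ has, for some $r\ge 1/(4L_2)$, a one-to-one local parametrization $\mathrm B_{T_xM}(0,r)\to M$, $v\mapsto x+v+N_x(v)$, with $N_x$ of class $\mathcal C^k$ on the closed ball, $N_x(0)=0$, $\mathrm d_0N_x=0$, $\|\mathrm d^2_vN_x\|_{\rm op}\le L_2$ for $\|v\|\le 1/(4L_2)$ and $\|\mathrm d^i_vN_x\|_{\rm op}\le L_i$ for $3\le i\le k$. Let $\mathcal P$ be the set of probability distributions $P$ whose support $M$ lies in $\mathcal C$ and which have a density with values in $[f_{\min},f_{\max}]$ with respect to the $d$-dimensional volume measure of $M$. Let $R_\ell(M)=1/\sup_{x\in M}\|\mathrm{II}_x\|_{\rm op}$ be the minimal radius of curvature of $M$, where $\mathrm{II}_x$ is the second fundamental form at $x$. *Estimators.* From an i.i.d. $n$-sample of $P$, let $\widehat M$ be an estimator of $M$ such that $\mathrm d_{\mathrm H}(M,\widehat M)\le\varepsilon$ on an event $\mathcal A$. For a truncation level $\mathrm s_{\max}>0$ put $\widehat{\mathrm{sdr}}_\delta=\min\{\mathrm{sdr}_\delta(\widehat M,\mathrm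 d_{\widehat M^{\varepsilon}}),\mathrm s_{\max}\}$, and, given any real-valued estimator $\widehat R$ of $R_\ell(M)$, put $\widehat{\mathrm{rch}}=\min\{\widehat R,\widehat{\mathrm{sdr}}_\delta\}$. *Statement.* There is an absolute constant $C>0$ such that the following hold. 1. There is a finite $S$, depending only on the parameters of the model, with $\mathrm{sdr}_\delta(M,\mathrm d_M)\le S$ for all $P\in\mathcal P$ with support $M$ and all $\delta\le \mathrm{rch}_{\min}$. 2. For all $0<\delta<\mathrm{rch}_{\min}$ and $P\in\mathcal P$ with support $M$, $R_\ell(M)<\infty$ and $\mathrm{rch}(M)=\min\{R_\ell(M),\mathrm{sdr}_\delta(M,\mathrm d_M)\}$. 3. For all $0<\delta<\mathrm{rch}_{\min}$ and $\mathrm s_{\max}>0$ there is $\varepsilon_0>0$, depending only on $\delta$, $\mathrm s_{\max}$ and the parameters of the model, such that for all $n$, all $0<\varepsilon\le\varepsilon_0$, all $P\in\mathcal P$ with $\mathrm{sdr}_\delta(M,\mathrm d_M)\le \mathrm s_{\max}$, and all $\widehat M$, $\mathcal A$, $\widehat R$ as above, with $\zeta_0=C\,\mathrm s_{\max}^4/\delta^4$,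 $$\mathbb E_{P^{\otimes n}}|\widehat{\mathrm{sdr}}_\delta-\mathrm{sdr}_\delta(M,\mathrm d_M)|\le \zeta_0\,\varepsilon\,P^{\otimes n}(\mathcal A)+2\,\mathrm s_{\max}P^{\otimes n}(\mathcal A^c),$$ $$\mathbb E_{P^{\otimes n}}|\widehat{\mathrm{rch}}-\mathrm{rch}(M)|\le \mathbb E_{P^{\otimes n}}|\widehat R-R_\ell(M)|+\zeta_0\,\varepsilon\,P^{\otimes n}(\mathcal A)+2\,\mathrm s_{\max}P^{\otimes n}(\mathcal A^c).$$ 4. (Rates.) For all $0<\delta<\mathrm{rch}_{\min}$, $\mathrm s_{\max}>0$ and $\kappa>0$ there are $K>0$ and $n_0$, depending only on $\delta$, $\mathrm s_{\max}$, $\kappa$ and the parameters of the model, such that for all $n\ge n_0$ and all $P\in\mathcal P$ with $\mathrm{sdr}_\delta(M,\mathrm d_M)\le\mathrm s_{\max}$: if $\varepsilon=\kappa(\log n/n)^{k/d}$ and $P^{\otimes n}(\mathcal A^c)\le\kappa(\log n/n)^{k/d}$, then $\mathbb E_{P^{\otimes n}}|\widehat{\mathrm{sdr}}_\delta-\mathrm{sdr}_\delta(M,\mathrm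 d_M)|\le K(\log n/n)^{k/d}$; if moreover $\mathrm{sdr}_\delta(M,\mathrm d_M)\le R_\ell(M)$, then $\mathbb E_{P^{\otimes n}}|\widehat{\mathrm{sdr}}_\delta-\mathrm{rch}(M)|\le K(\log n/n)^{k/d}$; and if $\mathbb E_{P^{\otimes n}}|\widehat R-R_\ell(M)|\le\kappa(\log n/n)^{(k-2)/d}$, then $\mathbb E_{P^{\otimes n}}|\widehat{\mathrm{rch}}-\mathrm{rch}(M)|\le K(\log n/n)^{(k-2)/d}$. -/

import Mathlib

open MeasureTheory Filter Topology
open scoped ENNReal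

noncomputable section

namespace ReachEst

/-- `ℝ^D` with its Euclidean structure. -/
abbrev E (D : ℕ) : Type := EuclideanSpace ℝ (Fin D)

variable {D : ℕ}

/-! Metric notions: intrinsic distance, reach, spherical distortion radius -/

/-- Shortest-path distance `d_K(x, y)` in `K`: the infimum of the lengths of the continuous paths
from `x` to `y` which stay in `K` (`∞` if there is no such path of finite length). -/
def intrinsicDist (K : Set (E D)) (x y : E D) : ℝ≥0∞ :=
  ⨅ (γ : Path x y) (_ : ∀ t, γ t ∈ K), eVariationOn γ Set.univ

/-- Great-circle distance `d_{S(r)}(x, y) = 2 r arcsin (‖x - y‖ / (2 r))` between two points on a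
sphere of radius `r`; meaningful for `‖x - y‖ ≤ 2 r`. -/
def sphereDist (r : ℝ) (x y : E D) : ℝ :=
  2 * r * Real.arcsin (‖x - y‖ / (2 * r))

/-- Spherical distortion radius of `(K, dist)` at scale `δ`: the supremum of the radii `r > 0` such
that `dist x y ≤ d_{S(r)}(x, y)` for all `x, y ∈ K` with `δ ≤ ‖x - y‖ < 2 r`. -/
def sdr (δ : ℝ) (K : Set (E D)) (dist : E D → E D → ℝ≥0∞) : ℝ≥0∞ :=
  ⨆ (r : ℝ) (_ : 0 < r ∧ ∀ x ∈ K, ∀ y ∈ K, δ ≤ ‖x - y‖ → ‖x - y‖ < 2 * r →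
    dist x y ≤ ENNReal.ofReal (sphereDist r x y)), ENNReal.ofReal r

/-- Medial axis: the points with at least two nearest neighbours in `K`. -/
def medialAxis (K : Set (E D)) : Set (E D) :=
  {z | ∃ a ∈ K, ∃ b ∈ K, a ≠ b ∧ edist z a = Metric.infEDist z K ∧
    edist z b = Metric.infEDist z K}

/-- Reach of `K`: the infimum over the medial axis of the distance to `K`. -/
def reach (K : Set (E D)) : ℝ≥0∞ :=
  ⨅ z ∈ medialAxis K, Metric.infEDist z K

/-! Submanifolds -/

/-- `M` is a `d`-dimensional submanifold (without boundary) of `ℝ^D` of class `C^k`: around each of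
its points it is straightened to a `d`-dimensional linear subspace by a `C^k` diffeomorphism
between open subsets of `ℝ^D`. -/
def IsSubmanifold (d k : ℕ) (M : Set (E D)) : Prop :=
  ∀ x ∈ M, ∃ (Φ : OpenPartialHomeomorph (E D) (E D)) (V : Submodule ℝ (E D)),
    x ∈ Φ.source ∧ ContDiffOn ℝ k Φ Φ.source ∧ ContDiffOn ℝ k Φ.symm Φ.target ∧
    Module.finrank ℝ V = d ∧ ∀ y ∈ Φ.source, y ∈ M ↔ Φ y ∈ V

/-- Tangent space of `M` at `x`, as a linear subspace of `ℝ^D`. -/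
def tangentSpace (M : Set (E D)) (x : E D) : Submodule ℝ (E D) :=
  Submodule.span ℝ (tangentConeAt ℝ M x)

/-- Maximal curvature of `M`: the supremum over `x ∈ M` of the operator norm of the second
fundamental form `II_x`. As `II_x` is symmetric, its norm is the supremum of `‖II_x(v, v)‖` over
unit tangent vectors `v`, and `II_x(v, v)` is the component normal to `M` of `γ''(0)` for any
`C^2` curve `γ` in `M` with `γ(0) = x` and `γ'(0) = v`. -/
def maxCurvature (M : Set (E D)) : ℝ≥0∞ :=
  ⨆ (x ∈ M) (γ : ℝ → E D) (_ : ContDiffAt ℝ 2 γ 0 ∧ (∀ᶠ t in 𝓝 0, γ t ∈ M) ∧ γ 0 = x ∧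
    ‖deriv γ 0‖ = 1), ‖(tangentSpace M x)ᗮ.starProjection (iteratedDeriv 2 γ 0)‖ₑ

/-- Minimal radius of curvature `R_ℓ(M)`. -/
def minCurvatureRadius (M : Set (E D)) : ℝ≥0∞ := (maxCurvature M)⁻¹

/-- The class of compact connected `d`-dimensional `C^k` submanifolds `M` of `ℝ^D` with reach at
least `ρ` which, over a ball of radius `r ≥ 1 / (4 L₂)` of each tangent space, have a one-to-one
local parametrization `v ↦ x + v + N v` with `N` of class `C^k`, `N 0 = 0`, `dN(0) = 0`,
`‖d²N(v)‖ ≤ L₂` for `‖v‖ ≤ 1 / (4 L₂)`, and `‖dⁱN(v)‖ ≤ Lᵢ` for `3 ≤ i ≤ k`. -/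
structure IsModelManifold (d k : ℕ) (ρ : ℝ) (L : ℕ → ℝ) (M : Set (E D)) : Prop where
  isCompact : IsCompact M
  isConnected : IsConnected M
  isSubmanifold : IsSubmanifold d k M
  le_reach : ENNReal.ofReal ρ ≤ reach M
  exists_param : ∀ x ∈ M, ∃ (r : ℝ) (N : tangentSpace M x → E D),
    1 / (4 * L 2) ≤ r ∧
    ContDiffOn ℝ k N (Metric.closedBall 0 r) ∧
    N 0 = 0 ∧ fderiv ℝ N 0 = 0 ∧
    (∀ v ∈ Metric.closedBall (0 : tangentSpace M x) r, x + (v : E D) + N v ∈ M) ∧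
    Set.InjOn (fun v : tangentSpace M x => x + (v : E D) + N v) (Metric.closedBall 0 r) ∧
    (∀ v ∈ Metric.closedBall (0 : tangentSpace M x) r, ‖v‖ ≤ 1 / (4 * L 2) →
      ‖iteratedFDerivWithin ℝ 2 N (Metric.closedBall 0 r) v‖ ≤ L 2) ∧
    (∀ v ∈ Metric.closedBall (0 : tangentSpace M x) r, ∀ i, 3 ≤ i → i ≤ k →
      ‖iteratedFDerivWithin ℝ i N (Metric.closedBall 0 r) v‖ ≤ L i)

/-- The statistical model: probability distributions `P` whose support `M` is in the class above and
which have a density, with values in `[fmin, fmax]` on `M`, with respect to the `d`-dimensional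
volume measure of `M`. -/
structure InModel (d k : ℕ) (ρ : ℝ) (L : ℕ → ℝ) (fmin fmax : ℝ) (P : Measure (E D)) : Prop where
  isProbabilityMeasure : IsProbabilityMeasure P
  support_mem : IsModelManifold d k ρ L P.support
  exists_density : ∃ f : E D → ℝ≥0∞, Measurable f ∧
    (∀ x ∈ P.support, ENNReal.ofReal fmin ≤ f x ∧ f x ≤ ENNReal.ofReal fmax) ∧
    P = ((Measure.euclideanHausdorffMeasure d : Measure (E D)).restrict P.support).withDensity f

/-! Estimators -/

/-- Spherical distortion radius of the intrinsic metric `d_M`, as a real number. -/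
def trueSdr (δ : ℝ) (M : Set (E D)) : ℝ := (sdr δ M (intrinsicDist M)).toReal

/-- Plug-in estimator built from an estimate `Mhat` of the support: the spherical distortion radius
of `Mhat` for the shortest-path distance of the closed `ε`-offset of `Mhat`, truncated at `s`. -/
def plugInSdr (δ ε s : ℝ) (Mhat : Set (E D)) : ℝ :=
  (min (sdr δ Mhat (intrinsicDist (Metric.cthickening ε Mhat))) (ENNReal.ofReal s)).toReal

/-- Law of an i.i.d. `n`-sample drawn from `P`. -/
def sampleLaw (n : ℕ) (P : Measure (E D)) : Measure (Fin n → E D) := Measure.pi fun _ => P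

/-- Expected absolute error `𝔼 |T(X₁, …, X_n) - θ|` under i.i.d. sampling from `P`. -/
def risk (n : ℕ) (P : Measure (E D)) (T : (Fin n → E D) → ℝ) (θ : ℝ) : ℝ≥0∞ :=
  ∫⁻ X, ENNReal.ofReal |T X - θ| ∂(sampleLaw n P)

end ReachEst

end

/-!
Everything rests on one description of the reach. If points at distance less than `τ` from a closed
set `K` have unique nearest points, then normal segments extend up to length `τ`
(`HasReach.infDist_ray`), so that balls of radius `τ` tangent to `K` do not meet `K`
(`HasReach.inner_le`, and for all normals of a submanifold `HasReach.inner_le_of_mem_orthogonal`).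
This gives three things: the metric projection is Lipschitz below the reach
(`HasReach.norm_nearest_sub_le`); the curvature is at most `1 / τ` (`reach_le_minCurvatureRadius`);
and projecting midpoints over and over joins two points of `K` by a curve in `K` which is not longer
than the arc of radius `τ` over their chord (`HasReach.intrinsicDist_le`), that is, the spherical
distortion radius is at least the reach (`reach_le_sdr`).

Conversely, consider points of the medial axis whose distances to `M` tend to the reach `τ`, and a
limit of them. Either there are pairs of points of `M`, as close to each other as one likes, which
are both nearest to one of these points or to their limit; this forces the curvature to be at least
`1 / τ` (`IsSubmanifold.one_le_mul_infDist`). Or the limit has two antipodal nearest points `a` and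
`b` (`HasReach.exists_isNearest_norm_sub_lt`). In the second case every path in `M` from `a` to `b` goes around the empty ball between them and has length
at least `π τ` (`pi_mul_le_eVariationOn`), so the spherical distortion radius is at most `τ`. Hence
`reach_eq_min`.

The spherical distortion radii are bounded over the model, since the supports have bounded diameters
by a volume count (`exists_norm_sub_le_of_inModel`) and since a path to a farthest point, which
arrives orthogonally to the chord, exceeds the chord by a definite length (`sdr_le_of_norm_sub_le`).

For stability, let `K` be `ε`-close to `M`. The paths of `M` lie in the `ε`-offset of `K`, and the
paths of this offset are projected onto `M` with a Lipschitz constant `1 + O(ε)`. Thus the two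
length metrics differ by `O(ε)`. A decrease of the radius by `η` lengthens the arc over a chord `c`
by at least a multiple of `η (c / r)³`, and `c ≥ δ` (`arcLen_add_le`), so that decreasing an
admissible radius by a multiple of `(smax / δ)⁴ ε` absorbs this error. The only further obstacle is
the constraint `δ ≤ ‖x - y‖`, which may be lost when passing between `M` and `K`; it is restored by
pushing one of the points away within `M` (`IsModelManifold.exists_norm_sub_add_le`). The result is
the deterministic bound `IsCloseTo.abs_plugInSdr_sub_le`. The bounds on the risks and the rates
follow by integration, the minimum being `1`-Lipschitz in each of its arguments.
-/

namespace ReachEst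

/-! ### Sets of positive reach -/

section ReachTheory

open Metric

section Metric

variable {V : Type*} [MetricSpace V]

/-- `a` is a nearest point of `z` in `K`. -/
def IsNearest (K : Set V) (z a : V) : Prop := a ∈ K ∧ dist z a = infDist z K

/-- The reach of `K` is at least `τ`, in real-valued terms: a point at distance less than `τ` from
`K` has at most one nearest point in `K`. -/
def HasReach (τ : ℝ) (K : Set V) : Prop :=
  ∀ z a b, IsNearest K z a → IsNearest K z b → infDist z K < τ → a = b

lemma exists_isNearest [ProperSpace V] {K : Set V} (hK : IsClosed K) (hne : K.Nonempty) (z : V) :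
    ∃ a, IsNearest K z a := by
  obtain ⟨a, ha, h⟩ := hK.exists_infDist_eq_dist hne z
  exact ⟨a, ha, h.symm⟩

/-- The metric projection is continuous where the nearest point is unique. -/
lemma HasReach.dist_nearest_lt [ProperSpace V] {τ : ℝ} {K : Set V} (hK : IsClosed K)
    (h : HasReach τ K) {q b : V} (hb : IsNearest K q b) (hq : infDist q K < τ) {η : ℝ}
    (hη : 0 < η) :
    ∃ s : ℝ, 0 < s ∧ ∀ q' b', dist q' q < s → IsNearest K q' b' → dist b' b < η := by
  by_contra! hcon
  choose q' b' hqq hnb hbb using fun n : ℕ => hcon (1 / ((n : ℝ) + 1)) (by positivity)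
  have hq' : Tendsto q' atTop (𝓝 q) := by
    rw [tendsto_iff_dist_tendsto_zero]
    exact squeeze_zero (fun _ => dist_nonneg) (fun n => (hqq n).le)
      tendsto_one_div_add_atTop_nhds_zero_nat
  have hbd : ∀ n, b' n ∈ closedBall q (infDist q K + 2) := by
    intro n
    have h1 : dist (q' n) q ≤ 1 := (hqq n).le.trans (by
      rw [div_le_one (by positivity)]; linarith [(Nat.cast_nonneg n : (0 : ℝ) ≤ n)])
    have h2 := infDist_le_infDist_add_dist (s := K) (x := q' n) (y := q)
    have h3 := (hnb n).2
    have h4 := dist_triangle_left (b' n) q (q' n)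
    rw [mem_closedBall]
    linarith
  obtain ⟨c, -, φ, hφ, hc⟩ := (isCompact_closedBall q (infDist q K + 2)).tendsto_subseq hbd
  have hcK : c ∈ K := hK.mem_of_tendsto hc (Eventually.of_forall fun n => (hnb _).1)
  have hqφ := hq'.comp hφ.tendsto_atTop
  have e1 : Tendsto (fun n => dist (q' (φ n)) (b' (φ n))) atTop (𝓝 (dist q c)) := hqφ.dist hc
  have e2 : Tendsto (fun n => infDist (q' (φ n)) K) atTop (𝓝 (infDist q K)) :=
    ((continuous_infDist_pt K).tendsto q).comp hqφ
  have e3 : dist q c = infDist q K :=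
    tendsto_nhds_unique e1 (e2.congr fun n => ((hnb _).2).symm)
  have hcb : c = b := h q c b ⟨hcK, e3⟩ hb hq
  have e4 : Tendsto (fun n => dist (b' (φ n)) b) atTop (𝓝 (dist c b)) := hc.dist tendsto_const_nhds
  have := ge_of_tendsto' e4 fun n => hbb (φ n)
  rw [hcb, dist_self] at this
  linarith

end Metric

variable {V : Type*} [NormedAddCommGroup V] [InnerProductSpace ℝ V]

/-- Moving away from the unique nearest point increases the distance to `K`. -/
lemma HasReach.infDist_lt_infDist_add [ProperSpace V] {τ : ℝ} {K : Set V} (hK : IsClosed K)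
    (h : HasReach τ K) {q b w : V} (hb : IsNearest K q b) (hq : infDist q K < τ)
    (hw : 0 < inner ℝ w (q - b)) :
    ∃ s₀ : ℝ, 0 < s₀ ∧ ∀ s : ℝ, 0 < s → s < s₀ → infDist q K < infDist (q + s • w) K := by
  have hw0 : 0 < ‖w‖ := by
    rw [norm_pos_iff]; rintro rfl; simp at hw
  obtain ⟨s₁, hs₁, H⟩ := h.dist_nearest_lt hK hb hq (div_pos hw hw0)
  refine ⟨s₁ / ‖w‖, div_pos hs₁ hw0, fun s hs hss => ?_⟩
  obtain ⟨b', hb'⟩ := exists_isNearest hK ⟨b, hb.1⟩ (q + s • w)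
  have hd : dist (q + s • w) q < s₁ := by
    rw [dist_eq_norm, add_sub_cancel_left, norm_smul, Real.norm_of_nonneg hs.le]
    exact (lt_div_iff₀ hw0).1 hss
  have hbb := H _ _ hd hb'
  rw [dist_eq_norm, lt_div_iff₀ hw0] at hbb
  have hin : 0 < inner ℝ w (q - b') := by
    have e : q - b' = (q - b) - (b' - b) := by abel
    rw [e, inner_sub_right]
    have := real_inner_le_norm w (b' - b)
    nlinarith
  have h1 : infDist q K ≤ ‖q - b'‖ := by
    rw [← dist_eq_norm]; exact infDist_le_dist_of_mem hb'.1
  rw [← hb'.2, dist_eq_norm]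
  have e : q + s • w - b' = (q - b') + s • w := by abel
  have h2 : ‖q - b'‖ ^ 2 < ‖q + s • w - b'‖ ^ 2 := by
    rw [e, norm_add_sq_real, inner_smul_right, real_inner_comm]
    nlinarith [sq_nonneg ‖s • w‖, mul_pos hs hin]
  exact h1.trans_lt (lt_of_pow_lt_pow_left₀ 2 (norm_nonneg _) h2)

/-- One step of the extension of normal segments: a point maximizing the distance to `K` on a small
ball around `p` lies on the ray from the nearest point of `p` through `p`. -/
lemma HasReach.infDist_add_smul [ProperSpace V] {τ : ℝ} {K : Set V} (hK : IsClosed K)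
    (h : HasReach τ K) {a u : V} {d t : ℝ} (ha : a ∈ K) (hu : ‖u‖ = 1) (ht : 0 < t) (htd : t < d)
    (hdt : infDist (a + d • u) K = d) (hτ : d + t < τ) :
    infDist (a + (d + t) • u) K = d + t := by
  set p := a + d • u with hp
  have hpa : IsNearest K p a := ⟨ha, by
    rw [hdt, dist_eq_norm, hp, add_sub_cancel_left, norm_smul, hu, mul_one,
      Real.norm_of_nonneg (by linarith)]⟩
  obtain ⟨q, hq, hmax⟩ := (isCompact_closedBall p t).exists_isMaxOn
    ⟨p, mem_closedBall_self ht.le⟩ (continuous_infDist_pt K).continuousOn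
  have hqp : infDist p K ≤ infDist q K := hmax (mem_closedBall_self ht.le)
  rw [mem_closedBall, dist_eq_norm] at hq
  have hqd : infDist q K ≤ d + t := by
    have := infDist_le_infDist_add_dist (s := K) (x := q) (y := p)
    rw [dist_eq_norm] at this; linarith
  obtain ⟨b, hb⟩ := exists_isNearest hK ⟨a, ha⟩ q
  have hqb : ‖q - b‖ = infDist q K := by rw [← dist_eq_norm]; exact hb.2
  have hqb0 : 0 < ‖q - b‖ := by linarith
  set e : V := ‖q - b‖⁻¹ • (q - b) with he
  have hqbe : q - b = ‖q - b‖ • e := by rw [he, smul_smul, mul_inv_cancel₀ hqb0.ne', one_smul]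
  have hen : ‖e‖ = 1 := by
    rw [he, norm_smul, norm_inv, norm_norm, inv_mul_cancel₀ hqb0.ne']
  -- at a maximum the ascent direction `t • e - (q - p)`, which points into the ball, vanishes
  have key : inner ℝ (t • e - (q - p)) (q - b) ≤ 0 := by
    by_contra! hpos
    obtain ⟨s₀, hs₀, H⟩ := h.infDist_lt_infDist_add hK hb (hqd.trans_lt hτ) hpos
    set s := min (s₀ / 2) 1
    have hs : 0 < s := lt_min (by linarith) one_pos
    have hlt := H s hs ((min_le_left _ _).trans_lt (by linarith))
    have hs1 : s ≤ 1 := min_le_right _ _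
    have hmem : q + s • (t • e - (q - p)) ∈ closedBall p t := by
      rw [mem_closedBall, dist_eq_norm]
      have : q + s • (t • e - (q - p)) - p = (1 - s) • (q - p) + (s * t) • e := by module
      rw [this]
      refine (norm_add_le _ _).trans ?_
      rw [norm_smul, norm_smul, hen, Real.norm_of_nonneg (by linarith),
        Real.norm_of_nonneg (by positivity)]
      nlinarith
    exact absurd (hmax hmem) (not_le.2 hlt)
  have hvt : t ≤ inner ℝ (q - p) e := by
    rw [hqbe, inner_smul_right, inner_sub_left, inner_smul_left, real_inner_self_eq_norm_sq,
      hen] at key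
    simp only [conj_trivial, one_pow, mul_one] at key
    by_contra! hlt
    have := mul_pos hqb0 (sub_pos.2 hlt)
    linarith
  have hvte : q - p = t • e := by
    rw [← sub_eq_zero, ← norm_eq_zero, ← sq_eq_zero_iff]
    refine le_antisymm ?_ (sq_nonneg _)
    rw [norm_sub_sq_real, inner_smul_right, norm_smul, hen, Real.norm_of_nonneg ht.le]
    nlinarith [norm_nonneg (q - p)]
  have hpb : p - b = (‖q - b‖ - t) • e := by
    have : p - b = (q - b) - (q - p) := by abel
    rw [this, hvte, sub_smul, ← hqbe]
  have hpbn : ‖p - b‖ = ‖q - b‖ - t := by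
    rw [hpb, norm_smul, hen, mul_one, Real.norm_of_nonneg (by linarith)]
  have hpb' : IsNearest K p b := by
    refine ⟨hb.1, le_antisymm ?_ (infDist_le_dist_of_mem hb.1)⟩
    rw [dist_eq_norm, hpbn, hdt]; linarith
  have hab : b = a := h p b a hpb' hpa (by linarith)
  have hpbd : ‖p - b‖ = d := by rw [← dist_eq_norm, hpb'.2, hdt]
  have hue : e = u := by
    have h1 : p - b = d • u := by rw [hab, hp]; abel
    have h2 : d • u = d • e := by rw [← h1, hpb, ← hpbn, hpbd]
    exact (smul_right_injective V (by linarith : d ≠ 0) h2).symm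
  have hfin : a + (d + t) • u = q := by
    have : q = p + t • e := by rw [← hvte]; abel
    rw [this, hp, hue]; module
  rw [hfin, ← hqb]
  linarith

/-- Normal segments extend up to the reach: if `a` is the nearest point of `a + d • u`, then it is a
nearest point of `a + t • u` for all `t` below the reach. -/
lemma HasReach.infDist_ray [ProperSpace V] {τ : ℝ} {K : Set V} (hK : IsClosed K)
    (h : HasReach τ K) {a u : V} {d t : ℝ} (ha : a ∈ K) (hu : ‖u‖ = 1) (hd : 0 < d)
    (hdt : infDist (a + d • u) K = d) (ht : 0 ≤ t) (hτ : t < τ) :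
    infDist (a + t • u) K = t := by
  -- each step of the extension multiplies the length of the segment by `3 / 2`
  have main : ∀ n : ℕ, ∀ t, 0 ≤ t → t < τ → t ≤ (3 / 2) ^ n * d → infDist (a + t • u) K = t := by
    intro n
    induction n with
    | zero =>
      intro t ht _ htd
      rw [pow_zero, one_mul] at htd
      refine le_antisymm ((infDist_le_dist_of_mem ha).trans_eq ?_) ?_
      · rw [dist_eq_norm, add_sub_cancel_left, norm_smul, hu, mul_one, Real.norm_of_nonneg ht]
      · have h1 := infDist_le_infDist_add_dist (s := K) (x := a + d • u) (y := a + t • u)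
        have h2 : dist (a + d • u) (a + t • u) = d - t := by
          rw [dist_eq_norm, show a + d • u - (a + t • u) = (d - t) • u by module, norm_smul, hu,
            mul_one, Real.norm_of_nonneg (by linarith)]
        linarith
    | succ n ih =>
      intro t ht htτ htd
      rcases ht.eq_or_lt with rfl | ht0
      · simpa using infDist_zero_of_mem ha
      have h1 := ih (2 / 3 * t) (by positivity) (by linarith) (by
        rw [pow_succ] at htd; linarith)
      have h2 := h.infDist_add_smul hK ha hu (t := t / 3) (d := 2 / 3 * t) (by positivity)
        (by linarith) h1 (by linarith)
      rwa [show 2 / 3 * t + t / 3 = t by ring] at h2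
  obtain ⟨n, hn⟩ := pow_unbounded_of_one_lt (t / d) (by norm_num : (1 : ℝ) < 3 / 2)
  exact main n t ht hτ ((div_le_iff₀ hd).1 hn.le)

/-- If the open balls of radius `t < τ` centred at `a + t • u` contain no point of `K`, then `K`
curves from the direction `u` at most like a sphere of radius `τ`. -/
lemma inner_le_of_infDist_ray {τ : ℝ} (hτ : 0 < τ) {K : Set V} {a b u : V} (hb : b ∈ K)
    (hu : ‖u‖ = 1) (h : ∀ t, 0 < t → t < τ → infDist (a + t • u) K = t) :
    inner ℝ (b - a) u ≤ ‖b - a‖ ^ 2 / (2 * τ) := by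
  rw [le_div_iff₀ (by positivity)]
  have key : ∀ t, 0 < t → t < τ → inner ℝ (b - a) u * (2 * t) ≤ ‖b - a‖ ^ 2 := by
    intro t ht htτ
    have h1 : t ≤ ‖(b - a) - t • u‖ := by
      rw [show (b - a) - t • u = b - (a + t • u) by abel, ← dist_eq_norm, dist_comm]
      exact (h t ht htτ).symm.le.trans (infDist_le_dist_of_mem hb)
    have h2 : t ^ 2 ≤ ‖(b - a) - t • u‖ ^ 2 := by gcongr
    rw [norm_sub_sq_real, norm_smul, hu, inner_smul_right, Real.norm_of_nonneg ht.le] at h2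
    nlinarith
  have hlim : Tendsto (fun t => inner ℝ (b - a) u * (2 * t)) (𝓝[<] τ)
      (𝓝 (inner ℝ (b - a) u * (2 * τ))) :=
    (Continuous.tendsto (by fun_prop) τ).mono_left nhdsWithin_le_nhds
  refine le_of_tendsto hlim ?_
  filter_upwards [Ioo_mem_nhdsLT hτ] with t ht using key t ht.1 ht.2

/-- Federer's inequality for the direction from a nearest point `a` to the projected point `p`. -/
lemma HasReach.inner_le [ProperSpace V] {τ : ℝ} {K : Set V} (hK : IsClosed K)
    (h : HasReach τ K) {p a b : V} (ha : IsNearest K p a) (hp : infDist p K < τ) (hb : b ∈ K) :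
    inner ℝ (b - a) (p - a) ≤ ‖p - a‖ * ‖b - a‖ ^ 2 / (2 * τ) := by
  rcases eq_or_ne p a with rfl | hpa
  · simp
  have hn : 0 < ‖p - a‖ := norm_pos_iff.2 (sub_ne_zero.2 hpa)
  have hd : ‖p - a‖ = infDist p K := by rw [← dist_eq_norm]; exact ha.2
  set u := ‖p - a‖⁻¹ • (p - a) with hu
  have hpu : p - a = ‖p - a‖ • u := by rw [hu, smul_smul, mul_inv_cancel₀ hn.ne', one_smul]
  have hun : ‖u‖ = 1 := by rw [hu, norm_smul, norm_inv, norm_norm, inv_mul_cancel₀ hn.ne']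
  have h1 := inner_le_of_infDist_ray (hn.trans_le (hd.trans_le hp.le)) hb hun
    fun t ht htτ => h.infDist_ray hK ha.1 hun hn
      (by rw [← hpu, add_sub_cancel, hd]) ht.le htτ
  calc inner ℝ (b - a) (p - a) = ‖p - a‖ * inner ℝ (b - a) u := by
        conv_lhs => rw [hpu]
        rw [inner_smul_right]
    _ ≤ ‖p - a‖ * (‖b - a‖ ^ 2 / (2 * τ)) := by gcongr
    _ = _ := by ring

/-- The metric projection is Lipschitz on offsets of radius below the reach. -/
lemma HasReach.norm_nearest_sub_le [ProperSpace V] {τ σ : ℝ} {K : Set V} (hK : IsClosed K)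
    (h : HasReach τ K) {p q a b : V} (ha : IsNearest K p a) (hb : IsNearest K q b)
    (hp : infDist p K ≤ σ) (hq : infDist q K ≤ σ) (hσ : σ < τ) :
    (1 - σ / τ) * ‖a - b‖ ≤ ‖p - q‖ := by
  have hσ0 : 0 ≤ σ := infDist_nonneg.trans hp
  have hτ : 0 < τ := hσ0.trans_lt hσ
  have h1 := h.inner_le hK ha (hp.trans_lt hσ) hb.1
  have h2 := h.inner_le hK hb (hq.trans_lt hσ) ha.1
  rw [norm_sub_rev b a] at h1
  have hpa : ‖p - a‖ ≤ σ := by rw [← dist_eq_norm, ha.2]; exact hp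
  have hqb : ‖q - b‖ ≤ σ := by rw [← dist_eq_norm, hb.2]; exact hq
  have h3 : ‖p - a‖ * ‖a - b‖ ^ 2 / (2 * τ) ≤ σ * ‖a - b‖ ^ 2 / (2 * τ) := by gcongr
  have h4 : ‖q - b‖ * ‖a - b‖ ^ 2 / (2 * τ) ≤ σ * ‖a - b‖ ^ 2 / (2 * τ) := by gcongr
  have e : inner ℝ (a - b) (p - q) =
      ‖a - b‖ ^ 2 - inner ℝ (b - a) (p - a) - inner ℝ (a - b) (q - b) := by
    rw [← real_inner_self_eq_norm_sq, show b - a = -(a - b) by abel, inner_neg_left,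
      show p - q = (p - a) - (q - b) + (a - b) by abel, inner_add_right, inner_sub_right]
    ring
  have h5 : (1 - σ / τ) * ‖a - b‖ ^ 2 ≤ ‖a - b‖ * ‖p - q‖ := by
    have h6 := real_inner_le_norm (a - b) (p - q)
    have h7 : σ * ‖a - b‖ ^ 2 / (2 * τ) = σ / τ * ‖a - b‖ ^ 2 / 2 := by field_simp
    rw [e] at h6
    linarith
  rcases (norm_nonneg (a - b)).eq_or_lt with h0 | h0
  · rw [← h0, mul_zero]; exact norm_nonneg _
  · exact le_of_mul_le_mul_left (by linarith) h0

end ReachTheory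


/-! ### Length of circular arcs -/

section ArcLength

/-- Length of the arc of a circle of radius `r` over a chord of length `c`. -/
noncomputable def arcLen (r c : ℝ) : ℝ := 2 * r * Real.arcsin (c / (2 * r))

lemma arcLen_nonneg {r c : ℝ} (hr : 0 < r) (hc : 0 ≤ c) : 0 ≤ arcLen r c :=
  mul_nonneg (by positivity) (Real.arcsin_nonneg.2 (by positivity))

lemma arcLen_mono {r c c' : ℝ} (hr : 0 < r) (h : c ≤ c') : arcLen r c ≤ arcLen r c' := by
  unfold arcLen
  gcongr

lemma le_arcLen {r c : ℝ} (hr : 0 < r) (hc : 0 ≤ c) (hcr : c ≤ 2 * r) : c ≤ arcLen r c := by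
  have h1 : c / (2 * r) ≤ 1 := (div_le_one (by positivity)).2 hcr
  have h0 : 0 ≤ c / (2 * r) := by positivity
  have h := Real.sin_le (Real.arcsin_nonneg.2 h0)
  rw [Real.sin_arcsin (by linarith) h1, div_le_iff₀ (by positivity)] at h
  unfold arcLen
  linarith

lemma arcLen_le {r c : ℝ} (hr : 0 < r) (hc : 0 ≤ c) (hcr : c ≤ 2 * r) :
    arcLen r c ≤ Real.pi / 2 * c := by
  have h1 : c / (2 * r) ≤ 1 := (div_le_one (by positivity)).2 hcr
  have h0 : 0 ≤ c / (2 * r) := by positivity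
  have h := Real.mul_le_sin (Real.arcsin_nonneg.2 h0) (Real.arcsin_le_pi_div_two _)
  rw [Real.sin_arcsin (by linarith) h1, le_div_iff₀ (by positivity)] at h
  have hpi := Real.pi_pos
  unfold arcLen
  calc 2 * r * Real.arcsin (c / (2 * r))
      = Real.pi / 2 * (2 / Real.pi * Real.arcsin (c / (2 * r)) * (2 * r)) := by field_simp
    _ ≤ Real.pi / 2 * c := by gcongr

/-- The graph of the sine lies below its tangents over `[0, π]`. -/
lemma sin_sub_sin_le {x y : ℝ} (hx : 0 ≤ x) (hx' : x ≤ Real.pi) (hy : 0 ≤ y) (hy' : y ≤ Real.pi) :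
    Real.sin x - Real.sin y ≤ Real.cos y * (x - y) := by
  have hcos : ∀ s t : ℝ, 0 ≤ s → s < t → t ≤ Real.pi →
      ∃ ξ, s < ξ ∧ ξ < t ∧ Real.sin t - Real.sin s = Real.cos ξ * (t - s) := by
    intro s t _ hst _
    obtain ⟨ξ, hξ, h⟩ := exists_deriv_eq_slope Real.sin hst Real.continuousOn_sin
      Real.differentiable_sin.differentiableOn
    refine ⟨ξ, hξ.1, hξ.2, ?_⟩
    rw [Real.deriv_sin] at h
    rw [h, div_mul_cancel₀ _ (by linarith)]
  rcases lt_trichotomy x y with h | rfl | h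
  · obtain ⟨ξ, h1, h2, e⟩ := hcos x y hx h hy'
    have := Real.cos_le_cos_of_nonneg_of_le_pi (hx.trans h1.le) hy' h2.le
    nlinarith
  · simp
  · obtain ⟨ξ, h1, h2, e⟩ := hcos y x hy h hx'
    have := Real.cos_le_cos_of_nonneg_of_le_pi hy (h2.le.trans hx') h1.le
    nlinarith

lemma sin_cube_le {θ : ℝ} (h0 : 0 ≤ θ) (h1 : θ ≤ Real.pi / 2) :
    Real.sin θ ^ 3 / 3 ≤ Real.sin θ - θ * Real.cos θ := by
  have hmono : MonotoneOn (fun x => Real.sin x - x * Real.cos x - Real.sin x ^ 3 / 3)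
      (Set.Icc 0 (Real.pi / 2)) := by
    have hd : ∀ x, HasDerivAt (fun x => Real.sin x - x * Real.cos x - Real.sin x ^ 3 / 3)
        (Real.sin x * (x - Real.sin x * Real.cos x)) x := by
      intro x
      have := (((Real.hasDerivAt_sin x).sub ((hasDerivAt_id x).mul (Real.hasDerivAt_cos x))).sub
        (((Real.hasDerivAt_sin x).pow 3).div_const 3))
      refine this.congr_deriv ?_
      simp only [id]
      norm_num
      ring
    refine monotoneOn_of_deriv_nonneg (convex_Icc _ _)
      (fun x _ => (hd x).continuousAt.continuousWithinAt)
      (fun x _ => (hd x).differentiableAt.differentiableWithinAt) fun x hx => ?_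
    rw [interior_Icc] at hx
    rw [(hd x).deriv]
    have hs := Real.sin_nonneg_of_nonneg_of_le_pi hx.1.le (by linarith [hx.2, Real.pi_pos])
    have hs' := Real.sin_le hx.1.le
    have hc := Real.cos_le_one x
    refine mul_nonneg hs ?_
    nlinarith
  have := hmono ⟨le_rfl, by positivity⟩ ⟨h0, h1⟩ h0
  simp at this
  linarith

/-- Quantitative monotonicity of the arc length in the radius: decreasing the radius `r` by `η`
makes up for an increase of the chord by `a` and for an additive error `b`. -/
lemma arcLen_add_le {r η c a b : ℝ} (hη : 0 ≤ η) (hηr : η < r) (hc : 0 ≤ c) (ha : 0 ≤ a)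
    (hb : 0 ≤ b) (hc0 : c ≤ 2 * (r - η)) (hca : c + a < 2 * r)
    (h : a + b ≤ 2 * η * ((c + a) / (2 * r)) ^ 3 / 3) :
    arcLen r (c + a) + b ≤ arcLen (r - η) c := by
  have hr : 0 < r := by linarith
  have hr0 : 0 < r - η := by linarith
  set t := (c + a) / (2 * r) with ht
  set t0 := c / (2 * (r - η)) with ht0
  have t_nn : 0 ≤ t := by positivity
  have t_lt : t < 1 := (div_lt_one (by positivity)).2 hca
  have t0_nn : 0 ≤ t0 := by positivity
  have t0_le : t0 ≤ 1 := (div_le_one (by positivity)).2 hc0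
  set θ := Real.arcsin t with hθ
  set θ0 := Real.arcsin t0 with hθ0
  have hsin : Real.sin θ = t := Real.sin_arcsin (by linarith) t_lt.le
  have hsin0 : Real.sin θ0 = t0 := Real.sin_arcsin (by linarith) t0_le
  have θ_nn : 0 ≤ θ := Real.arcsin_nonneg.2 t_nn
  have θ0_nn : 0 ≤ θ0 := Real.arcsin_nonneg.2 t0_nn
  have hpi := Real.pi_pos
  have θ_lt : θ < Real.pi / 2 := Real.arcsin_lt_pi_div_two.2 t_lt
  have θ0_le : θ0 ≤ Real.pi / 2 := Real.arcsin_le_pi_div_two _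
  have hcos : 0 < Real.cos θ := Real.cos_pos_of_mem_Ioo ⟨by linarith, θ_lt⟩
  have hcos1 : Real.cos θ ≤ 1 := Real.cos_le_one _
  have h1 := sin_sub_sin_le θ0_nn (by linarith) θ_nn (by linarith)
  have h2 := sin_cube_le θ_nn θ_lt.le
  rw [hsin, hsin0] at h1
  rw [hsin] at h2
  have e1 : 2 * r * t = c + a := by rw [ht]; field_simp
  have e2 : 2 * (r - η) * t0 = c := by rw [ht0]; field_simp
  -- the claim times `cos θ > 0`: the tangent of the sine at `θ` compares `θ0` with `θ`, and
  -- `sin_cube_le` bounds the gain `2 η (sin θ - θ cos θ)` from below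
  have h3 : (2 * r * θ + b) * Real.cos θ ≤ 2 * (r - η) * θ0 * Real.cos θ := by
    have h4 := mul_le_mul_of_nonneg_left h1 (by linarith : (0 : ℝ) ≤ 2 * (r - η))
    have h5 := mul_le_mul_of_nonneg_left h2 (by linarith : (0 : ℝ) ≤ 2 * η)
    have h6 : b * Real.cos θ ≤ b := mul_le_of_le_one_right hb hcos1
    nlinarith
  exact le_of_mul_le_mul_right h3 hcos

lemma arcLen_anti {r r' c : ℝ} (hr : 0 < r) (hrr : r ≤ r') (hc : 0 ≤ c) (hcr : c < 2 * r) :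
    arcLen r' c ≤ arcLen r c := by
  have := arcLen_add_le (r := r') (η := r' - r) (c := c) (a := 0) (b := 0) (by linarith)
    (by linarith) hc le_rfl le_rfl (by linarith) (by linarith) (by
      have : 0 ≤ 2 * (r' - r) := by linarith
      have : 0 < r' := by linarith
      simp only [add_zero]
      positivity)
  simpa using this

end ArcLength

/-! ### Projections of midpoints -/

section Midpoint

open Metric

variable {V : Type*} [NormedAddCommGroup V] [InnerProductSpace ℝ V]

lemma norm_sub_midpoint_sq (x y p : V) :
    ‖x - p‖ ^ 2 + ‖y - p‖ ^ 2 = ‖x - y‖ ^ 2 / 2 + 2 * ‖midpoint ℝ x y - p‖ ^ 2 := by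
  have h := parallelogram_law_with_norm ℝ (x - p) (y - p)
  have e1 : x - p + (y - p) = (2 : ℝ) • (midpoint ℝ x y - p) := by
    rw [midpoint_eq_smul_add, smul_sub, smul_smul]; norm_num; rw [two_smul]; abel
  have e2 : x - p - (y - p) = x - y := by abel
  rw [e1, e2, norm_smul] at h
  norm_num at h
  nlinarith

/-- For `K` of reach `τ`, the midpoint of a chord of `K` is at most as far from `K` as the midpoint
of the chord of the same length of a circle of radius `τ` is from this circle. -/
lemma HasReach.norm_midpoint_sub_le [ProperSpace V] {τ : ℝ} {K : Set V} (hK : IsClosed K)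
    (h : HasReach τ K) {x y p : V} (hx : x ∈ K) (hy : y ∈ K) (hxy : ‖x - y‖ < 2 * τ)
    (hp : IsNearest K (midpoint ℝ x y) p) :
    ‖midpoint ℝ x y - p‖ ≤ τ - √(τ ^ 2 - (‖x - y‖ / 2) ^ 2) := by
  set m := midpoint ℝ x y with hm
  set l := ‖x - y‖ / 2 with hl
  have hl0 : 0 ≤ l := by positivity
  have hlτ : l < τ := by rw [hl]; linarith
  have hτ : 0 < τ := hl0.trans_lt hlτ
  have hxm : ‖m - x‖ = l := by
    rw [← dist_eq_norm, hm, dist_midpoint_left, dist_eq_norm, hl]; norm_num; ring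
  have hdl : ‖m - p‖ ≤ l := by
    rw [← hxm, ← dist_eq_norm, ← dist_eq_norm, hp.2]; exact infDist_le_dist_of_mem hx
  have hmτ : infDist m K < τ := by rw [← hp.2, dist_eq_norm]; linarith
  have h1 := h.inner_le hK hp hmτ hx
  have h2 := h.inner_le hK hp hmτ hy
  set d := ‖m - p‖ with hd
  have hsum : ‖x - p‖ ^ 2 + ‖y - p‖ ^ 2 = 2 * l ^ 2 + 2 * d ^ 2 := by
    rw [norm_sub_midpoint_sq, hl]; ring
  have hin : inner ℝ (x - p) (m - p) + inner ℝ (y - p) (m - p) = 2 * d ^ 2 := by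
    rw [← inner_add_left, hd, ← real_inner_self_eq_norm_sq]
    have : x - p + (y - p) = (2 : ℝ) • (m - p) := by
      rw [hm, midpoint_eq_smul_add, smul_sub, smul_smul]; norm_num; rw [two_smul]; abel
    rw [this, inner_smul_left]; simp
  have h3 : 2 * d ^ 2 * (2 * τ) ≤ d * (2 * l ^ 2 + 2 * d ^ 2) := by
    have := add_le_add h1 h2
    rw [hin, ← add_div, ← mul_add, hsum, le_div_iff₀ (by positivity)] at this
    exact this
  set w := √(τ ^ 2 - l ^ 2) with hw
  have hw2 : w ^ 2 = τ ^ 2 - l ^ 2 := Real.sq_sqrt (by nlinarith)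
  have hw0 : 0 ≤ w := Real.sqrt_nonneg _
  rcases (norm_nonneg (m - p)).eq_or_lt with h0 | h0
  · have : w ≤ τ := by nlinarith
    rw [hd, ← h0]; linarith
  · have h4 : 2 * d * τ ≤ l ^ 2 + d ^ 2 := by
      have : d * (2 * d * τ) ≤ d * (l ^ 2 + d ^ 2) := by nlinarith
      exact le_of_mul_le_mul_left this h0
    have h5 : w ^ 2 ≤ (τ - d) ^ 2 := by nlinarith
    have := abs_le_of_sq_le_sq' h5 (by linarith)
    linarith [this.2]

/-- If two angles have at most the mean squared sine of two copies of `θ / 2`, then their sum is at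
most `θ`. -/
lemma add_le_of_sin_sq_add_sin_sq_le {α β θ : ℝ} (hα0 : 0 ≤ α) (hα1 : α ≤ Real.pi / 2)
    (hβ0 : 0 ≤ β) (hβ1 : β ≤ Real.pi / 2) (hθ0 : 0 ≤ θ) (hcθ0 : 0 < Real.cos θ)
    (hsq : Real.sin α ^ 2 + Real.sin β ^ 2 ≤ 1 - Real.cos θ) : α + β ≤ θ := by
  have hprod : Real.cos (α + β) * Real.cos (α - β) = 1 - Real.sin α ^ 2 - Real.sin β ^ 2 := by
    rw [Real.cos_add, Real.cos_sub]
    have ha := Real.cos_sq' α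
    have hb := Real.cos_sq' β
    calc _ = Real.cos α ^ 2 * Real.cos β ^ 2 - Real.sin α ^ 2 * Real.sin β ^ 2 := by ring
      _ = _ := by rw [ha, hb]; ring
  have hdiff0 : 0 ≤ Real.cos (α - β) :=
    Real.cos_nonneg_of_neg_pi_div_two_le_of_le (by linarith) (by linarith)
  have hdiff1 : Real.cos (α - β) ≤ 1 := Real.cos_le_one _
  have hcos : Real.cos θ ≤ Real.cos (α + β) := by
    have hpos : 0 ≤ Real.cos (α + β) := by
      by_contra! hneg
      have := mul_nonpos_of_nonpos_of_nonneg hneg.le hdiff0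
      linarith
    have := mul_le_of_le_one_right hpos hdiff1
    linarith
  by_contra! hlt
  have := Real.cos_lt_cos_of_nonneg_of_le_pi hθ0 (by linarith) hlt
  linarith

/-- The projection of the midpoint of a chord splits it into two shorter chords whose arcs of radius
`τ` together are not longer than the arc over the given chord. -/
lemma HasReach.arcLen_add_arcLen_le [ProperSpace V] {τ : ℝ} {K : Set V} (hK : IsClosed K)
    (h : HasReach τ K) {x y p : V} (hx : x ∈ K) (hy : y ∈ K) (hxy : ‖x - y‖ < 2 * τ)
    (hp : IsNearest K (midpoint ℝ x y) p) :
    arcLen τ ‖x - p‖ + arcLen τ ‖p - y‖ ≤ arcLen τ ‖x - y‖ ∧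
    ‖x - p‖ ≤ (1 + ‖x - y‖ / (2 * τ)) / 2 * ‖x - y‖ ∧
    ‖p - y‖ ≤ (1 + ‖x - y‖ / (2 * τ)) / 2 * ‖x - y‖ := by
  have hmp := h.norm_midpoint_sub_le hK hx hy hxy hp
  have hsum := norm_sub_midpoint_sq x y p
  rw [norm_sub_rev p y]
  have hxm : ‖x - midpoint ℝ x y‖ = ‖x - y‖ / 2 := by
    rw [← dist_eq_norm, dist_left_midpoint, dist_eq_norm]; norm_num; ring
  have hym : ‖y - midpoint ℝ x y‖ = ‖x - y‖ / 2 := by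
    rw [← dist_eq_norm, dist_comm, dist_midpoint_right, dist_eq_norm]; norm_num; ring
  have htx : ‖x - p‖ ≤ ‖x - midpoint ℝ x y‖ + ‖midpoint ℝ x y - p‖ :=
    norm_sub_le_norm_sub_add_norm_sub _ _ _
  have hty : ‖y - p‖ ≤ ‖y - midpoint ℝ x y‖ + ‖midpoint ℝ x y - p‖ :=
    norm_sub_le_norm_sub_add_norm_sub _ _ _
  set l := ‖x - y‖ / 2 with hl
  have hxyl : ‖x - y‖ = 2 * l := by rw [hl]; ring
  have hl0 : 0 ≤ l := by positivity
  have hlτ : l < τ := by rw [hl]; linarith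
  have hτ : 0 < τ := hl0.trans_lt hlτ
  set d := ‖midpoint ℝ x y - p‖ with hd
  have hd0 : 0 ≤ d := norm_nonneg _
  set w := √(τ ^ 2 - l ^ 2) with hw
  have hw2 : w ^ 2 = τ ^ 2 - l ^ 2 := Real.sq_sqrt (by nlinarith)
  have hw0 : 0 < w := Real.sqrt_pos.2 (by nlinarith)
  have hwτ : w ≤ τ := abs_le_of_sq_le_sq (by linarith [sq_nonneg l]) hτ.le |>.trans' (le_abs_self w)
  have hdτ : d * τ ≤ l ^ 2 := by
    have h1 : (τ - w) * τ ≤ (τ - w) * (τ + w) :=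
      mul_le_mul_of_nonneg_left (by linarith) (by linarith)
    have h2 : d * τ ≤ (τ - w) * τ := mul_le_mul_of_nonneg_right hmp hτ.le
    linarith [hw2]
  have hbound : l + d ≤ (1 + 2 * l / (2 * τ)) / 2 * (2 * l) := by
    have : d ≤ l ^ 2 / τ := (le_div_iff₀ hτ).2 hdτ
    calc l + d ≤ l + l ^ 2 / τ := by linarith
      _ = _ := by field_simp
  rw [hxyl]
  refine ⟨?_, by linarith, by linarith⟩
  have hd_l : d ≤ l := by
    have : l * l ≤ l * τ := mul_le_mul_of_nonneg_left hlτ.le hl0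
    exact le_of_mul_le_mul_right (by linarith [sq l] : d * τ ≤ l * τ) hτ
  have hxp2 : ‖x - p‖ / (2 * τ) ≤ 1 := (div_le_one (by positivity)).2 (by linarith)
  have hyp2 : ‖y - p‖ / (2 * τ) ≤ 1 := (div_le_one (by positivity)).2 (by linarith)
  have hl1 : 2 * l / (2 * τ) ≤ 1 := (div_le_one (by positivity)).2 (by linarith)
  unfold arcLen
  set α := Real.arcsin (‖x - p‖ / (2 * τ)) with hα
  set β := Real.arcsin (‖y - p‖ / (2 * τ)) with hβ
  set θ := Real.arcsin (2 * l / (2 * τ)) with hθ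
  have hsα : Real.sin α = ‖x - p‖ / (2 * τ) :=
    Real.sin_arcsin (by linarith [show 0 ≤ ‖x - p‖ / (2 * τ) by positivity]) hxp2
  have hsβ : Real.sin β = ‖y - p‖ / (2 * τ) :=
    Real.sin_arcsin (by linarith [show 0 ≤ ‖y - p‖ / (2 * τ) by positivity]) hyp2
  have hcθ : Real.cos θ = w / τ := by
    rw [hθ, Real.cos_arcsin, show 1 - (2 * l / (2 * τ)) ^ 2 = (w / τ) ^ 2 by
      rw [div_pow w, hw2]; field_simp]
    exact Real.sqrt_sq (by positivity)
  have hα0 : 0 ≤ α := Real.arcsin_nonneg.2 (by positivity)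
  have hβ0 : 0 ≤ β := Real.arcsin_nonneg.2 (by positivity)
  have hθ0 : 0 ≤ θ := Real.arcsin_nonneg.2 (by positivity)
  have hα1 : α ≤ Real.pi / 2 := Real.arcsin_le_pi_div_two _
  have hβ1 : β ≤ Real.pi / 2 := Real.arcsin_le_pi_div_two _
  have hθ1 : θ ≤ Real.pi / 2 := Real.arcsin_le_pi_div_two _
  have hsq : Real.sin α ^ 2 + Real.sin β ^ 2 ≤ 1 - Real.cos θ := by
    rw [hsα, hsβ, hcθ, div_pow, div_pow, ← add_div, hsum, hxyl, div_le_iff₀ (by positivity)]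
    have e : (1 - w / τ) * (2 * τ) ^ 2 = 4 * (τ - w) * τ := by field_simp; ring
    rw [e]
    have : d ^ 2 ≤ (τ - w) ^ 2 := pow_le_pow_left₀ hd0 hmp 2
    linarith [hw2]
  have hle : α + β ≤ θ := add_le_of_sin_sq_add_sin_sq_le hα0 hα1 hβ0 hβ1 hθ0
    (by rw [hcθ]; positivity) hsq
  calc 2 * τ * α + 2 * τ * β = 2 * τ * (α + β) := by ring
    _ ≤ 2 * τ * θ := by gcongr

end Midpoint


/-! ### Intrinsic distances -/

section Intrinsic

open Metric

variable {D : ℕ}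

lemma intrinsicDist_le_of_path {K : Set (E D)} {x y : E D} (γ : Path x y) (h : ∀ t, γ t ∈ K) :
    intrinsicDist K x y ≤ eVariationOn γ Set.univ :=
  iInf₂_le γ h

lemma exists_path_of_intrinsicDist_lt {K : Set (E D)} {x y : E D} {c : ℝ≥0∞}
    (h : intrinsicDist K x y < c) :
    ∃ γ : Path x y, (∀ t, γ t ∈ K) ∧ eVariationOn γ Set.univ < c := by
  obtain ⟨γ, h⟩ := iInf_lt_iff.1 h
  obtain ⟨hγ, h⟩ := iInf_lt_iff.1 h
  exact ⟨γ, hγ, h⟩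

lemma intrinsicDist_mono {K K' : Set (E D)} (h : K ⊆ K') (x y : E D) :
    intrinsicDist K' x y ≤ intrinsicDist K x y :=
  le_iInf₂ fun γ hγ => intrinsicDist_le_of_path γ fun t => h (hγ t)

lemma intrinsicDist_triangle (K : Set (E D)) (x y z : E D) :
    intrinsicDist K x z ≤ intrinsicDist K x y + intrinsicDist K y z := by
  refine ENNReal.le_of_forall_pos_le_add fun ε hε hfin => ?_
  have hε' : (ε : ℝ≥0∞) / 2 ≠ 0 := by simpa using hε.ne'
  obtain ⟨γ, hγ, hγl⟩ := exists_path_of_intrinsicDist_lt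
    (ENNReal.lt_add_right (ENNReal.add_lt_top.1 hfin).1.ne hε')
  obtain ⟨γ', hγ', hγl'⟩ := exists_path_of_intrinsicDist_lt
    (ENNReal.lt_add_right (ENNReal.add_lt_top.1 hfin).2.ne hε')
  have hmem : ∀ t, (γ.trans γ') t ∈ K := by
    intro t
    rw [Path.trans_apply]
    split_ifs
    · exact hγ _
    · exact hγ' _
  set half : unitInterval := ⟨1 / 2, by norm_num, by norm_num⟩ with hhalf
  have hun : eVariationOn (γ.trans γ') Set.univ =
      eVariationOn (γ.trans γ') (Set.Iic half) + eVariationOn (γ.trans γ') (Set.Ici half) := by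
    rw [← eVariationOn.union _ (x := half) ⟨Set.mem_Iic.2 le_rfl, fun _ h => h⟩
      ⟨Set.mem_Ici.2 le_rfl, fun _ h => h⟩, Set.Iic_union_Ici]
  have happ : ∀ t : unitInterval, (γ.trans γ') t =
      if (t : ℝ) ≤ 1 / 2 then γ.extend (2 * t) else γ'.extend (2 * t - 1) := fun t => rfl
  have h1 : eVariationOn (γ.trans γ') (Set.Iic half) ≤ eVariationOn γ Set.univ := by
    refine le_trans (le_of_eq ?_) (eVariationOn.comp_le_of_monotoneOn γ
      (t := Set.Iic half) (fun t : unitInterval => Set.projIcc (0 : ℝ) 1 zero_le_one (2 * (t : ℝ)))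
      ?_ fun _ _ => Set.mem_univ _)
    · refine eVariationOn.congr fun t ht => ?_
      rw [happ, if_pos (show (t : ℝ) ≤ 1 / 2 from ht)]
      rfl
    · intro s _ t _ hst
      exact Set.monotone_projIcc _ (by simpa using hst)
  have h2 : eVariationOn (γ.trans γ') (Set.Ici half) ≤ eVariationOn γ' Set.univ := by
    refine le_trans (le_of_eq ?_) (eVariationOn.comp_le_of_monotoneOn γ' (t := Set.Ici half)
      (fun t : unitInterval => Set.projIcc (0 : ℝ) 1 zero_le_one (2 * (t : ℝ) - 1))
      ?_ fun _ _ => Set.mem_univ _)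
    · refine eVariationOn.congr fun t ht => ?_
      rw [happ]
      split_ifs with ht'
      · have : (t : ℝ) = 1 / 2 := le_antisymm ht' ht
        rw [this, show (2 : ℝ) * (1 / 2) = 1 by norm_num, Path.extend_one,
          Function.comp_apply, this]
        norm_num
      · rfl
    · intro s _ t _ hst
      exact Set.monotone_projIcc _ (by simpa using hst)
  calc intrinsicDist K x z ≤ eVariationOn (γ.trans γ') Set.univ :=
        intrinsicDist_le_of_path _ hmem
    _ ≤ eVariationOn γ Set.univ + eVariationOn γ' Set.univ := by rw [hun]; gcongr
    _ ≤ (intrinsicDist K x y + ε / 2) + (intrinsicDist K y z + ε / 2) := by gcongr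
    _ = intrinsicDist K x y + intrinsicDist K y z + ε := by
        rw [add_add_add_comm, ENNReal.add_halves]

/-- A map which is Lipschitz on `K` increases intrinsic distances at most by its constant. -/
lemma intrinsicDist_image_le {K K' : Set (E D)} {f : E D → E D} {C : NNReal}
    (hf : LipschitzOnWith C f K) (hK : Set.MapsTo f K K') {x y : E D} {c : ℝ≥0∞}
    (h : intrinsicDist K x y < c) : intrinsicDist K' (f x) (f y) ≤ C * c := by
  obtain ⟨γ, hγ, hlt⟩ := exists_path_of_intrinsicDist_lt h
  let γ' : Path (f x) (f y) :=
    { toFun := f ∘ γ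
      continuous_toFun := hf.continuousOn.comp_continuous γ.continuous hγ
      source' := by simp
      target' := by simp }
  calc intrinsicDist K' (f x) (f y) ≤ eVariationOn (f ∘ γ) Set.univ :=
        intrinsicDist_le_of_path γ' fun t => hK (hγ t)
    _ ≤ C * eVariationOn γ Set.univ := hf.comp_eVariationOn_le fun t _ => hγ t
    _ ≤ C * c := by gcongr

/-- `x` and `y` are joined in `K` by a curve parametrized by `[0, l]` with speed at most `1`. -/
def JoinedByLength {V : Type*} [PseudoEMetricSpace V] (K : Set V) (x y : V) (l : ℝ) : Prop :=
  0 ≤ l ∧ ∃ g : ℝ → V, LipschitzWith 1 g ∧ g 0 = x ∧ g l = y ∧ ∀ t, 0 ≤ t → t ≤ l → g t ∈ K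

lemma JoinedByLength.trans {V : Type*} [PseudoMetricSpace V] {K : Set V} {x y z : V} {l l' : ℝ}
    (h : JoinedByLength K x y l) (h' : JoinedByLength K y z l') :
    JoinedByLength K x z (l + l') := by
  obtain ⟨hl, g, hg, g0, gl, gK⟩ := h
  obtain ⟨hl', g', hg', g0', gl', gK'⟩ := h'
  refine ⟨add_nonneg hl hl', fun t => if t ≤ l then g t else g' (t - l), ?_, ?_, ?_, ?_⟩
  · have key : ∀ s t, s ≤ t → dist (if s ≤ l then g s else g' (s - l))
        (if t ≤ l then g t else g' (t - l)) ≤ dist s t := by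
      intro s t hst
      split_ifs with h1 h2 h2
      · simpa using hg.dist_le_mul s t
      · have e1 := hg.dist_le_mul s l
        have e2 := hg'.dist_le_mul 0 (t - l)
        rw [gl] at e1
        rw [g0'] at e2
        have e3 := dist_triangle (g s) y (g' (t - l))
        simp only [Real.dist_eq, NNReal.coe_one, one_mul] at e1 e2 ⊢
        rw [abs_of_nonpos (by linarith)] at e1 e2 ⊢
        linarith
      · linarith
      · simpa [Real.dist_eq] using hg'.dist_le_mul (s - l) (t - l)
    refine LipschitzWith.of_dist_le_mul fun s t => ?_
    rw [NNReal.coe_one, one_mul]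
    rcases le_total s t with h | h
    · exact key s t h
    · rw [dist_comm, dist_comm s t]; exact key t s h
  · simp [hl, g0]
  · rcases hl'.eq_or_lt with rfl | h0
    · simp [gl, ← gl', g0']
    · simp [h0.not_ge, gl']
  · intro t ht htl
    dsimp only
    split_ifs with h
    · exact gK t ht h
    · exact gK' _ (by linarith) (by linarith)

lemma joinedByLength_of_segment {V : Type*} [NormedAddCommGroup V] [NormedSpace ℝ V] {K : Set V}
    {x y : V} {l : ℝ} (hl : ‖x - y‖ ≤ l) (h : segment ℝ x y ⊆ K) : JoinedByLength K x y l := by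
  refine ⟨(norm_nonneg _).trans hl, ?_⟩
  rcases ((norm_nonneg _).trans hl).eq_or_lt with rfl | hl0
  · have : x = y := by rw [← sub_eq_zero, ← norm_le_zero_iff]; exact hl
    subst this
    exact ⟨fun _ => x, LipschitzWith.const _ |>.weaken zero_le_one, rfl, rfl,
      fun _ _ _ => h (left_mem_segment ℝ x x)⟩
  · refine ⟨fun t => AffineMap.lineMap x y (t / l), ?_, by simp, by simp [hl0.ne'],
      fun t ht htl => ?_⟩
    · refine LipschitzWith.of_dist_le_mul fun s t => ?_
      rw [dist_lineMap_lineMap, Real.dist_eq, Real.dist_eq, ← sub_div, abs_div, abs_of_pos hl0,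
        dist_eq_norm, NNReal.coe_one, one_mul, div_mul_eq_mul_div, div_le_iff₀ hl0]
      gcongr
    · refine h ?_
      rw [segment_eq_image_lineMap]
      exact ⟨t / l, ⟨by positivity, (div_le_one hl0).2 htl⟩, rfl⟩

lemma JoinedByLength.mono {V : Type*} [NormedAddCommGroup V] [NormedSpace ℝ V] {K : Set V}
    {x y : V} {l l' : ℝ} (h : JoinedByLength K x y l) (hl : l ≤ l') : JoinedByLength K x y l' := by
  have hy : y ∈ K := by
    obtain ⟨h0, g, -, -, rfl, hg⟩ := h
    exact hg l h0 le_rfl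
  have h' : JoinedByLength K y y (l' - l) :=
    joinedByLength_of_segment (by simpa using hl) (by simpa using hy)
  simpa using h.trans h'

/-- A limit of curves of bounded length which come closer and closer to the closed set `K`. -/
lemma joinedByLength_of_forall_pos {V : Type*} [MetricSpace V] [ProperSpace V] {K : Set V}
    (hK : IsClosed K) (hne : K.Nonempty) {x y : V} {l : ℝ}
    (h : ∀ η > 0, JoinedByLength {z | infDist z K ≤ η} x y l) : JoinedByLength K x y l := by
  refine ⟨(h 1 one_pos).1, ?_⟩
  choose g hg g0 gl gK using fun n : ℕ => (h (1 / ((n : ℝ) + 1)) (by positivity)).2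
  -- the limit is taken along an ultrafilter, pointwise
  have hlim : ∀ t, ∃ c, Tendsto (fun n => g n t) (hyperfilter ℕ : Filter ℕ) (𝓝 c) := by
    intro t
    have hb : ∀ n, g n t ∈ closedBall x |t| := by
      intro n
      have := (hg n).dist_le_mul t 0
      rw [g0] at this
      simpa using this
    obtain ⟨c, -, hc⟩ := (isCompact_closedBall x |t|).ultrafilter_le_nhds
      ((hyperfilter ℕ).map fun n => g n t)
      (by rw [Ultrafilter.coe_map, le_principal_iff]; exact mem_map.2 (univ_mem' hb))
    exact ⟨c, hc⟩
  choose G hG using hlim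
  refine ⟨G, ?_, ?_, ?_, fun t ht htl => ?_⟩
  · refine LipschitzWith.of_dist_le_mul fun s t => ?_
    exact le_of_tendsto' ((hG s).dist (hG t)) fun n => (hg n).dist_le_mul s t
  · exact tendsto_nhds_unique (hG 0) (by simp only [g0]; exact tendsto_const_nhds)
  · exact tendsto_nhds_unique (hG l) (by simp only [gl]; exact tendsto_const_nhds)
  · rw [hK.mem_iff_infDist_zero hne]
    refine le_antisymm ?_ infDist_nonneg
    have h1 := ((continuous_infDist_pt K).tendsto (G t)).comp (hG t)
    have h2 : Tendsto (fun n : ℕ => 1 / ((n : ℝ) + 1)) (hyperfilter ℕ : Filter ℕ) (𝓝 0) :=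
      tendsto_one_div_add_atTop_nhds_zero_nat.mono_left Nat.hyperfilter_le_atTop
    exact le_of_tendsto_of_tendsto' h1 h2 fun n => gK n t ht htl

lemma JoinedByLength.intrinsicDist_le {K : Set (E D)} {x y : E D} {l : ℝ}
    (h : JoinedByLength K x y l) : intrinsicDist K x y ≤ ENNReal.ofReal l := by
  obtain ⟨hl, g, hg, g0, gl, gK⟩ := h
  let γ : Path x y :=
    { toFun := fun t => g (l * t)
      continuous_toFun := hg.continuous.comp (by fun_prop)
      source' := by simp [g0]
      target' := by simp [gl] }
  refine (intrinsicDist_le_of_path γ fun t => gK _ (mul_nonneg hl t.2.1)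
    (mul_le_of_le_one_right hl t.2.2)).trans ?_
  have h1 := (hg.lipschitzOnWith (s := Set.univ)).comp_eVariationOn_le
    (g := fun t : unitInterval => l * (t : ℝ)) (s := Set.univ) (Set.mapsTo_univ _ _)
  have hmono : MonotoneOn (fun t : unitInterval => l * (t : ℝ)) Set.univ :=
    fun s _ t _ hst => mul_le_mul_of_nonneg_left hst hl
  have h2 := hmono.eVariationOn_eq (Set.mem_univ 0) (Set.mem_univ 1)
  have h3 : (Set.univ ∩ Set.Icc (0 : unitInterval) 1) = Set.univ := by
    ext t; simp [unitInterval.le_one']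
  rw [h3] at h2
  refine le_trans h1 (le_of_eq ?_)
  simpa using h2

lemma intrinsicDist_le_of_segment {K : Set (E D)} {x y : E D} (h : segment ℝ x y ⊆ K) :
    intrinsicDist K x y ≤ ENNReal.ofReal ‖x - y‖ :=
  (joinedByLength_of_segment le_rfl h).intrinsicDist_le

/-- Repeated projection of midpoints joins two points of a set of positive reach by polygons which
are not longer than an arc of a circle and stay arbitrarily close to the set. -/
lemma HasReach.joinedByLength_offset {V : Type*} [NormedAddCommGroup V] [InnerProductSpace ℝ V]
    [ProperSpace V] {τ η : ℝ} {K : Set V} (hK : IsClosed K) (h : HasReach τ K)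
    {c₀ : ℝ} (hc₀ : c₀ < 2 * τ) (hτ : 0 < τ) (n : ℕ) :
    ∀ x ∈ K, ∀ y ∈ K, ‖x - y‖ ≤ c₀ → ((1 + c₀ / (2 * τ)) / 2) ^ n * ‖x - y‖ ≤ η →
      JoinedByLength {z | infDist z K ≤ η} x y (arcLen τ ‖x - y‖) := by
  induction n with
  | zero =>
    intro x hx y hy hxy hn
    rw [pow_zero, one_mul] at hn
    refine joinedByLength_of_segment (le_arcLen hτ (norm_nonneg _) (by linarith)) fun z hz => ?_
    refine (infDist_le_dist_of_mem hx).trans (le_trans ?_ hn)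
    rw [segment_eq_image_lineMap] at hz
    obtain ⟨t, ht, rfl⟩ := hz
    rw [dist_lineMap_left, Real.norm_of_nonneg ht.1, ← dist_eq_norm]
    exact mul_le_of_le_one_left dist_nonneg ht.2
  | succ n ih =>
    intro x hx y hy hxy hn
    obtain ⟨p, hp⟩ := exists_isNearest hK ⟨x, hx⟩ (midpoint ℝ x y)
    obtain ⟨h1, h2, h3⟩ := h.arcLen_add_arcLen_le hK hx hy (by linarith) hp
    set q := (1 + c₀ / (2 * τ)) / 2 with hq
    have hc0 : 0 ≤ c₀ := (norm_nonneg _).trans hxy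
    have hq0 : 0 ≤ q := by positivity
    have hq1 : q ≤ 1 := by
      have : c₀ / (2 * τ) ≤ 1 := (div_le_one (by positivity)).2 hc₀.le
      rw [hq]; linarith
    have hle : (1 + ‖x - y‖ / (2 * τ)) / 2 * ‖x - y‖ ≤ q * ‖x - y‖ := by
      rw [hq]; gcongr
    have hstep : ∀ c, c ≤ q * ‖x - y‖ → c ≤ c₀ ∧ q ^ n * c ≤ η := by
      intro c hc
      refine ⟨hc.trans ((mul_le_of_le_one_left (norm_nonneg _) hq1).trans hxy), ?_⟩
      calc q ^ n * c ≤ q ^ n * (q * ‖x - y‖) := by gcongr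
        _ ≤ η := by rw [← mul_assoc, ← pow_succ]; exact hn
    obtain ⟨h4, h5⟩ := hstep _ (h2.trans hle)
    obtain ⟨h6, h7⟩ := hstep _ (h3.trans hle)
    exact ((ih x hx p hp.1 h4 h5).trans (ih p hp.1 y hy h6 h7)).mono h1

/-- In a set of reach at least `τ`, intrinsic distances are at most those on a sphere of radius
`τ`. -/
lemma HasReach.intrinsicDist_le {τ : ℝ} {K : Set (E D)} (hK : IsClosed K) (h : HasReach τ K)
    {x y : E D} (hx : x ∈ K) (hy : y ∈ K) (hxy : ‖x - y‖ < 2 * τ) :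
    intrinsicDist K x y ≤ ENNReal.ofReal (arcLen τ ‖x - y‖) := by
  have hτ : 0 < τ := by linarith [norm_nonneg (x - y)]
  refine (joinedByLength_of_forall_pos hK ⟨x, hx⟩ fun η hη => ?_).intrinsicDist_le
  have hq1 : (1 + ‖x - y‖ / (2 * τ)) / 2 < 1 := by
    have : ‖x - y‖ / (2 * τ) < 1 := (div_lt_one (by positivity)).2 hxy
    linarith
  have hlim := (tendsto_pow_atTop_nhds_zero_of_lt_one
    (r := (1 + ‖x - y‖ / (2 * τ)) / 2) (by positivity) hq1).mul_const ‖x - y‖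
  rw [zero_mul] at hlim
  obtain ⟨n, hn⟩ := (hlim.eventually_le_const hη).exists
  exact h.joinedByLength_offset hK hxy hτ n x hx y hy le_rfl hn

end Intrinsic

/-! ### Bottlenecks -/

section Bottleneck

open Metric InnerProductGeometry

/-- A chord outside a ball of radius `τ` is at least as long as the chord of the sphere of radius `τ`
over the same central angle. -/
lemma two_mul_sin_half_angle_le {V : Type*} [NormedAddCommGroup V] [InnerProductSpace ℝ V]
    {τ : ℝ} (hτ : 0 ≤ τ) {v w : V} (hv : τ ≤ ‖v‖) (hw : τ ≤ ‖w‖) :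
    2 * τ * Real.sin (angle v w / 2) ≤ ‖v - w‖ := by
  have h1 : ‖v - w‖ ^ 2 = ‖v‖ ^ 2 - 2 * (‖v‖ * ‖w‖ * Real.cos (angle v w)) + ‖w‖ ^ 2 := by
    rw [norm_sub_sq_real, ← cos_angle_mul_norm_mul_norm v w]; ring
  have h2 : Real.cos (angle v w) = 1 - 2 * Real.sin (angle v w / 2) ^ 2 := by
    have := Real.cos_two_mul (angle v w / 2)
    rw [show 2 * (angle v w / 2) = angle v w by ring] at this
    rw [this, Real.cos_sq']; ring
  have h3 : τ * τ ≤ ‖v‖ * ‖w‖ := mul_le_mul hv hw hτ (norm_nonneg _)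
  refine le_of_sq_le_sq ?_ (norm_nonneg _)
  have h4 : (2 * τ * Real.sin (angle v w / 2)) ^ 2
      ≤ 4 * (‖v‖ * ‖w‖) * Real.sin (angle v w / 2) ^ 2 := by
    have := mul_le_mul_of_nonneg_right h3 (sq_nonneg (Real.sin (angle v w / 2)))
    linarith
  rw [h1, h2]
  linarith [sq_nonneg (‖v‖ - ‖w‖)]

/-- The angle at the centre of a ball of radius `τ` of a short chord outside this ball is almost at
most the length of the chord divided by `τ`. -/
lemma mul_angle_le_norm_sub {V : Type*} [NormedAddCommGroup V] [InnerProductSpace ℝ V]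
    {τ η : ℝ} (hτ : 0 < τ) (hη : η ≤ 1) {v w : V} (hv : τ ≤ ‖v‖) (hw : τ ≤ ‖w‖)
    (h : ‖v - w‖ ≤ 2 * τ / Real.pi * η) : τ * (1 - η) * angle v w ≤ ‖v - w‖ := by
  have h1 := two_mul_sin_half_angle_le hτ.le hv hw
  have h0 := angle_nonneg v w
  have hpi := angle_le_pi v w
  set A := angle v w
  have h2 := Real.mul_le_sin (x := A / 2) (by linarith) (by linarith)
  have hA : A ≤ η := by
    have h3 : 2 * τ * (2 / Real.pi * (A / 2)) ≤ 2 * τ / Real.pi * η := by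
      refine le_trans ?_ (h1.trans h)
      gcongr
    have h4 : 2 * τ * (2 / Real.pi * (A / 2)) = 2 * τ / Real.pi * A := by ring
    rw [h4] at h3
    exact le_of_mul_le_mul_left h3 (by have := Real.pi_pos; positivity)
  refine le_trans ?_ h1
  rcases h0.eq_or_lt with h0 | h0
  · simp [← h0]
  have h5 := Real.sin_gt_sub_cube (x := A / 2) (by linarith)
  have h6 : A / 2 * (1 - η) ≤ Real.sin (A / 2) := by
    refine le_trans ?_ h5.le
    have : (A / 2) ^ 3 / 6 ≤ A / 2 * η := by
      have e : (A / 2) ^ 3 / 6 = A / 2 * (A * A / 24) := by ring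
      rw [e]
      have : A * A / 24 ≤ η := by nlinarith
      gcongr
    linarith
  nlinarith

/-- A path outside an open ball of radius `τ` which joins opposite directions as seen from the
centre has length at least `π τ`. -/
lemma pi_mul_le_eVariationOn {V : Type*} [NormedAddCommGroup V] [InnerProductSpace ℝ V]
    {τ : ℝ} (hτ : 0 < τ) {x y z : V} (γ : Path x y) (h : ∀ t, τ ≤ ‖γ t - z‖)
    (hxy : angle (x - z) (y - z) = Real.pi) :
    ENNReal.ofReal (Real.pi * τ) ≤ eVariationOn γ Set.univ := by
  have hpi := Real.pi_pos
  -- along a fine partition the central angles add up to at least `π`, and each of them is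
  -- controlled by the length of its chord up to a factor `1 - η`
  have key : ∀ η, 0 < η → η < 1 →
      ENNReal.ofReal (τ * (1 - η) * Real.pi) ≤ eVariationOn γ Set.univ := by
    intro η hη hη1
    have huc := CompactSpace.uniformContinuous_of_continuous γ.continuous
    obtain ⟨s, hs, H⟩ := Metric.uniformContinuous_iff.1 huc (2 * τ / Real.pi * η) (by positivity)
    obtain ⟨N, hN⟩ := exists_nat_one_div_lt hs
    set u : ℕ → unitInterval := fun i => Set.projIcc (0 : ℝ) 1 zero_le_one (i / ((N : ℝ) + 1))
      with hu
    have hmono : Monotone u := fun i j hij => Set.monotone_projIcc _ (by gcongr)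
    have hu0 : γ (u 0) = x := by
      have : u 0 = 0 := by simp [hu, Set.projIcc_left]
      rw [this, γ.source]
    have huN : γ (u (N + 1)) = y := by
      have : u (N + 1) = 1 := by
        simp only [hu]
        push_cast
        rw [div_self (by positivity)]
        simp [Set.projIcc_right]
      rw [this, γ.target]
    have hstep : ∀ i, ‖γ (u (i + 1)) - γ (u i)‖ ≤ 2 * τ / Real.pi * η := by
      intro i
      rw [← dist_eq_norm]
      refine (H ?_).le
      refine lt_of_le_of_lt ?_ hN
      refine ((LipschitzWith.projIcc (zero_le_one (α := ℝ))).dist_le_mul _ _).trans (le_of_eq ?_)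
      rw [NNReal.coe_one, one_mul, Real.dist_eq, ← sub_div]
      push_cast
      rw [show (i : ℝ) + 1 - i = 1 by ring, abs_of_nonneg (by positivity)]
    have hang : ∀ n, τ * (1 - η) * angle (x - z) (γ (u n) - z) ≤
        ∑ i ∈ Finset.range n, ‖γ (u (i + 1)) - γ (u i)‖ := by
      intro n
      induction n with
      | zero =>
        rw [hu0, angle_self, mul_zero, Finset.sum_range_zero]
        intro h0
        have := h 0
        rw [γ.source, h0, norm_zero] at this
        linarith
      | succ n ih =>
        rw [Finset.sum_range_succ]
        have h1 := InnerProductGeometry.angle_le_angle_add_angle (x - z) (γ (u n) - z)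
          (γ (u (n + 1)) - z)
        have h2 := mul_angle_le_norm_sub hτ hη1.le (h (u (n + 1))) (h (u n))
          (by simpa using hstep n)
        rw [sub_sub_sub_cancel_right, angle_comm] at h2
        have h3 : 0 ≤ τ * (1 - η) := mul_nonneg hτ.le (by linarith)
        nlinarith [mul_le_mul_of_nonneg_left h1 h3]
    have h1 := hang (N + 1)
    rw [huN, hxy] at h1
    calc ENNReal.ofReal (τ * (1 - η) * Real.pi)
        ≤ ENNReal.ofReal (∑ i ∈ Finset.range (N + 1), ‖γ (u (i + 1)) - γ (u i)‖) :=
          ENNReal.ofReal_le_ofReal h1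
      _ = ∑ i ∈ Finset.range (N + 1), edist (γ (u (i + 1))) (γ (u i)) := by
          rw [ENNReal.ofReal_sum_of_nonneg fun _ _ => norm_nonneg _]
          simp only [edist_dist, dist_eq_norm]
      _ ≤ _ := eVariationOn.sum_le hmono fun _ => Set.mem_univ _
  have hlim : Tendsto (fun η : ℝ => ENNReal.ofReal (τ * (1 - η) * Real.pi)) (𝓝[>] 0)
      (𝓝 (ENNReal.ofReal (τ * (1 - 0) * Real.pi))) :=
    ENNReal.tendsto_ofReal ((Continuous.tendsto (by fun_prop) 0).mono_left nhdsWithin_le_nhds)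
  rw [show τ * (1 - 0) * Real.pi = Real.pi * τ by ring] at hlim
  refine le_of_tendsto hlim ?_
  filter_upwards [Ioo_mem_nhdsGT one_pos] with η hη using key η hη.1 hη.2

lemma arcLen_two_mul_lt {τ r : ℝ} (hτ : 0 < τ) (hr : τ < r) : arcLen r (2 * τ) < Real.pi * τ := by
  have hr0 : 0 < r := hτ.trans hr
  have ht0 : 0 < 2 * τ / (2 * r) := by positivity
  have ht1 : 2 * τ / (2 * r) < 1 := (div_lt_one (by positivity)).2 (by linarith)
  have h := Real.mul_lt_sin (Real.arcsin_pos.2 ht0) (Real.arcsin_lt_pi_div_two.2 ht1)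
  rw [Real.sin_arcsin (by linarith) ht1.le, lt_div_iff₀ (by positivity)] at h
  have hpi := Real.pi_pos
  unfold arcLen
  calc 2 * r * Real.arcsin (2 * τ / (2 * r))
      = Real.pi / 2 * (2 / Real.pi * Real.arcsin (2 * τ / (2 * r)) * (2 * r)) := by field_simp
    _ < Real.pi / 2 * (2 * τ) := by gcongr
    _ = _ := by ring

variable {D : ℕ}

/-- A bottleneck, that is a point whose nearest points include two antipodal ones, bounds the
spherical distortion radius. -/
lemma sdr_le_of_bottleneck {δ τ : ℝ} {K : Set (E D)} (hτ : 0 < τ) (hδ : δ ≤ 2 * τ) {z a b : E D}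
    (ha : IsNearest K z a) (hb : IsNearest K z b) (hz : infDist z K = τ) (hab : 2 * τ ≤ ‖a - b‖) :
    sdr δ K (intrinsicDist K) ≤ ENNReal.ofReal τ := by
  have haz : ‖a - z‖ = τ := by rw [← dist_eq_norm, dist_comm, ha.2, hz]
  have hbz : ‖b - z‖ = τ := by rw [← dist_eq_norm, dist_comm, hb.2, hz]
  have hab' : ‖a - b‖ = 2 * τ := by
    refine le_antisymm ?_ hab
    have := norm_sub_le (a - z) (b - z)
    rw [sub_sub_sub_cancel_right] at this
    linarith
  have hang : angle (a - z) (b - z) = Real.pi := by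
    rw [angle, haz, hbz]
    have h1 := norm_sub_sq_real (a - z) (b - z)
    rw [sub_sub_sub_cancel_right, haz, hbz, hab'] at h1
    have h2 : inner ℝ (a - z) (b - z) = -(τ * τ) := by linarith
    rw [h2, neg_div, div_self (by positivity), Real.arccos_neg_one]
  refine iSup₂_le fun r ⟨hr, h⟩ => ENNReal.ofReal_le_ofReal ?_
  by_contra! hlt
  have h1 := h a ha.1 b hb.1 (by rw [hab']; exact hδ) (by rw [hab']; linarith)
  have h2 : sphereDist r a b = arcLen r (2 * τ) := by rw [← hab']; rfl
  have h3 : ENNReal.ofReal (Real.pi * τ) ≤ intrinsicDist K a b := by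
    refine le_iInf₂ fun γ hγ => pi_mul_le_eVariationOn hτ γ (z := z) (fun t => ?_) hang
    rw [← dist_eq_norm, dist_comm, ← hz]
    exact infDist_le_dist_of_mem (hγ t)
  have h4 := h3.trans h1
  rw [h2, ENNReal.ofReal_le_ofReal_iff (arcLen_nonneg hr (by positivity))] at h4
  exact absurd (arcLen_two_mul_lt hτ hlt) (not_lt.2 h4)

/-- If a point at distance `τ` from a set of reach `τ` has two nearest points which are not
antipodal, then the projection of their midpoint is again a nearest point of it; hence each of them
is a limit of further nearest points. -/
lemma HasReach.exists_isNearest_norm_sub_lt {V : Type*} [NormedAddCommGroup V]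
    [InnerProductSpace ℝ V] [ProperSpace V] {τ : ℝ} {K : Set V} (hK : IsClosed K)
    (h : HasReach τ K) {z a b : V} (ha : IsNearest K z a) (hb : IsNearest K z b) (hne : b ≠ a)
    (hz : infDist z K = τ) (hab : ‖a - b‖ < 2 * τ) {η : ℝ} (hη : 0 < η) :
    ∃ b', IsNearest K z b' ∧ b' ≠ a ∧ ‖a - b'‖ < η := by
  have hτ : 0 < τ := by linarith [norm_nonneg (a - b)]
  set q := (1 + ‖a - b‖ / (2 * τ)) / 2 with hq
  have hq0 : 0 ≤ q := by positivity
  have hq1 : q < 1 := by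
    have : ‖a - b‖ / (2 * τ) < 1 := (div_lt_one (by positivity)).2 hab
    rw [hq]; linarith
  have main : ∀ n : ℕ, ∃ b', IsNearest K z b' ∧ b' ≠ a ∧ ‖a - b'‖ ≤ q ^ n * ‖a - b‖ := by
    intro n
    induction n with
    | zero => exact ⟨b, hb, hne, by simp⟩
    | succ n ih =>
      obtain ⟨b', hb', hne', hle⟩ := ih
      have hle1 : ‖a - b'‖ ≤ ‖a - b‖ :=
        hle.trans (mul_le_of_le_one_left (norm_nonneg _) (pow_le_one₀ hq0 hq1.le))
      have hlt : ‖a - b'‖ < 2 * τ := hle1.trans_lt hab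
      obtain ⟨p, hp⟩ := exists_isNearest hK ⟨a, ha.1⟩ (midpoint ℝ a b')
      have h1 := h.norm_midpoint_sub_le hK ha.1 hb'.1 hlt hp
      obtain ⟨-, h2, h3⟩ := h.arcLen_add_arcLen_le hK ha.1 hb'.1 hlt hp
      have hpos : 0 < ‖a - b'‖ := norm_pos_iff.2 (sub_ne_zero.2 hne'.symm)
      have hqq : (1 + ‖a - b'‖ / (2 * τ)) / 2 ≤ q := by rw [hq]; gcongr
      -- the midpoint is close to `z` by Pythagoras and to `p` by the bound on the reach, and the two
      -- distances add up to at most `τ`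
      refine ⟨p, ⟨hp.1, le_antisymm ?_ (infDist_le_dist_of_mem hp.1)⟩, ?_, ?_⟩
      · have e1 := norm_sub_midpoint_sq a b' z
        have e2 : ‖a - z‖ = τ := by rw [← dist_eq_norm, dist_comm, ha.2, hz]
        have e3 : ‖b' - z‖ = τ := by rw [← dist_eq_norm, dist_comm, hb'.2, hz]
        rw [e2, e3] at e1
        have e4 : ‖midpoint ℝ a b' - z‖ = √(τ ^ 2 - (‖a - b'‖ / 2) ^ 2) := by
          rw [eq_comm, Real.sqrt_eq_iff_eq_sq (by nlinarith) (norm_nonneg _)]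
          linarith
        rw [← dist_eq_norm, dist_comm] at e4
        have e5 := dist_triangle z (midpoint ℝ a b') p
        rw [dist_eq_norm (midpoint ℝ a b') p] at e5
        rw [hz]
        linarith
      · rintro rfl
        have := h3.trans (mul_le_mul_of_nonneg_right hqq hpos.le)
        nlinarith
      · calc ‖a - p‖ ≤ q * ‖a - b'‖ := h2.trans (mul_le_mul_of_nonneg_right hqq hpos.le)
          _ ≤ q * (q ^ n * ‖a - b‖) := by gcongr
          _ = _ := by ring
  have hlim := (tendsto_pow_atTop_nhds_zero_of_lt_one hq0 hq1).mul_const ‖a - b‖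
  rw [zero_mul] at hlim
  obtain ⟨n, hn⟩ := (hlim.eventually_lt_const hη).exists
  obtain ⟨b', h1, h2, h3⟩ := main n
  exact ⟨b', h1, h2, h3.trans_lt hn⟩

lemma edist_eq_infEDist_iff {X : Type*} [MetricSpace X] {K : Set X} (hne : K.Nonempty) (z a : X) :
    edist z a = infEDist z K ↔ dist z a = infDist z K := by
  rw [dist_edist, infDist, ENNReal.toReal_eq_toReal_iff' (edist_ne_top _ _) (infEDist_ne_top hne)]

lemma mem_medialAxis_iff {K : Set (E D)} {z : E D} :
    z ∈ medialAxis K ↔ ∃ a b, a ≠ b ∧ IsNearest K z a ∧ IsNearest K z b := by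
  constructor
  · rintro ⟨a, ha, b, hb, hab, h1, h2⟩
    exact ⟨a, b, hab, ⟨ha, (edist_eq_infEDist_iff ⟨a, ha⟩ z a).1 h1⟩,
      hb, (edist_eq_infEDist_iff ⟨a, ha⟩ z b).1 h2⟩
  · rintro ⟨a, b, hab, ⟨ha, h1⟩, hb, h2⟩
    exact ⟨a, ha, b, hb, hab, (edist_eq_infEDist_iff ⟨a, ha⟩ z a).2 h1,
      (edist_eq_infEDist_iff ⟨a, ha⟩ z b).2 h2⟩

lemma hasReach_of_le_reach {τ : ℝ} {K : Set (E D)} (h : ENNReal.ofReal τ ≤ reach K) :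
    HasReach τ K := by
  intro z a b ha hb hz
  by_contra hab
  have h1 : reach K ≤ infEDist z K := iInf₂_le z (mem_medialAxis_iff.2 ⟨a, b, hab, ha, hb⟩)
  have h2 : infEDist z K < ENNReal.ofReal τ := by
    rw [infDist] at hz
    exact (ENNReal.lt_ofReal_iff_toReal_lt (infEDist_ne_top ⟨a, ha.1⟩)).2 hz
  exact absurd (h.trans h1) (not_le.2 h2)

end Bottleneck

/-! ### Tangent spaces and local shape of submanifolds -/

section Submanifold

open Metric

variable {D d k : ℕ} {M : Set (E D)}

/-- `Φ` is a local `C²` diffeomorphism which straightens `M` to the `d`-dimensional subspace `W`. -/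
structure IsStraightening (d : ℕ) (M : Set (E D)) (Φ : OpenPartialHomeomorph (E D) (E D))
    (W : Submodule ℝ (E D)) : Prop where
  contDiffAt : ∀ y ∈ Φ.source, ContDiffAt ℝ 2 Φ y
  contDiffAt_symm : ∀ q ∈ Φ.target, ContDiffAt ℝ 2 Φ.symm q
  finrank_eq : Module.finrank ℝ W = d
  mem_iff : ∀ y ∈ Φ.source, y ∈ M ↔ Φ y ∈ W

lemma IsSubmanifold.exists_straightening (hM : IsSubmanifold d k M) (hk : 2 ≤ k) {a : E D}
    (ha : a ∈ M) : ∃ Φ W, a ∈ Φ.source ∧ IsStraightening d M Φ W := by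
  obtain ⟨Φ, W, h1, h2, h3, h4, h5⟩ := hM a ha
  have hk' : (2 : WithTop ℕ∞) ≤ (k : WithTop ℕ∞) := by exact_mod_cast hk
  exact ⟨Φ, W, h1, fun y hy => (h2.contDiffAt (Φ.open_source.mem_nhds hy)).of_le hk',
    fun q hq => (h3.contDiffAt (Φ.open_target.mem_nhds hq)).of_le hk', h4, h5⟩

lemma mem_tangentConeAt_of_hasDerivAt {V : Type*} [NormedAddCommGroup V] [NormedSpace ℝ V]
    {M : Set V} {γ : ℝ → V} {v : V} (h : HasDerivAt γ v 0) (hM : ∀ᶠ t in 𝓝 0, γ t ∈ M) :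
    v ∈ tangentConeAt ℝ M (γ 0) := by
  refine mem_tangentConeAt_of_seq (𝓝[≠] (0 : ℝ)) (fun t => t⁻¹) (fun t => γ t - γ 0) ?_ ?_ ?_
  · have := h.continuousAt.tendsto.sub_const (γ 0)
    rw [sub_self] at this
    exact this.mono_left nhdsWithin_le_nhds
  · refine (hM.filter_mono nhdsWithin_le_nhds).mono fun t ht => ?_
    simpa using ht
  · simpa using hasDerivAt_iff_tendsto_slope_zero.1 h

namespace IsStraightening

variable {Φ : OpenPartialHomeomorph (E D) (E D)} {W : Submodule ℝ (E D)}

lemma mem_of_mem (h : IsStraightening d M Φ W) {q : E D} (hq : q ∈ Φ.target) (hqW : q ∈ W) :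
    Φ.symm q ∈ M := by
  rw [h.mem_iff _ (Φ.map_target hq), Φ.right_inv hq]
  exact hqW

lemma eventually_mem (h : IsStraightening d M Φ W) {q w : E D} (hq : q ∈ Φ.target) (hqW : q ∈ W)
    (hw : w ∈ W) : ∀ᶠ t : ℝ in 𝓝 0, Φ.symm (q + t • w) ∈ M := by
  have hc : Tendsto (fun t : ℝ => q + t • w) (𝓝 0) (𝓝 q) := by
    have : Continuous fun t : ℝ => q + t • w := by fun_prop
    simpa using this.tendsto 0
  filter_upwards [hc.eventually (Φ.open_target.mem_nhds hq)] with t ht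
  exact h.mem_of_mem ht (W.add_mem hqW (W.smul_mem _ hw))

lemma differentiableAt_symm (h : IsStraightening d M Φ W) {q : E D} (hq : q ∈ Φ.target) :
    DifferentiableAt ℝ Φ.symm q :=
  (h.contDiffAt_symm q hq).differentiableAt (by norm_num)

lemma fderiv_fderiv_symm (h : IsStraightening d M Φ W) {q : E D} (hq : q ∈ Φ.target) (w : E D) :
    fderiv ℝ Φ (Φ.symm q) (fderiv ℝ Φ.symm q w) = w := by
  have h1 := ((h.contDiffAt _ (Φ.map_target hq)).differentiableAt (by norm_num)).hasFDerivAt.comp q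
    (h.differentiableAt_symm hq).hasFDerivAt
  have h2 : HasFDerivAt (Φ ∘ Φ.symm) (ContinuousLinearMap.id ℝ (E D)) q :=
    (hasFDerivAt_id q).congr_of_eventuallyEq (Φ.eventually_right_inverse hq)
  exact DFunLike.congr_fun (h1.unique h2) w

lemma fderiv_symm_fderiv (h : IsStraightening d M Φ W) {x : E D} (hx : x ∈ Φ.source) (v : E D) :
    fderiv ℝ Φ.symm (Φ x) (fderiv ℝ Φ x v) = v := by
  have h0 := (h.differentiableAt_symm (Φ.map_source hx)).hasFDerivAt
  have h1 := h0.comp x ((h.contDiffAt _ hx).differentiableAt (by norm_num)).hasFDerivAt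
  have h2 : HasFDerivAt (Φ.symm ∘ Φ) (ContinuousLinearMap.id ℝ (E D)) x :=
    (hasFDerivAt_id x).congr_of_eventuallyEq (Φ.eventually_left_inverse hx)
  exact DFunLike.congr_fun (h1.unique h2) v

lemma hasDerivAt_line (h : IsStraightening d M Φ W) {q w : E D} {t : ℝ}
    (hq : q + t • w ∈ Φ.target) :
    HasDerivAt (fun t : ℝ => Φ.symm (q + t • w)) (fderiv ℝ Φ.symm (q + t • w) w) t := by
  have h1 : HasDerivAt (fun t : ℝ => q + t • w) w t := by
    simpa using ((hasDerivAt_id t).smul_const w).const_add q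
  exact (h.differentiableAt_symm hq).hasFDerivAt.comp_hasDerivAt t h1

lemma hasDerivAt_fderiv_line (h : IsStraightening d M Φ W) {q w : E D} {t : ℝ}
    (hq : q + t • w ∈ Φ.target) :
    HasDerivAt (fun t : ℝ => fderiv ℝ Φ.symm (q + t • w) w)
      (fderiv ℝ (fderiv ℝ Φ.symm) (q + t • w) w w) t := by
  have h1 : HasDerivAt (fun t : ℝ => q + t • w) w t := by
    simpa using ((hasDerivAt_id t).smul_const w).const_add q
  have h2 : DifferentiableAt ℝ (fderiv ℝ Φ.symm) (q + t • w) :=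
    ((h.contDiffAt_symm _ hq).fderiv_right (m := 1) (by norm_num)).differentiableAt (by norm_num)
  have h3 := h2.hasFDerivAt.comp_hasDerivAt t h1
  exact h3.clm_apply (hasDerivAt_const t w) |>.congr_deriv (by simp)

lemma fderiv_symm_mem_tangentSpace (h : IsStraightening d M Φ W) {q w : E D} (hq : q ∈ Φ.target)
    (hqW : q ∈ W) (hw : w ∈ W) : fderiv ℝ Φ.symm q w ∈ tangentSpace M (Φ.symm q) := by
  refine Submodule.subset_span ?_
  have h1 := h.hasDerivAt_line (q := q) (w := w) (t := 0) (by simpa using hq)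
  have h2 := mem_tangentConeAt_of_hasDerivAt h1 (h.eventually_mem hq hqW hw)
  simpa using h2

lemma exists_fderiv_symm_eq (h : IsStraightening d M Φ W) {x v : E D} (hx : x ∈ Φ.source)
    (hxM : x ∈ M) (hv : v ∈ tangentSpace M x) : ∃ w ∈ W, fderiv ℝ Φ.symm (Φ x) w = v := by
  refine ⟨fderiv ℝ Φ x v, ?_, h.fderiv_symm_fderiv hx v⟩
  -- the components of `Φ` normal to `W` vanish on `M`, hence so do their derivatives on its
  -- tangent cone
  have hcone : ∀ v ∈ tangentConeAt ℝ M x, fderiv ℝ Φ x v ∈ W := by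
    intro v hv
    have hΦ : HasFDerivAt Φ (fderiv ℝ Φ x) x :=
      ((h.contDiffAt _ hx).differentiableAt (by norm_num)).hasFDerivAt
    have h1 : HasFDerivWithinAt (fun y => Wᗮ.starProjection (Φ y))
        (Wᗮ.starProjection ∘L fderiv ℝ Φ x) (M ∩ Φ.source) x :=
      (Wᗮ.starProjection.hasFDerivAt.comp x hΦ).hasFDerivWithinAt
    have hzero : ∀ y ∈ W, Wᗮ.starProjection y = 0 := by
      intro y hy
      rw [Submodule.starProjection_apply_eq_zero_iff, Submodule.orthogonal_orthogonal]
      exact hy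
    have hv' : v ∈ tangentConeAt ℝ (M ∩ Φ.source) x := by
      rwa [tangentConeAt_inter_nhds (Φ.open_source.mem_nhds hx)]
    have h2 : HasFDerivWithinAt (fun y => Wᗮ.starProjection (Φ y))
        (0 : E D →L[ℝ] E D) (M ∩ Φ.source) x := by
      refine (hasFDerivWithinAt_const (0 : E D) x (M ∩ Φ.source)).congr (fun y hy => ?_) ?_
      · exact hzero _ ((h.mem_iff y hy.2).1 hy.1)
      · exact hzero _ ((h.mem_iff x hx).1 hxM)
    have h3 : Wᗮ.starProjection (fderiv ℝ Φ x v) = 0 := h1.unique_on h2 hv'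
    rwa [Submodule.starProjection_apply_eq_zero_iff, Submodule.orthogonal_orthogonal] at h3
  have hle : tangentSpace M x ≤ W.comap (fderiv ℝ Φ x).toLinearMap := Submodule.span_le.2 hcone
  exact hle hv

end IsStraightening

lemma IsSubmanifold.exists_curve (hM : IsSubmanifold d k M) (hk : 2 ≤ k) {x v : E D} (hx : x ∈ M)
    (hv : v ∈ tangentSpace M x) : ∃ γ : ℝ → E D, ContDiffAt ℝ 2 γ 0 ∧ (∀ᶠ t in 𝓝 0, γ t ∈ M) ∧
      γ 0 = x ∧ HasDerivAt γ v 0 := by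
  obtain ⟨Φ, W, hxΦ, h⟩ := hM.exists_straightening hk hx
  obtain ⟨w, hw, rfl⟩ := h.exists_fderiv_symm_eq hxΦ hx hv
  have hq := Φ.map_source hxΦ
  have hqW := (h.mem_iff x hxΦ).1 hx
  refine ⟨fun t => Φ.symm (Φ x + t • w), ?_, h.eventually_mem hq hqW hw,
    by simp [Φ.left_inv hxΦ], ?_⟩
  · have h1 : ContDiffAt ℝ 2 (fun t : ℝ => Φ x + t • w) 0 := by fun_prop
    have h2 : ContDiffAt ℝ 2 Φ.symm (Φ x + (0 : ℝ) • w) := by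
      simpa using h.contDiffAt_symm _ hq
    exact h2.comp (0 : ℝ) h1
  · simpa using h.hasDerivAt_line (q := Φ x) (w := w) (t := 0) (by simpa using hq)

/-- The segment to a nearest or farthest point of a submanifold is normal to it. -/
lemma IsSubmanifold.sub_mem_orthogonal (hM : IsSubmanifold d k M) (hk : 2 ≤ k) {x z : E D}
    (hx : x ∈ M) (h : IsExtrOn (fun y => ‖y - z‖) M x) : z - x ∈ (tangentSpace M x)ᗮ := by
  rw [Submodule.mem_orthogonal]
  intro v hv
  obtain ⟨γ, -, hγ, rfl, hd⟩ := hM.exists_curve hk hx hv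
  have h1 : HasDerivAt (fun t => ‖γ t - z‖ ^ 2) (2 * inner ℝ (γ 0 - z) v) 0 :=
    (hd.sub_const z).norm_sq
  have h2 : IsLocalExtr (fun t => ‖γ t - z‖ ^ 2) 0 := by
    rcases h with h | h
    · refine Or.inl (hγ.mono fun t ht => ?_)
      exact pow_le_pow_left₀ (norm_nonneg _) (h ht) 2
    · refine Or.inr (hγ.mono fun t ht => ?_)
      exact pow_le_pow_left₀ (norm_nonneg _) (h ht) 2
  have h3 := h2.hasDerivAt_eq_zero h1
  rw [real_inner_comm, ← neg_sub, inner_neg_left]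
  linarith

lemma IsNearest.sub_mem_orthogonal (hM : IsSubmanifold d k M) (hk : 2 ≤ k) {x z : E D}
    (h : IsNearest M z x) : z - x ∈ (tangentSpace M x)ᗮ := by
  refine hM.sub_mem_orthogonal hk h.1 (Or.inl fun y hy => ?_)
  have := h.2.le.trans (infDist_le_dist_of_mem hy)
  rwa [dist_comm, dist_comm z, dist_eq_norm, dist_eq_norm] at this

lemma IsSubmanifold.le_finrank_tangentSpace (hM : IsSubmanifold d k M) (hk : 2 ≤ k) {x : E D}
    (hx : x ∈ M) : d ≤ Module.finrank ℝ (tangentSpace M x) := by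
  obtain ⟨Φ, W, hxΦ, h⟩ := hM.exists_straightening hk hx
  have hq := Φ.map_source hxΦ
  have hqW := (h.mem_iff x hxΦ).1 hx
  rw [← h.finrank_eq]
  have hmem : ∀ w ∈ W, (fderiv ℝ Φ.symm (Φ x)).toLinearMap w ∈ tangentSpace M x := by
    intro w hw
    have := h.fderiv_symm_mem_tangentSpace hq hqW hw
    rwa [Φ.left_inv hxΦ] at this
  refine LinearMap.finrank_le_finrank_of_injective
    (f := (fderiv ℝ Φ.symm (Φ x)).toLinearMap.restrict hmem) fun w w' hww => ?_
  have h1 := congrArg (fun v : tangentSpace M x => fderiv ℝ Φ (Φ.symm (Φ x)) (v : E D)) hww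
  have h2 := h.fderiv_fderiv_symm hq (w : E D)
  have h3 := h.fderiv_fderiv_symm hq (w' : E D)
  exact Subtype.ext (h2.symm.trans (h1.trans h3))

/-- `γ` is a `C²` curve in `M` which passes through `x` with unit speed at time `0`. -/
def IsUnitSpeedAt (M : Set (E D)) (x : E D) (γ : ℝ → E D) : Prop :=
  ContDiffAt ℝ 2 γ 0 ∧ (∀ᶠ t in 𝓝 0, γ t ∈ M) ∧ γ 0 = x ∧ ‖deriv γ 0‖ = 1

lemma IsSubmanifold.exists_isUnitSpeedAt (hM : IsSubmanifold d k M) (hd : 1 ≤ d) (hk : 2 ≤ k)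
    {x : E D} (hx : x ∈ M) : ∃ γ, IsUnitSpeedAt M x γ := by
  have h1 := hM.le_finrank_tangentSpace hk hx
  have : Nontrivial (tangentSpace M x) := Module.finrank_pos_iff.1 (hd.trans h1)
  obtain ⟨v, hv⟩ := exists_norm_eq (tangentSpace M x) zero_le_one
  obtain ⟨γ, h2, h3, h4, h5⟩ := hM.exists_curve hk hx v.2
  exact ⟨γ, h2, h3, h4, by rw [h5.deriv]; exact hv⟩

lemma IsUnitSpeedAt.enorm_le_maxCurvature {x : E D} (hx : x ∈ M) {γ : ℝ → E D}
    (h : IsUnitSpeedAt M x γ) :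
    ‖(tangentSpace M x)ᗮ.starProjection (iteratedDeriv 2 γ 0)‖ₑ ≤ maxCurvature M :=
  le_iSup₂_of_le x hx (le_iSup₂_of_le γ h le_rfl)

/-- Taylor's inequality of order two for a function on `[0, 1]`. -/
lemma taylor_two_le {φ φ' φ'' : ℝ → ℝ} {B : ℝ}
    (h1 : ∀ t ∈ Set.Icc (0 : ℝ) 1, HasDerivAt φ (φ' t) t)
    (h2 : ∀ t ∈ Set.Icc (0 : ℝ) 1, HasDerivAt φ' (φ'' t) t)
    (h3 : ∀ t ∈ Set.Icc (0 : ℝ) 1, φ'' t ≤ B) : φ 1 ≤ φ 0 + φ' 0 + B / 2 := by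
  have hA : AntitoneOn (fun t => φ' t - B * t) (Set.Icc 0 1) := by
    have hd : ∀ t ∈ Set.Icc (0 : ℝ) 1, HasDerivAt (fun t => φ' t - B * t) (φ'' t - B) t :=
      fun t ht => ((h2 t ht).sub ((hasDerivAt_id t).const_mul B)).congr_deriv (by simp)
    refine antitoneOn_of_deriv_nonpos (convex_Icc _ _)
      (fun t ht => (hd t ht).continuousAt.continuousWithinAt)
      (fun t ht => (hd t (interior_subset ht)).differentiableAt.differentiableWithinAt)
      fun t ht => ?_
    rw [(hd t (interior_subset ht)).deriv]
    linarith [h3 t (interior_subset ht)]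
  have hd : ∀ t ∈ Set.Icc (0 : ℝ) 1,
      HasDerivAt (fun t => φ t - φ' 0 * t - B / 2 * t ^ 2) (φ' t - φ' 0 - B * t) t := by
    intro t ht
    refine (((h1 t ht).sub ((hasDerivAt_id t).const_mul (φ' 0))).sub
      ((hasDerivAt_pow 2 t).const_mul (B / 2))).congr_deriv ?_
    norm_num
    ring
  have hB : AntitoneOn (fun t => φ t - φ' 0 * t - B / 2 * t ^ 2) (Set.Icc 0 1) := by
    refine antitoneOn_of_deriv_nonpos (convex_Icc _ _)
      (fun t ht => (hd t ht).continuousAt.continuousWithinAt)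
      (fun t ht => (hd t (interior_subset ht)).differentiableAt.differentiableWithinAt)
      fun t ht => ?_
    rw [(hd t (interior_subset ht)).deriv]
    have := hA ⟨le_rfl, zero_le_one⟩ (interior_subset ht) (interior_subset ht).1
    simp only [mul_zero, sub_zero] at this
    linarith
  have := hB ⟨le_rfl, zero_le_one⟩ ⟨zero_le_one, le_rfl⟩ zero_le_one
  simp only [mul_zero, sub_zero, mul_one, one_pow, ne_eq, OfNat.ofNat_ne_zero, not_false_eq_true,
    zero_pow] at this
  linarith

end Submanifold

/-! ### Second order expansion of submanifolds -/

section LocalShape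

open Metric

variable {D d k : ℕ} {M : Set (E D)}

/-- The first two derivatives of a `C²` map oscillate little near a point. -/
lemma _root_.ContDiffAt.exists_ball_fderiv {F G : Type*} [NormedAddCommGroup F] [NormedSpace ℝ F]
    [NormedAddCommGroup G] [NormedSpace ℝ G] {f : F → G} {q₀ : F} (h : ContDiffAt ℝ 2 f q₀)
    {μ : ℝ} (hμ : 0 < μ) :
    ∃ r > 0, (∀ q ∈ ball q₀ r, ‖fderiv ℝ f q - fderiv ℝ f q₀‖ ≤ μ) ∧
      (∀ q ∈ ball q₀ r, ‖fderiv ℝ (fderiv ℝ f) q‖ ≤ ‖fderiv ℝ (fderiv ℝ f) q₀‖ + 1) ∧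
      ∀ q ∈ ball q₀ r, ∀ q' ∈ ball q₀ r,
        ‖fderiv ℝ (fderiv ℝ f) q - fderiv ℝ (fderiv ℝ f) q'‖ ≤ μ := by
  have h1 : ContDiffAt ℝ 1 (fderiv ℝ f) q₀ := h.fderiv_right (by norm_num)
  have c1 : ContinuousAt (fderiv ℝ f) q₀ := h1.continuousAt
  have c2 := (h1.fderiv_right (m := 0) (by norm_num)).continuousAt
  have e1 : ∀ᶠ q in 𝓝 q₀, ‖fderiv ℝ f q - fderiv ℝ f q₀‖ < μ :=
    (tendsto_iff_norm_sub_tendsto_zero.1 c1).eventually_lt_const hμ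
  have e2 : ∀ᶠ q in 𝓝 q₀, ‖fderiv ℝ (fderiv ℝ f) q - fderiv ℝ (fderiv ℝ f) q₀‖ <
      min 1 (μ / 2) := by
    have c3 := tendsto_iff_norm_sub_tendsto_zero.1 c2
    exact c3.eventually_lt_const (lt_min one_pos (half_pos hμ))
  obtain ⟨r, hr, H⟩ := Metric.eventually_nhds_iff_ball.1 (e1.and e2)
  refine ⟨r, hr, fun q hq => ?_, fun q hq => ?_, fun q hq q' hq' => ?_⟩
  · exact (H q hq).1.le
  · have h2 := norm_le_insert' (fderiv ℝ (fderiv ℝ f) q) (fderiv ℝ (fderiv ℝ f) q₀)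
    have h3 := (H q hq).2.trans_le (min_le_left _ _)
    linarith
  · have h2 := (H q hq).2.trans_le (min_le_right _ _)
    have h3 := (H q' hq').2.trans_le (min_le_right _ _)
    have h4 := norm_sub_le_norm_sub_add_norm_sub (fderiv ℝ (fderiv ℝ f) q)
      (fderiv ℝ (fderiv ℝ f) q₀) (fderiv ℝ (fderiv ℝ f) q')
    rw [norm_sub_rev (fderiv ℝ (fderiv ℝ f) q₀)] at h4
    linarith

lemma IsStraightening.isUnitSpeedAt_line {Φ : OpenPartialHomeomorph (E D) (E D)}
    {W : Submodule ℝ (E D)} (h : IsStraightening d M Φ W) {p w : E D} (hp : p ∈ Φ.target)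
    (hpW : p ∈ W) (hw : w ∈ W) (hn : ‖fderiv ℝ Φ.symm p w‖ = 1) :
    IsUnitSpeedAt M (Φ.symm p) (fun t : ℝ => Φ.symm (p + t • w)) ∧
      iteratedDeriv 2 (fun t : ℝ => Φ.symm (p + t • w)) 0 =
        fderiv ℝ (fderiv ℝ Φ.symm) p w w := by
  have hp0 : p + (0 : ℝ) • w ∈ Φ.target := by simpa using hp
  have hcont : ContinuousAt (fun t : ℝ => p + t • w) (0 : ℝ) := by fun_prop
  have hev : ∀ᶠ t : ℝ in 𝓝 0, p + t • w ∈ Φ.target :=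
    hcont.eventually (Φ.open_target.mem_nhds hp0)
  refine ⟨⟨?_, h.eventually_mem hp hpW hw, by simp, ?_⟩, ?_⟩
  · have h1 : ContDiffAt ℝ 2 (fun t : ℝ => p + t • w) 0 := by fun_prop
    exact (h.contDiffAt_symm _ hp0).comp (0 : ℝ) h1
  · rw [(h.hasDerivAt_line hp0).deriv]
    simpa using hn
  · rw [iteratedDeriv_succ, iteratedDeriv_one]
    have h1 : deriv (fun t : ℝ => Φ.symm (p + t • w)) =ᶠ[𝓝 0]
        fun t => fderiv ℝ Φ.symm (p + t • w) w :=
      hev.mono fun t ht => (h.hasDerivAt_line ht).deriv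
    rw [h1.deriv_eq, (h.hasDerivAt_fderiv_line hp0).deriv]
    simp

/-- Bounds for a map close to a linear map `A`: here `w`, `c` are the norms of a vector and of its
image by `A`, and `n`, `l` are two perturbations of `c`. -/
lemma near_isometry_bounds {w n l c b μ ν : ℝ} (hb : 0 < b) (hμ : 0 ≤ μ) (hν : ν ≤ 1)
    (hμν : 4 * b * μ ≤ ν) (hw : 0 ≤ w) (hn : 0 ≤ n) (h1 : w ≤ b * c) (h2 : c ≤ n + μ * w) (h3 : c ≤ l + μ * w)
    (h4 : |l - n| ≤ 2 * μ * w) :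
    w ≤ 2 * b * n ∧ w ≤ 2 * b * l ∧ |l ^ 2 - n ^ 2| ≤ 3 * ν * n ^ 2 := by
  have l4 : b * (μ * w) ≤ w / 4 := by
    have := mul_le_mul_of_nonneg_right (hμν.trans hν) hw
    linarith
  have l5 := mul_le_mul_of_nonneg_left h2 hb.le
  have l6 := mul_le_mul_of_nonneg_left h3 hb.le
  have wn : w ≤ 2 * b * n := by linarith
  have wl : w ≤ 2 * b * l := by linarith
  refine ⟨wn, wl, ?_⟩
  have hl : 0 ≤ l := by
    by_contra! h0
    have := mul_neg_of_pos_of_neg hb h0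
    linarith
  have hdiff : |l - n| ≤ ν * n := by
    have h5 : 2 * μ * w ≤ 2 * μ * (2 * b * n) := by gcongr
    have h6 : 4 * b * μ * n ≤ ν * n := by gcongr
    linarith
  rw [show l ^ 2 - n ^ 2 = (l - n) * (l + n) by ring, abs_mul,
    abs_of_nonneg (by positivity : 0 ≤ l + n)]
  have h5 : l + n ≤ 3 * n := by
    have := (abs_le.1 hdiff).2
    have := mul_le_mul_of_nonneg_right hν hn
    linarith
  calc |l - n| * (l + n) ≤ (ν * n) * (3 * n) := by
        gcongr
        exact (abs_nonneg _).trans hdiff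
    _ = _ := by ring

/-- Second order expansion of a `C²` submanifold, uniform near each of its points: the component of
`y - x` along a normal `u` at `x` is half the second derivative of a unit speed curve through `x`
along `u`, times `‖y - x‖²`, up to a small error. -/
lemma IsSubmanifold.exists_second_order (hM : IsSubmanifold d k M) (hk : 2 ≤ k) {a : E D}
    (ha : a ∈ M) : ∃ C : ℝ, 0 ≤ C ∧ ∀ ε > 0, ∃ η > 0, ∀ x ∈ M, ∀ y ∈ M, dist x a < η →
      dist y a < η → x ≠ y → ∃ γ, IsUnitSpeedAt M x γ ∧ ‖iteratedDeriv 2 γ 0‖ ≤ C ∧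
        ∀ u ∈ (tangentSpace M x)ᗮ, ‖u‖ ≤ 1 →
          inner ℝ (y - x) u ≤ (1 / 2 * inner ℝ (iteratedDeriv 2 γ 0) u + ε) * ‖y - x‖ ^ 2 := by
  obtain ⟨Φ, W, haΦ, h⟩ := hM.exists_straightening hk ha
  set q₀ := Φ a with hq₀
  have hq₀t : q₀ ∈ Φ.target := Φ.map_source haΦ
  set A := fderiv ℝ Φ.symm with hA
  set H := fderiv ℝ A with hH
  set b := ‖fderiv ℝ Φ (Φ.symm q₀)‖ + 1 with hb
  have hb0 : 0 < b := by positivity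
  have hAb : ∀ w, ‖w‖ ≤ b * ‖A q₀ w‖ := by
    intro w
    have h1 := (fderiv ℝ Φ (Φ.symm q₀)).le_opNorm (A q₀ w)
    rw [hA, h.fderiv_fderiv_symm hq₀t] at h1
    refine h1.trans ?_
    rw [hb]
    gcongr
    linarith
  set C := (‖H q₀‖ + 1) * (2 * b) ^ 2 with hC
  have hC0 : 0 ≤ C := by positivity
  refine ⟨C, hC0, fun ε hε => ?_⟩
  -- `ν` bounds the relative error of lengths, `μ` the oscillation of the derivatives
  set ν := min 1 (ε / (3 * C + 1)) with hν
  have hν0 : 0 < ν := lt_min one_pos (by positivity)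
  have hν1 : ν ≤ 1 := min_le_left _ _
  have hνC : 3 * C * ν ≤ ε := by
    have h1 : ν * (3 * C + 1) ≤ ε := (le_div_iff₀ (by positivity)).1 (min_le_right _ _)
    linarith
  set μ := min (ν / (4 * b)) (ε / (4 * b ^ 2)) with hμ
  have hμ0 : 0 < μ := lt_min (by positivity) (by positivity)
  have hμν : 4 * b * μ ≤ ν := by
    have := (le_div_iff₀ (by positivity)).1 (min_le_left (ν / (4 * b)) (ε / (4 * b ^ 2)))
    linarith
  have hμε : 4 * b ^ 2 * μ ≤ ε := by
    have := (le_div_iff₀ (by positivity)).1 (min_le_right (ν / (4 * b)) (ε / (4 * b ^ 2)))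
    linarith
  obtain ⟨r₁, hr₁, hr1, hr2, hr3⟩ := (h.contDiffAt_symm q₀ hq₀t).exists_ball_fderiv hμ0
  obtain ⟨r₂, hr₂, hrt₂⟩ := Metric.isOpen_iff.1 Φ.open_target q₀ hq₀t
  set r := min r₁ r₂
  have hr : 0 < r := lt_min hr₁ hr₂
  have hrr₁ : ball q₀ r ⊆ ball q₀ r₁ := ball_subset_ball (min_le_left _ _)
  have hrt : ball q₀ r ⊆ Φ.target := (ball_subset_ball (min_le_right _ _)).trans hrt₂
  replace hr1 := fun q hq => hr1 q (hrr₁ hq)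
  replace hr2 := fun q hq => hr2 q (hrr₁ hq)
  replace hr3 := fun q hq q' hq' => hr3 q (hrr₁ hq) q' (hrr₁ hq')
  have hΦc : ∀ᶠ x in 𝓝 a, x ∈ Φ.source ∧ Φ x ∈ ball q₀ r :=
    (Φ.open_source.eventually_mem haΦ).and
      ((Φ.continuousAt haΦ).eventually (ball_mem_nhds _ hr))
  obtain ⟨η, hη, hball⟩ := Metric.eventually_nhds_iff.1 hΦc
  refine ⟨η, hη, fun x hx y hy hxa hya hxy => ?_⟩
  obtain ⟨hxs, hxr⟩ := hball hxa
  obtain ⟨hys, hyr⟩ := hball hya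
  have hpW : Φ x ∈ W := (h.mem_iff x hxs).1 hx
  have hqW : Φ y ∈ W := (h.mem_iff y hys).1 hy
  set p := Φ x with hp
  set w := Φ y - p with hw
  have hwW : w ∈ W := W.sub_mem hqW hpW
  have hpt : p ∈ Φ.target := hrt hxr
  have hpx : Φ.symm p = x := Φ.left_inv hxs
  have hqy : Φ.symm (Φ y) = y := Φ.left_inv hys
  have hpw : p + w = Φ y := by rw [hw]; abel
  have hw0 : 0 < ‖w‖ := by
    rw [norm_pos_iff, hw, sub_ne_zero]
    intro h0
    exact hxy (by rw [← hpx, ← hqy, h0])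
  have hseg : ∀ t ∈ Set.Icc (0 : ℝ) 1, p + t • w ∈ ball q₀ r := fun t ht =>
    (convex_ball q₀ r).add_smul_sub_mem hxr hyr ht
  -- `‖y - x‖`, `‖A q₀ w‖` and `‖A p w‖` agree up to small multiples of `‖w‖`
  have l1 : ‖y - x - A q₀ w‖ ≤ μ * ‖w‖ := by
    have := (convex_ball q₀ r).norm_image_sub_le_of_norm_fderiv_le' (𝕜 := ℝ) (f := Φ.symm)
      (φ := A q₀) (C := μ) (fun q hq => h.differentiableAt_symm (hrt hq)) hr1 hxr hyr
    rwa [hpx, hqy] at this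
  have l2 : ‖A p w - A q₀ w‖ ≤ μ * ‖w‖ := by
    rw [← sub_apply]
    exact (ContinuousLinearMap.le_opNorm _ _).trans (by gcongr; exact hr1 p hxr)
  set N := ‖y - x‖ with hN
  set lam := ‖A p w‖ with hlam
  have l3 := hAb w
  have l5 : ‖A q₀ w‖ ≤ N + μ * ‖w‖ := by
    have := norm_le_insert (y - x) (A q₀ w)
    linarith
  have l6 : ‖A q₀ w‖ ≤ lam + μ * ‖w‖ := by
    have := norm_le_insert (A p w) (A q₀ w)
    linarith
  have l7 : |lam - N| ≤ 2 * μ * ‖w‖ := by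
    have h1 : |lam - N| ≤ ‖A p w - (y - x)‖ := abs_norm_sub_norm_le _ _
    have h2 : ‖A p w - (y - x)‖ ≤ ‖A p w - A q₀ w‖ + ‖A q₀ w - (y - x)‖ :=
      norm_sub_le_norm_sub_add_norm_sub _ _ _
    rw [norm_sub_rev (A q₀ w)] at h2
    linarith
  have hN0 : 0 ≤ N := norm_nonneg _
  obtain ⟨wN, wlam, hsq⟩ := near_isometry_bounds hb0 hμ0.le hν1 hμν hw0.le hN0 l3 l5 l6 l7
  have hlam0 : 0 < lam := by
    by_contra! h0
    have : lam = 0 := le_antisymm h0 (norm_nonneg _)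
    rw [this, mul_zero] at wlam
    linarith
  -- the curve is the image of the line through `p` directed by `w`, at unit speed
  set w' := lam⁻¹ • w with hw'
  have hwlw : w = lam • w' := by rw [hw', smul_smul, mul_inv_cancel₀ hlam0.ne', one_smul]
  have hunit : ‖A p w'‖ = 1 := by
    rw [hw', map_smul, norm_smul, norm_inv, Real.norm_of_nonneg hlam0.le, ← hlam,
      inv_mul_cancel₀ hlam0.ne']
  obtain ⟨hγ, hγ2⟩ := h.isUnitSpeedAt_line hpt hpW (W.smul_mem _ hwW) hunit
  rw [hpx] at hγ
  have hHC : ‖H p w' w'‖ ≤ C := by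
    have h1 : ‖w'‖ ≤ 2 * b := by
      rw [hw', norm_smul, norm_inv, Real.norm_of_nonneg hlam0.le, inv_mul_le_iff₀ hlam0]
      linarith
    calc ‖H p w' w'‖ ≤ ‖H p‖ * ‖w'‖ * ‖w'‖ := (H p).le_opNorm₂ _ _
      _ ≤ (‖H q₀‖ + 1) * (2 * b) * (2 * b) := by gcongr; exact hr2 p hxr
      _ = C := by rw [hC]; ring
  refine ⟨_, hγ, by rwa [hγ2], fun u hu hu1 => ?_⟩
  rw [hγ2]
  set g := inner ℝ (H p w' w') u with hg
  have hgC : |g| ≤ C := by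
    refine (abs_real_inner_le_norm _ _).trans ?_
    calc ‖H p w' w'‖ * ‖u‖ ≤ C * 1 := by gcongr
      _ = C := mul_one C
  have hTay := taylor_two_le (φ := fun t => inner ℝ (Φ.symm (p + t • w)) u)
    (φ' := fun t => inner ℝ (A (p + t • w) w) u)
    (φ'' := fun t => inner ℝ (H (p + t • w) w w) u)
    (B := inner ℝ (H p w w) u + μ * ‖w‖ ^ 2)
    (fun t ht => ((h.hasDerivAt_line (hrt (hseg t ht))).inner ℝ
      (hasDerivAt_const t u)).congr_deriv (by simp [hA]))
    (fun t ht => ((h.hasDerivAt_fderiv_line (hrt (hseg t ht))).inner ℝ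
      (hasDerivAt_const t u)).congr_deriv (by simp [hA, hH]))
    (fun t ht => by
      rw [← sub_le_iff_le_add', ← inner_sub_left]
      refine (real_inner_le_norm _ _).trans ?_
      refine (mul_le_of_le_one_right (norm_nonneg _) hu1).trans ?_
      change ‖(H (p + t • w) - H p) w w‖ ≤ _
      refine ((H (p + t • w) - H p).le_opNorm₂ w w).trans ?_
      rw [sq, ← mul_assoc]
      gcongr
      exact hr3 _ (hseg t ht) _ hxr)
  have hperp : inner ℝ (A p w) u = 0 := by
    have := h.fderiv_symm_mem_tangentSpace hpt hpW hwW
    rw [hpx] at this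
    exact (Submodule.mem_orthogonal _ _).1 hu _ this
  have hquad : inner ℝ (H p w w) u = lam ^ 2 * g := by
    have e : H p (lam • w') (lam • w') = (lam ^ 2) • H p w' w' := by
      simp [sq, smul_smul]
    rw [hg, hwlw, e, inner_smul_left]
    simp
  simp only [one_smul, zero_smul, add_zero, hpw, hpx, hqy, hperp, hquad] at hTay
  have e1 : inner ℝ (y - x) u ≤ (lam ^ 2 * g + μ * ‖w‖ ^ 2) / 2 := by
    rw [inner_sub_left]; linarith
  have e2 : μ * ‖w‖ ^ 2 ≤ ε * N ^ 2 := by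
    calc μ * ‖w‖ ^ 2 ≤ μ * (2 * b * N) ^ 2 := by gcongr
      _ = 4 * b ^ 2 * μ * N ^ 2 := by ring
      _ ≤ ε * N ^ 2 := by gcongr
  have e3 : (lam ^ 2 - N ^ 2) * g ≤ ε * N ^ 2 := by
    calc (lam ^ 2 - N ^ 2) * g ≤ |lam ^ 2 - N ^ 2| * |g| := by
          rw [← abs_mul]; exact le_abs_self _
      _ ≤ 3 * ν * N ^ 2 * C := by gcongr
      _ = 3 * C * ν * N ^ 2 := by ring
      _ ≤ ε * N ^ 2 := by gcongr
  linarith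

end LocalShape

/-! ### Reach and curvature -/

section ReachCurvature

open Metric

variable {D d k : ℕ} {M : Set (E D)}

/-- Federer's inequality for all normal vectors of a submanifold of positive reach. -/
lemma HasReach.inner_le_of_mem_orthogonal {τ : ℝ} (hτ : 0 < τ) (hMc : IsClosed M)
    (h : HasReach τ M) (hM : IsSubmanifold d k M) (hk : 2 ≤ k) {x y u : E D} (hx : x ∈ M)
    (hy : y ∈ M) (hu : u ∈ (tangentSpace M x)ᗮ) :
    inner ℝ (y - x) u ≤ ‖u‖ * (‖y - x‖ ^ 2 / (2 * τ)) := by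
  -- for a unit normal `v` the second order expansion shows that `x` is the nearest point of
  -- `x + e • v` for some `e > 0`, and the normal segment extends up to the reach
  suffices H : ∀ v ∈ (tangentSpace M x)ᗮ, ‖v‖ = 1 → inner ℝ (y - x) v ≤ ‖y - x‖ ^ 2 / (2 * τ) by
    rcases eq_or_ne u 0 with rfl | hu0
    · simp
    have hn : 0 < ‖u‖ := norm_pos_iff.2 hu0
    have h1 := H (‖u‖⁻¹ • u) (Submodule.smul_mem _ _ hu)
      (by rw [norm_smul, norm_inv, norm_norm, inv_mul_cancel₀ hn.ne'])
    rw [inner_smul_right, inv_mul_le_iff₀ hn] at h1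
    exact h1
  intro v hv hv1
  obtain ⟨C, hC, hloc⟩ := hM.exists_second_order hk hx
  obtain ⟨η, hη, hloc⟩ := hloc 1 one_pos
  set c := C / 2 + 1 with hc
  have hc0 : 0 < c := by positivity
  set e := min (η / 2) (1 / (2 * c)) with he
  have he0 : 0 < e := lt_min (by positivity) (by positivity)
  have he1 : e ≤ η / 2 := min_le_left _ _
  have he2 : 2 * e * c ≤ 1 := by
    have := (le_div_iff₀ (by positivity)).1 (min_le_right (η / 2) (1 / (2 * c)))
    linarith
  have hdist : infDist (x + e • v) M = e := by
    refine le_antisymm ((infDist_le_dist_of_mem hx).trans_eq ?_) ((le_infDist ⟨x, hx⟩).2 ?_)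
    · rw [dist_eq_norm, add_sub_cancel_left, norm_smul, hv1, mul_one, Real.norm_of_nonneg he0.le]
    · intro p hp
      rw [dist_eq_norm, norm_sub_rev]
      rcases lt_or_ge (dist p x) η with hpη | hpη
      · rcases eq_or_ne x p with rfl | hxp
        · rw [sub_add_cancel_left, norm_neg, norm_smul, hv1, mul_one, Real.norm_of_nonneg he0.le]
        obtain ⟨γ, -, hγC, hγ⟩ := hloc x hx p hp (by simpa using hη) hpη hxp
        have h1 := hγ v hv hv1.le
        have h2 : inner ℝ (iteratedDeriv 2 γ 0) v ≤ C :=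
          (real_inner_le_norm _ _).trans (by rw [hv1, mul_one]; exact hγC)
        have h3 : inner ℝ (p - x) v ≤ c * ‖p - x‖ ^ 2 := h1.trans (by gcongr; linarith)
        refine le_of_sq_le_sq ?_ (norm_nonneg _)
        rw [show p - (x + e • v) = (p - x) - e • v by abel, norm_sub_sq_real, norm_smul, hv1,
          mul_one, inner_smul_right, Real.norm_of_nonneg he0.le]
        have h4 : e * inner ℝ (p - x) v ≤ e * (c * ‖p - x‖ ^ 2) := by gcongr
        have h5 : 2 * e * c * ‖p - x‖ ^ 2 ≤ 1 * ‖p - x‖ ^ 2 := by gcongr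
        linarith
      · rw [dist_eq_norm] at hpη
        have h1 := norm_sub_norm_le (p - x) (e • v)
        rw [norm_smul, hv1, mul_one, Real.norm_of_nonneg he0.le] at h1
        rw [show p - (x + e • v) = (p - x) - e • v by abel]
        linarith
  exact inner_le_of_infDist_ray hτ hy hv1 fun t ht htτ =>
    h.infDist_ray hMc hx hv1 he0 hdist ht.le htτ

/-- The second derivative is nonnegative at a local minimum. -/
lemma deriv_deriv_nonneg_of_isLocalMin {f : ℝ → ℝ} {t : ℝ} (h : IsLocalMin f t)
    (hf : ContinuousAt f t) : 0 ≤ deriv (deriv f) t := by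
  by_contra! hneg
  have h1 := isLocalMax_of_deriv_deriv_neg hneg h.deriv_eq_zero hf
  have h2 : f =ᶠ[𝓝 t] fun _ => f t := by
    filter_upwards [h, h1] with s hs hs' using le_antisymm hs' hs
  have h3 : deriv f =ᶠ[𝓝 t] deriv fun _ => f t := h2.deriv
  rw [h3.deriv_eq] at hneg
  simp at hneg

/-- Second order condition along a curve for a minimum of `y ↦ c ‖y - z‖² - ⟪y, u⟫`. -/
lemma second_order_condition {V : Type*} [NormedAddCommGroup V] [InnerProductSpace ℝ V]
    {γ : ℝ → V} (hγ : ContDiffAt ℝ 2 γ 0) {c : ℝ} {z u : V}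
    (h : IsLocalMin (fun t => c * ‖γ t - z‖ ^ 2 - inner ℝ (γ t) u) 0) :
    inner ℝ (iteratedDeriv 2 γ 0) u ≤
      2 * c * (‖deriv γ 0‖ ^ 2 + inner ℝ (γ 0 - z) (iteratedDeriv 2 γ 0)) := by
  have hev : ∀ᶠ t in 𝓝 (0 : ℝ), HasDerivAt γ (deriv γ t) t := by
    filter_upwards [hγ.eventually (by simp)] with t ht
    exact (ht.differentiableAt (by norm_num)).hasDerivAt
  have h2 : HasDerivAt (deriv γ) (iteratedDeriv 2 γ 0) 0 := by
    rw [iteratedDeriv_succ, iteratedDeriv_one]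
    have h3 : ContDiffAt ℝ 1 (deriv γ) 0 := by
      have h4 : ContDiffAt ℝ 1 (fderiv ℝ γ) 0 := hγ.fderiv_right (by norm_num)
      exact h4.clm_apply contDiffAt_const
    exact (h3.differentiableAt (by norm_num)).hasDerivAt
  set f := fun t => c * ‖γ t - z‖ ^ 2 - inner ℝ (γ t) u with hf
  have hf1 : ∀ t, HasDerivAt γ (deriv γ t) t →
      HasDerivAt f (c * (2 * inner ℝ (γ t - z) (deriv γ t)) - inner ℝ (deriv γ t) u) t := by
    intro t ht
    exact (((ht.sub_const z).norm_sq).const_mul c).sub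
      ((ht.inner ℝ (hasDerivAt_const t u)).congr_deriv (by simp))
  have h0 := hev.self_of_nhds
  have hd1 : deriv f =ᶠ[𝓝 0]
      fun t => c * (2 * inner ℝ (γ t - z) (deriv γ t)) - inner ℝ (deriv γ t) u :=
    hev.mono fun t ht => (hf1 t ht).deriv
  have hd2 : deriv (deriv f) 0 = 2 * c * (‖deriv γ 0‖ ^ 2 +
      inner ℝ (γ 0 - z) (iteratedDeriv 2 γ 0)) - inner ℝ (iteratedDeriv 2 γ 0) u := by
    rw [hd1.deriv_eq]
    have h3 := (((((h0.sub_const z).inner ℝ h2).const_mul 2).const_mul c).sub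
      (h2.inner ℝ (hasDerivAt_const 0 u))).deriv
    refine h3.trans ?_
    rw [real_inner_self_eq_norm_sq, inner_zero_right]
    ring
  have := deriv_deriv_nonneg_of_isLocalMin h (hf1 0 h0).continuousAt
  rw [hd2] at this
  linarith

/-- Federer's inequality says that, for a vector `P` normal to `M` at `x`, the function
`‖P‖ / (2 τ) ‖y - x‖² - ⟪y - x, P⟫` is nonnegative on `M`; its second derivative along a curve
through `x` bounds the curvature. -/
lemma HasReach.maxCurvature_le {τ : ℝ} (hτ : 0 < τ) (hMc : IsClosed M)
    (h : HasReach τ M) (hM : IsSubmanifold d k M) (hk : 2 ≤ k) :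
    maxCurvature M ≤ ENNReal.ofReal (1 / τ) := by
  refine iSup₂_le fun x hx => iSup₂_le fun γ ⟨hγ, hγM, hγ0, hγ1⟩ => ?_
  set P := (tangentSpace M x)ᗮ.starProjection (iteratedDeriv 2 γ 0) with hP
  rw [← ofReal_norm]
  refine ENNReal.ofReal_le_ofReal ?_
  have hPmem : P ∈ (tangentSpace M x)ᗮ := Submodule.starProjection_apply_mem _ _
  have hmin : IsLocalMin (fun t => ‖P‖ / (2 * τ) * ‖γ t - x‖ ^ 2 - inner ℝ (γ t) P) 0 := by
    filter_upwards [hγM] with t ht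
    have := h.inner_le_of_mem_orthogonal hτ hMc hM hk hx ht hPmem
    rw [inner_sub_left] at this
    simp only [hγ0, sub_self, norm_zero, ne_eq, OfNat.ofNat_ne_zero, not_false_eq_true, zero_pow,
      mul_zero, zero_sub]
    have e : ‖P‖ / (2 * τ) * ‖γ t - x‖ ^ 2 = ‖P‖ * (‖γ t - x‖ ^ 2 / (2 * τ)) := by ring
    linarith
  have h2 := second_order_condition hγ hmin
  have h3 : inner ℝ (iteratedDeriv 2 γ 0) P = ‖P‖ ^ 2 := by
    rw [← real_inner_self_eq_norm_sq, hP, Submodule.inner_starProjection_left_eq_right,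
      Submodule.starProjection_eq_self_iff.2 hPmem]
  rw [h3, hγ1, hγ0, sub_self, inner_zero_left] at h2
  rcases (norm_nonneg P).eq_or_lt with h0 | h0
  · rw [← h0]; positivity
  · have e : 2 * (‖P‖ / (2 * τ)) * (1 ^ 2 + 0) = ‖P‖ * (1 / τ) := by field_simp; ring
    rw [e, sq] at h2
    exact le_of_mul_le_mul_left h2 h0

lemma reach_le_minCurvatureRadius (hMc : IsClosed M) (hM : IsSubmanifold d k M) (hk : 2 ≤ k) :
    reach M ≤ minCurvatureRadius M := by
  refine ENNReal.le_of_forall_nnreal_lt fun τ hτ => ?_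
  rcases eq_or_ne τ 0 with rfl | h0
  · simp
  have hτ0 : (0 : ℝ) < τ := by positivity
  have h1 : HasReach τ M := hasReach_of_le_reach (by simpa using hτ.le)
  have h2 := h1.maxCurvature_le hτ0 hMc hM hk
  rw [minCurvatureRadius, ENNReal.le_inv_iff_le_inv]
  rwa [one_div, ENNReal.ofReal_inv_of_pos hτ0, ENNReal.ofReal_coe_nnreal] at h2

/-- A compact submanifold is curved at its points farthest from the origin. -/
lemma minCurvatureRadius_ne_top (hMc : IsCompact M) (hne : M.Nonempty) (hM : IsSubmanifold d k M)
    (hd : 1 ≤ d) (hk : 2 ≤ k) : minCurvatureRadius M ≠ ⊤ := by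
  obtain ⟨x, hx, hmax⟩ := hMc.exists_isMaxOn hne
    (f := fun y => ‖y - 0‖) (by fun_prop)
  obtain ⟨γ, hγ⟩ := hM.exists_isUnitSpeedAt hd hk hx
  have hxT := hM.sub_mem_orthogonal hk hx (Or.inr hmax)
  have hmin : IsLocalMin (fun t => (-1) * ‖γ t - 0‖ ^ 2 - inner ℝ (γ t) (0 : E D)) 0 := by
    filter_upwards [hγ.2.1] with t ht
    have h1 := pow_le_pow_left₀ (norm_nonneg _) (hmax ht) 2
    rw [hγ.2.2.1, inner_zero_right, inner_zero_right]
    dsimp only at h1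
    linarith
  have h2 := second_order_condition hγ.1 hmin
  rw [hγ.2.2.1, hγ.2.2.2, inner_zero_right, sub_zero] at h2
  rw [minCurvatureRadius, Ne, ENNReal.inv_eq_top]
  intro h0
  have h3 := hγ.enorm_le_maxCurvature hx
  rw [h0, nonpos_iff_eq_zero, enorm_eq_zero] at h3
  have h4 : inner ℝ (0 - x) (iteratedDeriv 2 γ 0) = 0 := by
    rw [← Submodule.starProjection_eq_self_iff.2 hxT,
      Submodule.inner_starProjection_left_eq_right, h3, inner_zero_right]
  rw [zero_sub, inner_neg_left] at h4
  linarith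

/-- In a submanifold of curvature less than `1 / τ` two nearest points of a point at distance `τ`
cannot be close to each other. -/
lemma IsSubmanifold.one_le_mul_infDist (hM : IsSubmanifold d k M) (hk : 2 ≤ k) {κ κ' : ℝ}
    (hκ : maxCurvature M ≤ ENNReal.ofReal κ) (hκ0 : 0 ≤ κ) (hκκ : κ < κ') {a : E D} (ha : a ∈ M) :
    ∃ η > 0, ∀ x y z, x ≠ y → IsNearest M z x → IsNearest M z y → dist x a < η → dist y a < η →
      1 ≤ κ' * infDist z M := by
  obtain ⟨C, -, hloc⟩ := hM.exists_second_order hk ha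
  obtain ⟨η, hη, hloc⟩ := hloc ((κ' - κ) / 2) (by linarith)
  refine ⟨η, hη, fun x y z hxy hx hy hxa hya => ?_⟩
  obtain ⟨γ, hγ, -, H⟩ := hloc x hx.1 y hy.1 hxa hya hxy
  have hT := hx.sub_mem_orthogonal hM hk
  have hzx : ‖z - x‖ = infDist z M := by rw [← dist_eq_norm]; exact hx.2
  have hzy : ‖z - y‖ = infDist z M := by rw [← dist_eq_norm]; exact hy.2
  have hyx : 0 < ‖y - x‖ := norm_pos_iff.2 (sub_ne_zero.2 hxy.symm)
  have ht : 0 < infDist z M := by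
    have h1 := norm_sub_le (z - x) (z - y)
    rw [sub_sub_sub_cancel_left, hzx, hzy] at h1
    linarith
  set t := infDist z M
  set u := t⁻¹ • (z - x) with hu
  have hut : z - x = t • u := by rw [hu, smul_smul, mul_inv_cancel₀ ht.ne', one_smul]
  have huT : u ∈ (tangentSpace M x)ᗮ := Submodule.smul_mem _ _ hT
  have hun : ‖u‖ = 1 := by
    rw [hu, norm_smul, norm_inv, Real.norm_of_nonneg ht.le, hzx, inv_mul_cancel₀ ht.ne']
  have h1 := H u huT hun.le
  have h2 : inner ℝ (iteratedDeriv 2 γ 0) u ≤ κ := by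
    have h3 := (hγ.enorm_le_maxCurvature hx.1).trans hκ
    rw [← ofReal_norm, ENNReal.ofReal_le_ofReal_iff hκ0] at h3
    rw [← Submodule.starProjection_eq_self_iff.2 huT,
      ← Submodule.inner_starProjection_left_eq_right]
    exact (real_inner_le_norm _ _).trans (by rw [hun, mul_one]; exact h3)
  have h3 : inner ℝ (y - x) u * (2 * t) = ‖y - x‖ ^ 2 := by
    have h4 := norm_sub_sq_real (z - x) (y - x)
    rw [sub_sub_sub_cancel_right, hzx, hzy, hut, inner_smul_left, real_inner_comm] at h4
    simp only [conj_trivial] at h4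
    linarith
  have h4 : inner ℝ (y - x) u ≤ κ' / 2 * ‖y - x‖ ^ 2 := h1.trans (by gcongr; linarith)
  have h5 : 1 * ‖y - x‖ ^ 2 ≤ κ' * t * ‖y - x‖ ^ 2 := by
    have := mul_le_mul_of_nonneg_right h4 (by positivity : 0 ≤ 2 * t)
    linarith
  exact le_of_mul_le_mul_right h5 (by positivity)

/-- If the reach is not determined by the curvature, then it is attained at a bottleneck. -/
lemma min_minCurvatureRadius_sdr_le_reach (hMc : IsCompact M) (hM : IsSubmanifold d k M)
    (hk : 2 ≤ k) {ρ δ : ℝ} (hρ : 0 < ρ) (hδ : δ ≤ ρ) (hreach : ENNReal.ofReal ρ ≤ reach M) :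
    min (minCurvatureRadius M) (sdr δ M (intrinsicDist M)) ≤ reach M := by
  rcases eq_or_ne (reach M) ⊤ with htop | htop
  · rw [htop]; exact le_top
  set τ := (reach M).toReal with hτdef
  have hτr : ENNReal.ofReal τ = reach M := ENNReal.ofReal_toReal htop
  have hρτ : ρ ≤ τ := by
    rw [← hτr] at hreach
    exact (ENNReal.ofReal_le_ofReal_iff ENNReal.toReal_nonneg).1 hreach
  have hτ : 0 < τ := hρ.trans_le hρτ
  have hR : HasReach τ M := hasReach_of_le_reach hτr.le
  by_contra! hlt
  obtain ⟨hlt1, hlt2⟩ := lt_min_iff.1 hlt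
  rw [minCurvatureRadius, ENNReal.lt_inv_iff_lt_inv, ← hτr,
    ← ENNReal.ofReal_inv_of_pos hτ] at hlt1
  set κ := (maxCurvature M).toReal
  have hκ : maxCurvature M = ENNReal.ofReal κ := (ENNReal.ofReal_toReal hlt1.ne_top).symm
  have hκ0 : 0 ≤ κ := ENNReal.toReal_nonneg
  have hκτ : κ < τ⁻¹ := by
    rw [hκ] at hlt1
    exact (ENNReal.ofReal_lt_ofReal_iff (by positivity)).1 hlt1
  obtain ⟨κ', hκκ', hκ'τ⟩ := exists_between hκτ
  have hκ'1 : κ' * τ < 1 := by rwa [← lt_div_iff₀ hτ, one_div]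
  have hstar := fun a (ha : a ∈ M) => hM.one_le_mul_infDist hk hκ.le hκ0 hκκ' ha
  -- points of the medial axis whose distances to `M` tend to the reach
  have hseq : ∀ n : ℕ, ∃ z a b, a ≠ b ∧ IsNearest M z a ∧ IsNearest M z b ∧ τ ≤ infDist z M ∧
      infDist z M ≤ τ + 1 / ((n : ℝ) + 1) := by
    intro n
    have h1 : reach M < ENNReal.ofReal (τ + 1 / ((n : ℝ) + 1)) := by
      rw [← hτr]
      exact (ENNReal.ofReal_lt_ofReal_iff (by positivity)).2
        (lt_add_of_pos_right _ (by positivity))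
    obtain ⟨z, h1⟩ := iInf_lt_iff.1 h1
    obtain ⟨hz, h1⟩ := iInf_lt_iff.1 h1
    obtain ⟨a, b, hab, ha, hb⟩ := mem_medialAxis_iff.1 hz
    have h2 : reach M ≤ infEDist z M := iInf₂_le z hz
    refine ⟨z, a, b, hab, ha, hb, ?_, ?_⟩
    · exact ENNReal.toReal_mono (infEDist_ne_top ⟨a, ha.1⟩) h2
    · exact (ENNReal.toReal_mono ENNReal.ofReal_ne_top h1.le).trans_eq
        (ENNReal.toReal_ofReal (by positivity))
  choose z a b hab ha hb hz1 hz2 using hseq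
  obtain ⟨a', ha', hatend⟩ := hMc.ultrafilter_le_nhds ((hyperfilter ℕ).map a)
    (by rw [Ultrafilter.coe_map, le_principal_iff]; exact mem_map.2 (univ_mem' fun n => (ha n).1))
  obtain ⟨b', hb', hbtend⟩ := hMc.ultrafilter_le_nhds ((hyperfilter ℕ).map b)
    (by rw [Ultrafilter.coe_map, le_principal_iff]; exact mem_map.2 (univ_mem' fun n => (hb n).1))
  obtain ⟨z', -, hztend⟩ := (hMc.cthickening (r := τ + 1)).ultrafilter_le_nhds
    ((hyperfilter ℕ).map z) (by
      rw [Ultrafilter.coe_map, le_principal_iff]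
      refine mem_map.2 (univ_mem' fun n => ?_)
      refine mem_cthickening_of_dist_le _ (a n) _ _ (ha n).1 ?_
      rw [(ha n).2]
      have : 1 / ((n : ℝ) + 1) ≤ 1 := by
        rw [div_le_one (by positivity)]; linarith [(Nat.cast_nonneg n : (0 : ℝ) ≤ n)]
      linarith [hz2 n])
  rw [Ultrafilter.coe_map] at hatend hbtend hztend
  have hat : Tendsto a (hyperfilter ℕ : Filter ℕ) (𝓝 a') := hatend
  have hbt : Tendsto b (hyperfilter ℕ : Filter ℕ) (𝓝 b') := hbtend
  have hzt : Tendsto z (hyperfilter ℕ : Filter ℕ) (𝓝 z') := hztend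
  have hdt : Tendsto (fun n => infDist (z n) M) (hyperfilter ℕ : Filter ℕ) (𝓝 (infDist z' M)) :=
    ((continuous_infDist_pt M).tendsto z').comp hzt
  have hdτ : infDist z' M = τ := by
    refine le_antisymm ?_ (ge_of_tendsto' hdt hz1)
    have h1 : Tendsto (fun n : ℕ => τ + 1 / ((n : ℝ) + 1)) (hyperfilter ℕ : Filter ℕ)
        (𝓝 (τ + 0)) :=
      (tendsto_one_div_add_atTop_nhds_zero_nat.mono_left Nat.hyperfilter_le_atTop).const_add τ
    rw [add_zero] at h1
    exact le_of_tendsto_of_tendsto' hdt h1 hz2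
  have hna : IsNearest M z' a' :=
    ⟨ha', tendsto_nhds_unique (hzt.dist hat) (hdt.congr fun n => ((ha n).2).symm)⟩
  have hnb : IsNearest M z' b' :=
    ⟨hb', tendsto_nhds_unique (hzt.dist hbt) (hdt.congr fun n => ((hb n).2).symm)⟩
  obtain ⟨η, hη, hsep⟩ := hstar a' ha'
  -- the limit `z'` has nearest points `a'` and `b'`; unless these are antipodal, some nearest points
  -- come too close to each other for the curvature bound
  rcases eq_or_ne b' a' with hab' | hab'
  · rw [hab'] at hbt
    have hev : ∀ᶠ n in (hyperfilter ℕ : Filter ℕ), 1 ≤ κ' * infDist (z n) M := by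
      filter_upwards [hat.eventually (ball_mem_nhds _ hη), hbt.eventually (ball_mem_nhds _ hη)]
        with n h1 h2 using hsep (a n) (b n) (z n) (hab n) (ha n) (hb n) h1 h2
    have := ge_of_tendsto (hdt.const_mul κ') hev
    rw [hdτ] at this
    linarith
  rcases lt_or_ge ‖a' - b'‖ (2 * τ) with hlt' | hge
  · obtain ⟨c, hc, hca, hcη⟩ :=
      hR.exists_isNearest_norm_sub_lt hMc.isClosed hna hnb hab' hdτ hlt' hη
    have := hsep a' c z' hca.symm hna hc (by simpa using hη)
      (by rwa [dist_comm, dist_eq_norm])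
    rw [hdτ] at this
    linarith
  · have := sdr_le_of_bottleneck hτ (by linarith : δ ≤ 2 * τ) hna hnb hdτ hge
    rw [hτr] at this
    exact absurd hlt2 (not_lt.2 this)

lemma reach_le_sdr (hMc : IsClosed M) (δ : ℝ) : reach M ≤ sdr δ M (intrinsicDist M) := by
  refine ENNReal.le_of_forall_nnreal_lt fun τ hτ => ?_
  rcases eq_or_ne τ 0 with rfl | h0
  · simp
  have hτ0 : (0 : ℝ) < τ := by positivity
  have h1 : HasReach τ M := hasReach_of_le_reach (by simpa using hτ.le)
  refine le_iSup₂_of_le (τ : ℝ) ⟨hτ0, fun x hx y hy _ hxy => ?_⟩ (by simp)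
  exact h1.intrinsicDist_le hMc hx hy hxy

theorem reach_eq_min (hMc : IsCompact M) (hM : IsSubmanifold d k M) (hk : 2 ≤ k) {ρ δ : ℝ}
    (hρ : 0 < ρ) (hδ : δ ≤ ρ) (hreach : ENNReal.ofReal ρ ≤ reach M) :
    reach M = min (minCurvatureRadius M) (sdr δ M (intrinsicDist M)) :=
  le_antisymm (le_min (reach_le_minCurvatureRadius hMc.isClosed hM hk) (reach_le_sdr hMc.isClosed δ))
    (min_minCurvatureRadius_sdr_le_reach hMc hM hk hρ hδ hreach)

end ReachCurvature

/-! ### Boundedness of the spherical distortion radii over the model -/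

section Bounded

open Metric

variable {D d k : ℕ} {M : Set (E D)}

/-- A `C²` map with vanishing differential at `0` and second derivative at most `l` on a ball of
radius `s` is `l R`-Lipschitz on the concentric balls of radius `R ≤ s`. -/
lemma norm_sub_le_of_norm_iteratedFDerivWithin_two_le {F G : Type*} [NormedAddCommGroup F]
    [NormedSpace ℝ F] [NormedAddCommGroup G] [NormedSpace ℝ G] {N : F → G} {r s l : ℝ}
    (hs0 : 0 < s) (hr : s ≤ r) (hl : 0 ≤ l) (hN2 : ContDiffOn ℝ 2 N (closedBall 0 r))
    (hdN : fderiv ℝ N 0 = 0)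
    (hl2 : ∀ v ∈ closedBall (0 : F) r, ‖v‖ ≤ s →
      ‖iteratedFDerivWithin ℝ 2 N (closedBall 0 r) v‖ ≤ l)
    {R : ℝ} (hR : R ≤ s) {v w : F} (hv : ‖v‖ ≤ R) (hw : ‖w‖ ≤ R) :
    ‖N v - N w‖ ≤ l * R * ‖v - w‖ := by
  have hr0 : 0 < r := hs0.trans_le hr
  set S := closedBall (0 : F) r with hS
  have huniq : UniqueDiffOn ℝ S :=
    uniqueDiffOn_convex (convex_closedBall _ _) (by
      rw [interior_closedBall _ hr0.ne']; exact ⟨0, mem_ball_self hr0⟩)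
  have hsub : closedBall (0 : F) s ⊆ S := closedBall_subset_closedBall hr
  have hd0 : fderivWithin ℝ N S 0 = 0 := by
    rw [fderivWithin_of_mem_nhds (closedBall_mem_nhds _ hr0), hdN]
  have hD1 : ContDiffOn ℝ 1 (fderivWithin ℝ N S) S := hN2.fderivWithin huniq (by norm_num)
  have hD2 : ∀ v ∈ closedBall (0 : F) s, ‖fderivWithin ℝ (fderivWithin ℝ N S) S v‖ ≤ l := by
    intro v hv
    have h1 := hl2 v (hsub hv) (by simpa using hv)
    rw [← norm_iteratedFDerivWithin_fderivWithin (n := 1) huniq (hsub hv),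
      norm_iteratedFDerivWithin_one _ (huniq v (hsub hv))] at h1
    exact h1
  have hDN : ∀ v ∈ closedBall (0 : F) s, ‖fderivWithin ℝ N S v‖ ≤ l * ‖v‖ := by
    intro v hv
    have h1 := (convex_closedBall (0 : F) s).norm_image_sub_le_of_norm_hasFDerivWithin_le
      (𝕜 := ℝ) (f := fderivWithin ℝ N S) (f' := fderivWithin ℝ (fderivWithin ℝ N S) S) (C := l)
      (fun w hw => ((hD1.differentiableOn (by norm_num) w (hsub hw)).hasFDerivWithinAt).mono hsub)
      hD2 (mem_closedBall_self hs0.le) hv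
    rwa [hd0, sub_zero, sub_zero] at h1
  have hsR : closedBall (0 : F) R ⊆ closedBall 0 s := closedBall_subset_closedBall hR
  refine (convex_closedBall (0 : F) R).norm_image_sub_le_of_norm_hasFDerivWithin_le
    (𝕜 := ℝ) (f := N) (f' := fderivWithin ℝ N S)
    (fun w hw => ((hN2.differentiableOn (by norm_num) w
      (hsub (hsR hw))).hasFDerivWithinAt).mono (hsR.trans hsub))
    (fun w hw => (hDN w (hsR hw)).trans ?_) (by simpa using hw) (by simpa using hv)
  have : ‖w‖ ≤ R := by simpa using hw
  gcongr

/-- Local parametrizations of a manifold of the model over tangent balls of radius `1 / (4 L₂)`: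
the normal parts are `1/4`-Lipschitz and quadratically small. -/
lemma IsModelManifold.exists_param_bounds {ρ : ℝ} {L : ℕ → ℝ} (h : IsModelManifold d k ρ L M)
    (hk : 2 ≤ k) (hL : 0 < L 2) {x : E D} (hx : x ∈ M) :
    ∃ N : tangentSpace M x → E D,
      (∀ v : tangentSpace M x, ‖v‖ ≤ 1 / (4 * L 2) → x + (v : E D) + N v ∈ M) ∧
      (∀ v w, ‖v‖ ≤ 1 / (4 * L 2) → ‖w‖ ≤ 1 / (4 * L 2) → ‖N v - N w‖ ≤ 1 / 4 * ‖v - w‖) ∧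
      ∀ v, ‖v‖ ≤ 1 / (4 * L 2) → ‖N v‖ ≤ L 2 * ‖v‖ ^ 2 := by
  obtain ⟨r, N, hr, hN, hN0, hdN, hmem, -, hL2, -⟩ := h.exists_param x hx
  set s := 1 / (4 * L 2) with hs
  have hs0 : 0 < s := by positivity
  have hN2 : ContDiffOn ℝ 2 N (closedBall 0 r) := hN.of_le (by exact_mod_cast hk)
  have hlip := fun R (hR : R ≤ s) v w hv hw =>
    norm_sub_le_of_norm_iteratedFDerivWithin_two_le hs0 hr hL.le hN2 hdN hL2 hR (v := v) (w := w)
      hv hw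
  refine ⟨N, fun v hv => hmem v (by simpa using hv.trans hr), fun v w hv hw => ?_, fun v hv => ?_⟩
  · have h1 := hlip s le_rfl v w hv hw
    have h2 : L 2 * s = 1 / 4 := by rw [hs]; field_simp
    rwa [h2] at h1
  · have h1 := hlip ‖v‖ hv v 0 le_rfl (by simp)
    rw [hN0, sub_zero, sub_zero] at h1
    linarith

/-- Lower bound on the `d`-dimensional volume of balls in a manifold of the model, by comparison
with a ball of `ℝ^d`. -/
lemma IsModelManifold.volume_le {ρ : ℝ} {L : ℕ → ℝ} (h : IsModelManifold d k ρ L M)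
    (hk : 2 ≤ k) (hL : 0 < L 2) {x : E D} (hx : x ∈ M) :
    volume (closedBall (0 : EuclideanSpace ℝ (Fin d)) (1 / (4 * L 2))) ≤
      (4 / 3 : NNReal) ^ (d : ℝ) * (Measure.euclideanHausdorffMeasure d : Measure (E D))
        (closedBall x (2 * (1 / (4 * L 2))) ∩ M) := by
  obtain ⟨N, hN1, hN2, hN3⟩ := h.exists_param_bounds hk hL hx
  set s := 1 / (4 * L 2) with hs
  have hs0 : 0 < s := by positivity
  have hdim := h.isSubmanifold.le_finrank_tangentSpace hk hx
  -- an isometric copy of `ℝ^d` in the tangent space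
  obtain ⟨ι⟩ : Nonempty (EuclideanSpace ℝ (Fin d) →ₗᵢ[ℝ] tangentSpace M x) := by
    let e := (EuclideanSpace.basisFun (Fin d) ℝ).toBasis
    let b := stdOrthonormalBasis ℝ (tangentSpace M x)
    refine ⟨(e.constr ℝ (b ∘ Fin.castLE hdim)).isometryOfOrthonormal (v := e) ?_ ?_⟩
    · simp [e]
    · have : e.constr ℝ (b ∘ Fin.castLE hdim) ∘ e = b ∘ Fin.castLE hdim := by
        ext1 i; simp
      rw [this]
      exact b.orthonormal.comp _ (Fin.castLE_injective hdim)
  set B := closedBall (0 : EuclideanSpace ℝ (Fin d)) s with hB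
  set F : B → E D := fun v => x + (ι v : E D) + N (ι v) with hF
  have hnorm : ∀ v : B, ‖ι v‖ ≤ s := fun v => by
    rw [ι.norm_map]; exact mem_closedBall_zero_iff.1 v.2
  have hanti : AntilipschitzWith (4 / 3) F := by
    refine AntilipschitzWith.of_le_mul_dist fun v w => ?_
    have h1 := hN2 (ι v) (ι w) (hnorm v) (hnorm w)
    have h2 : ‖ι v - ι w‖ = dist v w := by
      rw [← map_sub, ι.norm_map, Subtype.dist_eq, dist_eq_norm]
    have h3 : ‖(ι v : E D) - ι w‖ = dist v w := by rw [← h2]; rfl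
    have h4 : (ι v : E D) - ι w = (F v - F w) - (N (ι v) - N (ι w)) := by
      simp only [hF]; abel
    have h5 := norm_sub_le (F v - F w) (N (ι v) - N (ι w))
    rw [← h4, h3] at h5
    rw [h2] at h1
    rw [dist_eq_norm (F v)]
    push_cast
    linarith
  have himg : F '' Set.univ ⊆ closedBall x (2 * s) ∩ M := by
    rintro _ ⟨v, -, rfl⟩
    refine ⟨?_, hN1 _ (hnorm v)⟩
    rw [mem_closedBall, dist_eq_norm]
    have e : F v - x = (ι v : E D) + N (ι v) := by simp only [hF]; abel
    rw [e]
    have h1 := hN3 _ (hnorm v)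
    have h2 := hnorm v
    have h3 : L 2 * ‖ι v‖ ^ 2 ≤ s := by
      have h4 : L 2 * s = 1 / 4 := by rw [hs]; field_simp
      have h5 : L 2 * ‖ι v‖ ^ 2 ≤ L 2 * s ^ 2 := by gcongr
      nlinarith
    calc ‖(ι v : E D) + N (ι v)‖ ≤ ‖(ι v : E D)‖ + ‖N (ι v)‖ := norm_add_le _ _
      _ ≤ s + s := add_le_add h2 (h1.trans h3)
      _ = 2 * s := by ring
  have h1 := hanti.le_hausdorffMeasure_image (d := d) (Nat.cast_nonneg d) Set.univ
  have h2 : Measure.hausdorffMeasure (d : ℝ) B =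
      Measure.hausdorffMeasure (d : ℝ) (Set.univ : Set B) := by
    have := (isometry_subtype_coe (s := B)).hausdorffMeasure_image (d := d)
      (Or.inl (Nat.cast_nonneg d)) Set.univ
    rwa [Set.image_univ, Subtype.range_coe] at this
  rw [← h2] at h1
  rw [← EuclideanSpace.euclideanHausdorffMeasure_eq_volume d,
    Measure.euclideanHausdorffMeasure_def, Measure.euclideanHausdorffMeasure_def,
    Measure.smul_apply, Measure.smul_apply, ENNReal.smul_def, ENNReal.smul_def, smul_eq_mul,
    smul_eq_mul, mul_left_comm]
  gcongr
  exact h1.trans (by gcongr)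

/-- Under every distribution of the model, all balls of radius `1 / (2 L₂)` centred at the support
have mass bounded below. -/
lemma InModel.mul_volume_le {ρ fmin fmax : ℝ} {L : ℕ → ℝ} {P : Measure (E D)}
    (h : InModel d k ρ L fmin fmax P) (hk : 2 ≤ k) (hL : 0 < L 2) {x : E D} (hx : x ∈ P.support) :
    ENNReal.ofReal fmin * volume (closedBall (0 : EuclideanSpace ℝ (Fin d)) (1 / (4 * L 2))) ≤
      (4 / 3 : NNReal) ^ (d : ℝ) * P (closedBall x (2 * (1 / (4 * L 2)))) := by
  obtain ⟨f, -, hf, hP⟩ := h.exists_density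
  have h1 := h.support_mem.volume_le hk hL hx
  set B := closedBall x (2 * (1 / (4 * L 2))) with hB
  set μ := (Measure.euclideanHausdorffMeasure d : Measure (E D)) with hμ
  have hBm : MeasurableSet B := isClosed_closedBall.measurableSet
  have hSm : MeasurableSet P.support := h.support_mem.isCompact.isClosed.measurableSet
  have h2 : ENNReal.ofReal fmin * μ (B ∩ P.support) ≤ P B := by
    have e : P B = ∫⁻ y in B ∩ P.support, f y ∂μ := by
      conv_lhs => rw [hP]
      rw [withDensity_apply _ hBm, Measure.restrict_restrict hBm]
    rw [e, ← setLIntegral_const]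
    exact setLIntegral_mono' (hBm.inter hSm) fun y hy => (hf y hy.2).1
  calc _ ≤ ENNReal.ofReal fmin * ((4 / 3 : NNReal) ^ (d : ℝ) * μ (B ∩ P.support)) := by gcongr
    _ = (4 / 3 : NNReal) ^ (d : ℝ) * (ENNReal.ofReal fmin * μ (B ∩ P.support)) := by
        rw [mul_left_comm]
    _ ≤ _ := by gcongr

/-- The supports of the distributions of the model have uniformly bounded diameters: a connected
support of large diameter would contain too many disjoint balls of mass bounded below. -/
lemma exists_norm_sub_le_of_inModel (d D k : ℕ) (hk : 2 ≤ k) (ρ fmin fmax : ℝ) (L : ℕ → ℝ)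
    (hfmin : 0 < fmin) (hL : 0 < L 2) :
    ∃ Δ : ℝ, 0 ≤ Δ ∧ ∀ P : Measure (E D), InModel d k ρ L fmin fmax P →
      ∀ x ∈ P.support, ∀ y ∈ P.support, ‖x - y‖ ≤ Δ := by
  set s := 1 / (4 * L 2) with hs
  have hs0 : 0 < s := by positivity
  set m := ENNReal.ofReal fmin * volume (closedBall (0 : EuclideanSpace ℝ (Fin d)) s) with hm
  have hm0 : m ≠ 0 := by
    refine mul_ne_zero (by simpa using hfmin) ?_
    exact (measure_closedBall_pos volume _ hs0).ne'
  have hC : ((4 / 3 : NNReal) : ℝ≥0∞) ^ (d : ℝ) ≠ ⊤ := by finiteness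
  obtain ⟨n, hn⟩ := ENNReal.exists_nat_mul_gt hm0 hC
  -- balls of radius `2 s` centred at distances `0, 5 s, 10 s, …` from `x` are disjoint
  refine ⟨5 * s * n, by positivity, fun P hP x hx y hy => ?_⟩
  have := hP.isProbabilityMeasure
  by_contra! hlt
  -- points of the support at prescribed distances from `x`
  have hpts : ∀ j : Fin n, ∃ z ∈ P.support, dist z x = 5 * s * (j : ℕ) := by
    intro j
    have hconn := hP.support_mem.isConnected.isPreconnected.intermediate_value hx hy
      (f := fun z => dist z x) (by fun_prop)
    refine hconn ⟨by rw [dist_self]; positivity, ?_⟩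
    rw [dist_comm, dist_eq_norm]
    refine le_trans ?_ hlt.le
    gcongr
    exact j.2.le
  choose z hz hzd using hpts
  have hdisj : Pairwise (Function.onFun Disjoint fun j => closedBall (z j) (2 * s)) := by
    intro i j hij
    refine closedBall_disjoint_closedBall ?_
    have h1 : |dist (z i) x - dist (z j) x| ≤ dist (z i) (z j) := abs_dist_sub_le _ _ _
    rw [hzd, hzd, ← mul_sub, abs_mul, abs_of_pos (by positivity : 0 < 5 * s)] at h1
    have h2 : (1 : ℝ) ≤ |((i : ℕ) : ℝ) - ((j : ℕ) : ℝ)| := by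
      have h3 : ((i : ℕ) : ℤ) - ((j : ℕ) : ℤ) ≠ 0 := by
        rw [sub_ne_zero]
        exact_mod_cast fun h => hij (Fin.ext h)
      exact_mod_cast Int.one_le_abs h3
    nlinarith
  have hsum : ∑ j : Fin n, P (closedBall (z j) (2 * s)) ≤ 1 := by
    have h1 := tsum_measure_le_measure_univ (μ := P) (s := fun j : Fin n => closedBall (z j) (2 * s))
      (fun j => isClosed_closedBall.measurableSet.nullMeasurableSet)
      fun i j hij => (hdisj hij).aedisjoint
    rwa [tsum_fintype, measure_univ] at h1
  have : (n : ℝ≥0∞) * m ≤ ((4 / 3 : NNReal) : ℝ≥0∞) ^ (d : ℝ) := by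
    calc (n : ℝ≥0∞) * m = ∑ _j : Fin n, m := by simp
      _ ≤ ∑ j : Fin n, ((4 / 3 : NNReal) : ℝ≥0∞) ^ (d : ℝ) * P (closedBall (z j) (2 * s)) :=
          Finset.sum_le_sum fun j _ => hP.mul_volume_le hk hL (hz j)
      _ = ((4 / 3 : NNReal) : ℝ≥0∞) ^ (d : ℝ) * ∑ j : Fin n, P (closedBall (z j) (2 * s)) := by
          rw [Finset.mul_sum]
      _ ≤ ((4 / 3 : NNReal) : ℝ≥0∞) ^ (d : ℝ) * 1 := by gcongr
      _ = _ := mul_one _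
  exact absurd hn (not_lt.2 this)

lemma edist_add_edist_le_eVariationOn {V : Type*} [PseudoEMetricSpace V] {x y : V} (γ : Path x y)
    (t : unitInterval) : edist x (γ t) + edist (γ t) y ≤ eVariationOn γ Set.univ := by
  have hun : eVariationOn γ Set.univ =
      eVariationOn γ (Set.Iic t) + eVariationOn γ (Set.Ici t) := by
    rw [← eVariationOn.union _ (x := t) ⟨Set.mem_Iic.2 le_rfl, fun _ h => h⟩
      ⟨Set.mem_Ici.2 le_rfl, fun _ h => h⟩, Set.Iic_union_Ici]
  rw [hun]
  have h1 := eVariationOn.edist_le γ (s := Set.Iic t) (x := 0) (y := t)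
    (Set.mem_Iic.2 t.2.1) (Set.mem_Iic.2 le_rfl)
  have h2 := eVariationOn.edist_le γ (s := Set.Ici t) (x := t) (y := 1)
    (Set.mem_Ici.2 le_rfl) (Set.mem_Ici.2 t.2.2)
  rw [γ.source] at h1
  rw [γ.target] at h2
  exact add_le_add h1 h2

/-- Arcs of large radius exceed their chords by little. -/
lemma arcLen_lt_add_of_le {r c ρ : ℝ} (hρ : 0 < ρ) (hc : 2 * ρ ≤ c) (h : c + c ^ 2 / ρ ≤ r) :
    arcLen r c < c + ρ / 2 := by
  have hc0 : 0 < c := by linarith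
  have hr1 : c ≤ r := le_trans (by linarith [show 0 ≤ c ^ 2 / ρ by positivity]) h
  have hr2 : c ^ 2 ≤ ρ * r := by
    have : c ^ 2 / ρ ≤ r := le_trans (by linarith) h
    rwa [div_le_iff₀' hρ] at this
  have hr : 0 < r := hc0.trans_le hr1
  have hle := arcLen_le hr hc0.le (by linarith)
  unfold arcLen at hle ⊢
  set t := c / (2 * r) with ht
  have ht0 : 0 < t := by positivity
  have ht1 : t ≤ 1 := (div_le_one (by positivity)).2 (by linarith)
  set θ := Real.arcsin t with hθ
  have hθ0 : 0 < θ := Real.arcsin_pos.2 ht0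
  have hsin : Real.sin θ = t := Real.sin_arcsin (by linarith) ht1
  have h1 := Real.sin_gt_sub_cube hθ0
  rw [hsin] at h1
  have hct : 2 * r * t = c := by rw [ht]; field_simp
  have hθt : θ ≤ 1.6 * t := by
    have hpi := Real.pi_lt_d2
    have h2 : 2 * r * θ ≤ 2 * r * (1.6 * t) := by
      calc 2 * r * θ ≤ Real.pi / 2 * c := hle
        _ ≤ 1.6 * c := by gcongr; linarith
        _ = 2 * r * (1.6 * t) := by rw [← hct]; ring
    exact le_of_mul_le_mul_left h2 (by positivity)
  have h3 : θ ^ 3 ≤ (1.6 * t) ^ 3 := pow_le_pow_left₀ hθ0.le hθt 3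
  have h4 : θ ≤ t + t ^ 3 := by
    have : 0 < t ^ 3 := by positivity
    nlinarith
  have h5 : 2 * r * t ^ 3 ≤ ρ / 8 := by
    have e : 2 * r * t ^ 3 = c ^ 3 / (4 * r ^ 2) := by rw [ht]; field_simp; ring
    rw [e, div_le_iff₀ (by positivity)]
    have h6 : c ^ 2 * c ^ 2 ≤ (ρ * r) * (ρ * r) := mul_le_mul hr2 hr2 (by positivity) (by positivity)
    have h7 : c ^ 3 * (2 * ρ) ≤ c ^ 3 * c := by gcongr
    have h8 : c ^ 3 * (2 * ρ) ≤ ρ * r ^ 2 / 2 * (2 * ρ) := by nlinarith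
    have h9 := le_of_mul_le_mul_right h8 (by positivity)
    linarith
  calc 2 * r * θ ≤ 2 * r * (t + t ^ 3) := by gcongr
    _ = c + 2 * r * t ^ 3 := by rw [mul_add, hct]
    _ < c + ρ / 2 := by linarith

/-- A path in `M` from `x` to a point of `M` farthest from `x` arrives orthogonally to the chord,
which makes it longer than the chord by a definite amount. Hence the spherical distortion radius is
bounded in terms of the diameter. -/
lemma sdr_le_of_norm_sub_le (hMc : IsCompact M) (hne : M.Nonempty) (hM : IsSubmanifold d k M)
    (hd : 1 ≤ d) (hk : 2 ≤ k) {ρ Δ : ℝ} (hρ : 0 < ρ) (h : HasReach ρ M)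
    (hΔ : ∀ x ∈ M, ∀ y ∈ M, ‖x - y‖ ≤ Δ) :
    sdr ρ M (intrinsicDist M) ≤ ENNReal.ofReal (Δ + Δ ^ 2 / ρ) := by
  refine iSup₂_le fun r ⟨hr, hadm⟩ => ENNReal.ofReal_le_ofReal ?_
  by_contra! hlt
  obtain ⟨x, hx⟩ := hne
  obtain ⟨y, hy, hmax⟩ := hMc.exists_isMaxOn ⟨x, hx⟩ (f := fun y => ‖y - x‖) (by fun_prop)
  have hyT := hM.sub_mem_orthogonal hk hy (Or.inr hmax)
  set c := ‖x - y‖ with hc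
  have hc0 : 0 < c := by
    rw [hc, norm_pos_iff, sub_ne_zero]
    rintro rfl
    obtain ⟨γ, -, h2, h3, h4⟩ := hM.exists_isUnitSpeedAt hd hk hx
    have h5 : γ =ᶠ[𝓝 0] fun _ => x := by
      filter_upwards [h2] with t ht
      have := hmax ht
      simpa [sub_eq_zero] using this
    rw [h5.deriv_eq] at h4
    simp at h4
  have hfed : ∀ p ∈ M, inner ℝ (p - y) (x - y) ≤ c * (‖p - y‖ ^ 2 / (2 * ρ)) := fun p hp =>
    h.inner_le_of_mem_orthogonal hρ hMc.isClosed hM hk hy hp hyT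
  have hcρ : 2 * ρ ≤ c := by
    have h1 := hfed x hx
    rw [real_inner_self_eq_norm_sq, ← hc, ← mul_div_assoc, le_div_iff₀ (by positivity)] at h1
    have h2 : c ^ 2 * (2 * ρ) ≤ c ^ 2 * c := by linarith
    exact le_of_mul_le_mul_left h2 (by positivity)
  have hcΔ : c ≤ Δ := hΔ x hx y hy
  have hr1 : c + c ^ 2 / ρ ≤ r := le_trans (by gcongr) hlt.le
  have hcr : c ≤ r := le_trans (by linarith [show 0 ≤ c ^ 2 / ρ by positivity]) hr1
  have h1 := hadm x hx y hy (by linarith) (by linarith)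
  -- a path from `x` to `y` passes through a point at distance `ρ` from `y`, which is at distance at
  -- least `c - ρ / 2` from `x`
  have h2 : ENNReal.ofReal (c + ρ / 2) ≤ intrinsicDist M x y := by
    refine le_iInf₂ fun γ hγ => ?_
    obtain ⟨t, ht⟩ : ∃ t, ‖γ t - y‖ = ρ :=
      mem_range_of_exists_le_of_exists_ge (f := fun t => ‖γ t - y‖) (by fun_prop)
        ⟨1, by simpa using hρ.le⟩ ⟨0, by simp only [γ.source]; linarith⟩
    have h3 := hfed _ (hγ t)
    rw [ht] at h3
    have h4 : c - ρ / 2 ≤ ‖x - γ t‖ := by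
      refine le_of_sq_le_sq ?_ (norm_nonneg _)
      rw [show x - γ t = (x - y) - (γ t - y) by abel, norm_sub_sq_real, ← hc, ht,
        real_inner_comm]
      have : c * (ρ ^ 2 / (2 * ρ)) = c * ρ / 2 := by field_simp
      nlinarith
    refine le_trans ?_ (edist_add_edist_le_eVariationOn γ t)
    rw [edist_dist, edist_dist, ← ENNReal.ofReal_add dist_nonneg dist_nonneg, dist_eq_norm,
      dist_eq_norm, ht]
    exact ENNReal.ofReal_le_ofReal (by linarith)
  have h3 : ENNReal.ofReal (c + ρ / 2) ≤ ENNReal.ofReal (arcLen r c) := h2.trans h1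
  rw [ENNReal.ofReal_le_ofReal_iff (arcLen_nonneg hr (norm_nonneg _))] at h3
  exact absurd (arcLen_lt_add_of_le hρ hcρ hr1) (not_lt.2 h3)

lemma sdr_mono_scale {δ δ' : ℝ} (h : δ ≤ δ') (K : Set (E D)) (dK : E D → E D → ℝ≥0∞) :
    sdr δ K dK ≤ sdr δ' K dK :=
  iSup₂_le fun r ⟨hr, hadm⟩ => le_iSup₂_of_le r
    ⟨hr, fun x hx y hy hxy => hadm x hx y hy (h.trans hxy)⟩ le_rfl

theorem exists_sdr_le_of_inModel (d D k : ℕ) (hd : 1 ≤ d) (hk : 2 ≤ k) (ρ fmin fmax : ℝ)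
    (L : ℕ → ℝ) (hρ : 0 < ρ) (hfmin : 0 < fmin) (hL : 0 < L 2) :
    ∃ S : ℝ, ∀ P : Measure (E D), InModel d k ρ L fmin fmax P → ∀ δ : ℝ, δ ≤ ρ →
      sdr δ P.support (intrinsicDist P.support) ≤ ENNReal.ofReal S := by
  obtain ⟨Δ, -, hΔ⟩ := exists_norm_sub_le_of_inModel d D k hk ρ fmin fmax L hfmin hL
  refine ⟨Δ + Δ ^ 2 / ρ, fun P hP δ hδ => (sdr_mono_scale hδ _ _).trans ?_⟩
  have hM := hP.support_mem
  exact sdr_le_of_norm_sub_le hM.isCompact hM.isConnected.nonempty hM.isSubmanifold hd hk hρ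
    (hasReach_of_le_reach hM.le_reach) (hΔ P hP)

end Bounded

/-! ### Stability of the spherical distortion radius -/

section Stability

open Metric

variable {D d k : ℕ} {M K : Set (E D)}

/-- Points at moderate distance can be driven apart within the manifold: moving `y` in the direction
of the tangential part of `y - x`, which carries most of `y - x` since the reach is at least
`‖x - y‖`, increases the distance to `x` at a rate bounded below. -/
lemma IsModelManifold.exists_norm_sub_add_le {ρ t : ℝ} {L : ℕ → ℝ} (h : IsModelManifold d k ρ L M)
    (hk : 2 ≤ k) (hL : 0 < L 2) (hρ : 0 < ρ) {x y : E D} (hx : x ∈ M) (hy : y ∈ M)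
    (hxy : 0 < ‖x - y‖) (hxyρ : ‖x - y‖ ≤ ρ) (ht : 0 ≤ t) (htL : t ≤ 1 / (8 * L 2)) :
    ∃ y₁ ∈ M, ‖y - y₁‖ ≤ 9 / 8 * t ∧ ‖x - y‖ + t / 2 ≤ ‖x - y₁‖ := by
  have hτ := hasReach_of_le_reach h.le_reach
  have hpar := h.exists_param_bounds hk hL hy
  set T := tangentSpace M y with hT
  obtain ⟨N, hN1, -, hN3⟩ := hpar
  set w := y - x with hw
  have hwn : ‖w‖ = ‖x - y‖ := norm_sub_rev _ _
  set v : T := T.orthogonalProjectionOnto w with hv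
  set u := w - (v : E D) with hu
  have hu_mem : u ∈ Tᗮ := T.sub_starProjection_mem_orthogonal w
  have huv : inner ℝ (v : E D) u = 0 := T.inner_right_of_mem_orthogonal v.2 hu_mem
  have hwuv : w = v + u := by rw [hu]; abel
  have hfed := hτ.inner_le_of_mem_orthogonal hρ h.isCompact.isClosed h.isSubmanifold hk hy hx
    (neg_mem hu_mem)
  rw [norm_neg, inner_neg_right, ← inner_neg_left, neg_sub, ← hw] at hfed
  have hwu : inner ℝ w u = ‖u‖ ^ 2 := by
    rw [hwuv, inner_add_left, huv, zero_add, real_inner_self_eq_norm_sq]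
  have hwv : inner ℝ w (v : E D) = ‖v‖ ^ 2 := by
    rw [hwuv, inner_add_left, real_inner_comm _ u, huv, add_zero, real_inner_self_eq_norm_sq]
    rfl
  have hun : ‖u‖ ≤ ‖w‖ / 2 := by
    by_contra! hlt
    have hu0 : 0 < ‖u‖ := lt_of_le_of_lt (by positivity) hlt
    rw [hwu, ← hwn, pow_two] at hfed
    have h1 := le_of_mul_le_mul_left hfed hu0
    have h2 : ‖w‖ ^ 2 / (2 * ρ) ≤ ‖w‖ / 2 := by
      rw [div_le_iff₀ (by positivity)]
      nlinarith [norm_nonneg w]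
    linarith
  have hpyth : ‖w‖ ^ 2 = ‖v‖ ^ 2 + ‖u‖ ^ 2 := by
    rw [← hwu, ← hwv, ← inner_add_right, ← hwuv, real_inner_self_eq_norm_sq]
  have hw0 : 0 < ‖w‖ := by rwa [hwn]
  have hvn : 3 / 4 * ‖w‖ ≤ ‖v‖ := by
    refine le_of_sq_le_sq ?_ (norm_nonneg _)
    nlinarith [norm_nonneg u]
  have hv0 : 0 < ‖v‖ := by linarith
  have hs : ‖(t / ‖v‖) • v‖ = t := by
    rw [norm_smul, Real.norm_of_nonneg (by positivity), div_mul_cancel₀ _ hv0.ne']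
  have hsL : ‖(t / ‖v‖) • v‖ ≤ 1 / (4 * L 2) := by
    rw [hs]
    exact htL.trans (by gcongr; norm_num)
  have hNt : ‖N ((t / ‖v‖) • v)‖ ≤ t / 8 := by
    refine (hN3 _ hsL).trans ?_
    rw [hs]
    rw [le_div_iff₀ (by positivity)] at htL
    nlinarith
  set n := N ((t / ‖v‖) • v) with hn
  refine ⟨y + (((t / ‖v‖) • v : T) : E D) + n, hN1 _ hsL, ?_, ?_⟩
  · rw [show y - (y + (((t / ‖v‖) • v : T) : E D) + n) = -((((t / ‖v‖) • v : T) : E D) + n) by abel,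
      norm_neg]
    have : ‖(((t / ‖v‖) • v : T) : E D)‖ = t := hs
    linarith [norm_add_le (((t / ‖v‖) • v : T) : E D) n]
  · rw [norm_sub_rev x (_ + n)]
    set q := y + (((t / ‖v‖) • v : T) : E D) + n - x with hq
    have hqe : q = w + (t / ‖v‖) • (v : E D) + n := by
      rw [hq, hw, Submodule.coe_smul]; abel
    have h1 : inner ℝ w q = ‖w‖ ^ 2 + t * ‖v‖ + inner ℝ w n := by
      rw [hqe, inner_add_right, inner_add_right, real_inner_self_eq_norm_sq, inner_smul_right, hwv]
      field_simp
    have h2 := neg_le_of_abs_le (abs_real_inner_le_norm w n)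
    have h3 := real_inner_le_norm w q
    have h4 : ‖w‖ * (‖w‖ + t / 2) ≤ ‖w‖ * ‖q‖ := by nlinarith
    rw [← hwn]
    exact le_of_mul_le_mul_left h4 hw0

/-- The bound `arcLen_add_le` for chords of length at least `δ`. -/
lemma arcLen_add_le_of_le {r η δ c a b : ℝ} (hδ : 0 < δ) (hη : 0 ≤ η) (hηr : η < r) (hc : δ ≤ c)
    (ha : 0 ≤ a) (hb : 0 ≤ b) (hc0 : c ≤ 2 * (r - η)) (haη : a < 2 * η)
    (h : (a + b) * (12 * r ^ 3) ≤ η * δ ^ 3) :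
    arcLen r (c + a) + b ≤ arcLen (r - η) c := by
  have hr : 0 < r := by linarith
  refine arcLen_add_le hη hηr (by linarith) ha hb hc0 (by linarith) ?_
  calc a + b ≤ η * δ ^ 3 / (12 * r ^ 3) := (le_div_iff₀ (by positivity)).2 h
    _ = 2 * η * (δ / (2 * r)) ^ 3 / 3 := by field_simp; ring
    _ ≤ 2 * η * ((c + a) / (2 * r)) ^ 3 / 3 := by gcongr; linarith

/-- `r` is an admissible radius in the definition of the spherical distortion radius. -/
def IsAdmissible (δ : ℝ) (K : Set (E D)) (dK : E D → E D → ℝ≥0∞) (r : ℝ) : Prop :=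
  0 < r ∧ ∀ x ∈ K, ∀ y ∈ K, δ ≤ ‖x - y‖ → ‖x - y‖ < 2 * r →
    dK x y ≤ ENNReal.ofReal (sphereDist r x y)

lemma IsAdmissible.le_sdr {δ r : ℝ} {dK : E D → E D → ℝ≥0∞} (h : IsAdmissible δ K dK r) :
    ENNReal.ofReal r ≤ sdr δ K dK :=
  le_iSup₂_of_le r h le_rfl

lemma IsAdmissible.mono {δ r r' : ℝ} {dK : E D → E D → ℝ≥0∞} (h : IsAdmissible δ K dK r)
    (hr' : 0 < r') (hle : r' ≤ r) : IsAdmissible δ K dK r' :=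
  ⟨hr', fun x hx y hy h1 h2 => (h.2 x hx y hy h1 (by linarith)).trans <|
    ENNReal.ofReal_le_ofReal (arcLen_anti hr' hle (norm_nonneg _) h2)⟩

/-- The data of a support estimate: `K` is `ε`-close to a manifold `M` of the model, where `ε` is
small with respect to the scale `δ` and to the parameters of the model. -/
structure IsCloseTo (d k : ℕ) (ρ : ℝ) (L : ℕ → ℝ) (δ ε : ℝ) (M K : Set (E D)) : Prop where
  model : IsModelManifold d k ρ L M
  two_le : 2 ≤ k
  L_pos : 0 < L 2
  δ_pos : 0 < δ
  δ_lt : δ < ρ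
  ε_pos : 0 < ε
  ε_le_L : 8 * ε ≤ 1 / (8 * L 2)
  ε_le_ρ : 8 * ε ≤ ρ
  ε_le_δ : 4 * ε ≤ δ
  ε_le_sub : 4 * ε ≤ ρ - δ
  hausdorff : hausdorffEDist M K ≤ ENNReal.ofReal ε

namespace IsCloseTo

variable {ρ δ ε : ℝ} {L : ℕ → ℝ}

lemma hasReach (h : IsCloseTo d k ρ L δ ε M K) : HasReach ρ M :=
  hasReach_of_le_reach h.model.le_reach

lemma intrinsicDist_le (h : IsCloseTo d k ρ L δ ε M K) {x y : E D} (hx : x ∈ M) (hy : y ∈ M)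
    {t : ℝ} (hxy : ‖x - y‖ ≤ t) (ht : t < 2 * ρ) :
    intrinsicDist M x y ≤ ENNReal.ofReal (2 * t) := by
  have hρ : 0 < ρ := h.δ_pos.trans h.δ_lt
  refine (h.hasReach.intrinsicDist_le h.model.isCompact.isClosed
    hx hy (hxy.trans_lt ht)).trans (ENNReal.ofReal_le_ofReal ?_)
  have h1 := arcLen_le hρ (norm_nonneg (x - y)) (hxy.trans ht.le)
  nlinarith [Real.pi_le_four, norm_nonneg (x - y)]

/-- If the distance of two points of `M` falls short of a threshold `m ≤ δ + 4 ε` by at most `4 ε`,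
then the threshold is reached by moving one of them within `M` by `O(ε)`. -/
lemma exists_push (h : IsCloseTo d k ρ L δ ε M K) {x y : E D} {m : ℝ} (hx : x ∈ M) (hy : y ∈ M)
    (hm : m ≤ δ + 4 * ε) (hxy0 : 0 < ‖x - y‖) (hxy : m ≤ ‖x - y‖ + 4 * ε) :
    ∃ y₁ ∈ M, ‖y - y₁‖ ≤ 9 * ε ∧ m ≤ ‖x - y₁‖ := by
  have hε := h.ε_pos
  rcases le_or_gt m ‖x - y‖ with hle | hlt
  · exact ⟨y, hy, by simpa using by positivity, hle⟩
  obtain ⟨y₁, h1, h2, h3⟩ := h.model.exists_norm_sub_add_le h.two_le h.L_pos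
    (h.δ_pos.trans h.δ_lt) hx hy hxy0 (by linarith [h.ε_le_sub]) (t := 8 * ε) (by positivity)
    h.ε_le_L
  exact ⟨y₁, h1, by linarith, by linarith⟩

lemma exists_near_left (h : IsCloseTo d k ρ L δ ε M K) {x : E D} (hx : x ∈ K) :
    ∃ y ∈ M, ‖x - y‖ ≤ ε := by
  obtain ⟨y, hy, hxy⟩ := h.model.isCompact.exists_infEDist_eq_edist
    h.model.isConnected.nonempty x
  refine ⟨y, hy, ?_⟩
  have h1 := (infEDist_le_hausdorffEDist_of_mem hx).trans (hausdorffEDist_comm.trans_le h.hausdorff)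
  rw [hxy, edist_dist, dist_eq_norm] at h1
  exact (ENNReal.ofReal_le_ofReal_iff h.ε_pos.le).1 h1

lemma exists_near_right (h : IsCloseTo d k ρ L δ ε M K) {x : E D} (hx : x ∈ M) :
    ∃ y ∈ K, ‖x - y‖ ≤ 2 * ε := by
  have hε := h.ε_pos
  obtain ⟨y, hy, hxy⟩ := exists_edist_lt_of_hausdorffEDist_lt hx (h.hausdorff.trans_lt
    ((ENNReal.ofReal_lt_ofReal_iff (by positivity : 0 < 2 * ε)).2 (by linarith)))
  refine ⟨y, hy, ?_⟩
  rw [edist_dist, dist_eq_norm] at hxy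
  exact ((ENNReal.ofReal_lt_ofReal_iff (by positivity)).1 hxy).le

lemma subset_cthickening (h : IsCloseTo d k ρ L δ ε M K) : M ⊆ cthickening ε K := fun _ hx =>
  (infEDist_le_hausdorffEDist_of_mem hx).trans h.hausdorff

lemma infDist_le_of_mem_cthickening (h : IsCloseTo d k ρ L δ ε M K) {z : E D}
    (hz : z ∈ cthickening ε K) : infDist z M ≤ 2 * ε := by
  have hε := h.ε_pos
  have h1 : infEDist z M ≤ ENNReal.ofReal (2 * ε) := by
    calc infEDist z M ≤ infEDist z K + hausdorffEDist K M := infEDist_le_infEDist_add_hausdorffEDist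
      _ ≤ ENNReal.ofReal ε + ENNReal.ofReal ε :=
          add_le_add hz (hausdorffEDist_comm.trans_le h.hausdorff)
      _ = ENNReal.ofReal (2 * ε) := by
          rw [← ENNReal.ofReal_add hε.le hε.le, two_mul]
  exact ENNReal.toReal_le_of_le_ofReal (by positivity) h1

lemma intrinsicDist_cthickening_le (h : IsCloseTo d k ρ L δ ε M K) {x x' : E D} (hx' : x' ∈ K)
    (hxx : ‖x' - x‖ ≤ ε) :
    intrinsicDist (cthickening ε K) x' x ≤ ENNReal.ofReal ε := by
  refine (intrinsicDist_le_of_segment ?_).trans (ENNReal.ofReal_le_ofReal hxx)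
  refine Set.Subset.trans ?_ (closedBall_subset_cthickening hx' ε)
  refine (convex_closedBall x' ε).segment_subset (mem_closedBall_self h.ε_pos.le) ?_
  rwa [mem_closedBall, dist_eq_norm, norm_sub_rev]

/-- Admissible radii for `M` are, up to `O(ε)`, admissible for the estimate `K`. -/
lemma isAdmissible_offset (h : IsCloseTo d k ρ L δ ε M K) {r η : ℝ}
    (hr : IsAdmissible δ M (intrinsicDist M) r)
    (hη : 6 * ε ≤ η) (hηr : η < r) (hη' : 31 * ε * (12 * r ^ 3) ≤ η * δ ^ 3) :
    IsAdmissible δ K (intrinsicDist (cthickening ε K)) (r - η) := by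
  have hε := h.ε_pos
  have hδ := h.δ_pos
  refine ⟨by linarith, fun x' hx' y' hy' hδc hc => ?_⟩
  set c := ‖x' - y'‖ with hcdef
  obtain ⟨x, hx, hxx⟩ := h.exists_near_left hx'
  obtain ⟨y, hy, hyy⟩ := h.exists_near_left hy'
  have hcle : c ≤ ‖x - y‖ + 2 * ε := by
    calc c = ‖(x' - x) + (x - y) - (y' - y)‖ := by rw [hcdef]; congr 1; abel
      _ ≤ ‖(x' - x) + (x - y)‖ + ‖y' - y‖ := norm_sub_le _ _
      _ ≤ ‖x' - x‖ + ‖x - y‖ + ‖y' - y‖ := by gcongr; exact norm_add_le _ _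
      _ ≤ _ := by linarith
  obtain ⟨y₁, hy₁, hyy₁, hxy₁⟩ := h.exists_push hx hy (m := δ) (by linarith)
    (by linarith [h.ε_le_δ]) (by linarith)
  have hle : ‖x - y₁‖ ≤ c + 11 * ε := by
    calc ‖x - y₁‖ = ‖(x' - y') - (x' - x) + (y' - y) + (y - y₁)‖ := by congr 1; abel
      _ ≤ ‖x' - y'‖ + ‖x' - x‖ + ‖y' - y‖ + ‖y - y₁‖ := by
          grw [norm_add_le, norm_add_le, norm_sub_le]
      _ ≤ _ := by linarith
  have hr0 : 0 < r := hr.1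
  have h1 : intrinsicDist M x y₁ ≤ ENNReal.ofReal (arcLen r (c + 11 * ε)) :=
    (hr.2 x hx y₁ hy₁ hxy₁ (by linarith)).trans
      (ENNReal.ofReal_le_ofReal (arcLen_mono hr0 hle))
  have h2 : intrinsicDist M y₁ y ≤ ENNReal.ofReal (2 * (9 * ε)) :=
    h.intrinsicDist_le hy₁ hy (by rwa [norm_sub_rev]) (by linarith [h.ε_le_ρ])
  -- the path: from `x'` to `x`, within `M` to `y₁` and to `y`, then to `y'`
  have h3 : intrinsicDist (cthickening ε K) y y' ≤ ENNReal.ofReal ε :=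
    (intrinsicDist_le_of_segment (by
      rw [segment_symm]
      refine Set.Subset.trans ?_ (closedBall_subset_cthickening hy' ε)
      refine (convex_closedBall y' ε).segment_subset (mem_closedBall_self hε.le) ?_
      rwa [mem_closedBall, dist_eq_norm, norm_sub_rev])).trans
    (ENNReal.ofReal_le_ofReal (by rwa [norm_sub_rev]))
  have harc : 0 ≤ arcLen r (c + 11 * ε) := arcLen_nonneg hr0 (by linarith)
  calc intrinsicDist (cthickening ε K) x' y'
      ≤ intrinsicDist (cthickening ε K) x' x + (intrinsicDist M x y₁ + intrinsicDist M y₁ y) +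
        intrinsicDist (cthickening ε K) y y' := by
        grw [intrinsicDist_triangle _ x' y y', intrinsicDist_triangle _ x' x y,
          intrinsicDist_mono h.subset_cthickening x y, intrinsicDist_triangle M x y₁ y]
    _ ≤ ENNReal.ofReal ε + (ENNReal.ofReal (arcLen r (c + 11 * ε)) + ENNReal.ofReal (2 * (9 * ε))) +
        ENNReal.ofReal ε := by
        gcongr
        exact h.intrinsicDist_cthickening_le hx' hxx
    _ = ENNReal.ofReal (arcLen r (c + 11 * ε) + 20 * ε) := by
        rw [← ENNReal.ofReal_add harc (by positivity), ← ENNReal.ofReal_add hε.le (by positivity),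
          ← ENNReal.ofReal_add (by positivity) hε.le]
        congr 1; ring
    _ ≤ ENNReal.ofReal (arcLen (r - η) c) := ENNReal.ofReal_le_ofReal <|
        arcLen_add_le_of_le hδ (by linarith) hηr hδc (by positivity) (by positivity) hc.le
          (by linarith) (by linarith)

/-- Projecting onto `M` shows that paths in the offset of `K` are not much shorter than paths
in `M`. -/
lemma exists_intrinsicDist_le (h : IsCloseTo d k ρ L δ ε M K) {x y : E D} {l : ℝ} (hx : x ∈ K)
    (hy : y ∈ K) (hl : intrinsicDist (cthickening ε K) x y < ENNReal.ofReal l) :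
    ∃ a ∈ M, ∃ b ∈ M, ‖x - a‖ ≤ ε ∧ ‖y - b‖ ≤ ε ∧
      intrinsicDist M a b ≤ ENNReal.ofReal ((1 + 4 * ε / ρ) * l) := by
  have hε := h.ε_pos
  have hρ : 0 < ρ := h.δ_pos.trans h.δ_lt
  have hMc := h.model.isCompact.isClosed
  choose f hf using fun z => exists_isNearest hMc h.model.isConnected.nonempty z
  have hnear : ∀ z ∈ K, ‖z - f z‖ ≤ ε := fun z hz => by
    obtain ⟨a, ha, hza⟩ := h.exists_near_left hz
    rw [← dist_eq_norm, (hf z).2]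
    exact (infDist_le_dist_of_mem ha).trans (by rwa [dist_eq_norm])
  have hC : 0 ≤ 1 + 4 * ε / ρ := by positivity
  have hlip : LipschitzOnWith (1 + 4 * ε / ρ).toNNReal f (cthickening ε K) := by
    refine LipschitzOnWith.of_dist_le_mul fun p hp q hq => ?_
    rw [Real.coe_toNNReal _ hC, dist_eq_norm, dist_eq_norm]
    have hσ : 2 * ε < ρ := by linarith [h.ε_le_ρ]
    have h1 := h.hasReach.norm_nearest_sub_le hMc (hf p) (hf q)
      (h.infDist_le_of_mem_cthickening hp) (h.infDist_le_of_mem_cthickening hq) hσ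
    set u := ε / ρ with hu
    have hu0 : 0 ≤ u := by positivity
    have hu8 : u ≤ 1 / 8 := by rw [hu, div_le_iff₀ hρ]; linarith [h.ε_le_ρ]
    rw [mul_div_assoc, ← hu] at h1 ⊢
    have h2 : 1 ≤ (1 + 4 * u) * (1 - 2 * u) := by nlinarith
    calc ‖f p - f q‖ ≤ (1 + 4 * u) * (1 - 2 * u) * ‖f p - f q‖ :=
          le_mul_of_one_le_left (norm_nonneg _) h2
      _ = (1 + 4 * u) * ((1 - 2 * u) * ‖f p - f q‖) := by ring
      _ ≤ (1 + 4 * u) * ‖p - q‖ := by gcongr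
  refine ⟨f x, (hf x).1, f y, (hf y).1, hnear x hx, hnear y hy, ?_⟩
  refine (intrinsicDist_image_le hlip (fun z _ => (hf z).1) hl).trans_eq ?_
  rw [ENNReal.ofReal_mul hC]
  rfl

/-- Admissible radii for the estimate `K` are, up to `O(ε)`, admissible for `M`. -/
lemma isAdmissible_of_offset (h : IsCloseTo d k ρ L δ ε M K) {r η : ℝ}
    (hr : IsAdmissible δ K (intrinsicDist (cthickening ε K)) r)
    (hη : 7 * ε ≤ η) (hηr : η < r)
    (hη' : (45 * ε + 16 * ε * r / δ) * (12 * r ^ 3) ≤ η * δ ^ 3) :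
    IsAdmissible δ M (intrinsicDist M) (r - η) := by
  have hε := h.ε_pos
  have hδ := h.δ_pos
  have hρ : 0 < ρ := hδ.trans h.δ_lt
  have hr0 : 0 < r := hr.1
  refine ⟨by linarith, fun x hx y hy hδc hc => ?_⟩
  set c := ‖x - y‖ with hcdef
  obtain ⟨y₁, hy₁, hyy₁, hxy₁⟩ := h.exists_push hx hy (m := δ + 4 * ε) le_rfl
    (by linarith) (by linarith)
  obtain ⟨x', hx', hxx⟩ := h.exists_near_right hx
  obtain ⟨y', hy', hyy⟩ := h.exists_near_right hy₁
  have hge : δ ≤ ‖x' - y'‖ := by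
    have : ‖x - y₁‖ ≤ ‖x' - y'‖ + ‖x - x'‖ + ‖y₁ - y'‖ := by
      calc ‖x - y₁‖ = ‖(x' - y') + (x - x') - (y₁ - y')‖ := by congr 1; abel
        _ ≤ _ := by grw [norm_sub_le, norm_add_le]
    linarith
  have hle : ‖x' - y'‖ ≤ c + 13 * ε := by
    calc ‖x' - y'‖ = ‖(x - y) - (x - x') + (y - y₁) + (y₁ - y')‖ := by congr 1; abel
      _ ≤ ‖x - y‖ + ‖x - x'‖ + ‖y - y₁‖ + ‖y₁ - y'‖ := by
          grw [norm_add_le, norm_add_le, norm_sub_le]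
      _ ≤ _ := by linarith
  set l := arcLen r (c + 13 * ε) with hl
  have hl0 : 0 ≤ l := arcLen_nonneg hr0 (by linarith)
  have hl4 : l ≤ 4 * r := by
    have h1 := arcLen_le hr0 (by linarith : 0 ≤ c + 13 * ε) (by linarith)
    nlinarith [Real.pi_le_four]
  have h1 : intrinsicDist (cthickening ε K) x' y' < ENNReal.ofReal (l + ε) :=
    (hr.2 x' hx' y' hy' hge (by linarith)).trans_lt
      ((ENNReal.ofReal_le_ofReal (arcLen_mono hr0 hle)).trans_lt
        ((ENNReal.ofReal_lt_ofReal_iff (by positivity)).2 (by linarith)))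
  obtain ⟨a, ha, b, hb, hxa, hyb, hab⟩ := h.exists_intrinsicDist_le hx' hy' h1
  -- the path: within `M` from `x` to `a`, along the projection of a path of the offset to `b`, then
  -- to `y₁` and to `y`
  have h2 : intrinsicDist M x a ≤ ENNReal.ofReal (2 * (3 * ε)) :=
    h.intrinsicDist_le hx ha (by
      calc ‖x - a‖ ≤ ‖x - x'‖ + ‖x' - a‖ := norm_sub_le_norm_sub_add_norm_sub _ _ _
        _ ≤ _ := by linarith) (by linarith [h.ε_le_ρ])
  have h3 : intrinsicDist M b y₁ ≤ ENNReal.ofReal (2 * (3 * ε)) :=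
    h.intrinsicDist_le hb hy₁ (by
      rw [norm_sub_rev]
      calc ‖y₁ - b‖ ≤ ‖y₁ - y'‖ + ‖y' - b‖ := norm_sub_le_norm_sub_add_norm_sub _ _ _
        _ ≤ _ := by linarith) (by linarith [h.ε_le_ρ])
  have h4 : intrinsicDist M y₁ y ≤ ENNReal.ofReal (2 * (9 * ε)) :=
    h.intrinsicDist_le hy₁ hy (by rwa [norm_sub_rev]) (by linarith [h.ε_le_ρ])
  have h5 : (1 + 4 * ε / ρ) * (l + ε) ≤ l + 2 * ε + 16 * ε * r / δ := by
    have e1 : 4 * ε / ρ * l ≤ 16 * ε * r / δ := by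
      calc 4 * ε / ρ * l ≤ 4 * ε / δ * (4 * r) := by
            gcongr
            exact h.δ_lt.le
        _ = 16 * ε * r / δ := by ring
    have e2 : 4 * ε / ρ ≤ 1 := by rw [div_le_one hρ]; linarith [h.ε_le_ρ]
    nlinarith
  calc intrinsicDist M x y
      ≤ intrinsicDist M x a + intrinsicDist M a b + intrinsicDist M b y₁ + intrinsicDist M y₁ y := by
        grw [intrinsicDist_triangle M x y₁ y, intrinsicDist_triangle M x b y₁,
          intrinsicDist_triangle M x a b]
    _ ≤ ENNReal.ofReal (2 * (3 * ε)) + ENNReal.ofReal (l + 2 * ε + 16 * ε * r / δ) +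
        ENNReal.ofReal (2 * (3 * ε)) + ENNReal.ofReal (2 * (9 * ε)) := by
        gcongr
        exact hab.trans (ENNReal.ofReal_le_ofReal h5)
    _ = ENNReal.ofReal (l + (32 * ε + 16 * ε * r / δ)) := by
        rw [← ENNReal.ofReal_add (by positivity) (by positivity),
          ← ENNReal.ofReal_add (by positivity) (by positivity),
          ← ENNReal.ofReal_add (by positivity) (by positivity)]
        congr 1; ring
    _ ≤ ENNReal.ofReal (arcLen (r - η) c) := ENNReal.ofReal_le_ofReal <|
        arcLen_add_le_of_le hδ (by linarith) hηr hδc (by positivity) (by positivity) hc.le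
          (by linarith) (by linarith)

/-- The truncated plug-in estimator is within `O(ε)` of the spherical distortion radius of `M`. -/
theorem abs_plugInSdr_sub_le (h : IsCloseTo d k ρ L δ ε M K) {s : ℝ}
    (hs : sdr δ M (intrinsicDist M) ≤ ENNReal.ofReal s) :
    |plugInSdr δ ε s K - trueSdr δ M| ≤ 1000 * s ^ 4 / δ ^ 4 * ε := by
  have hε := h.ε_pos
  have hδ := h.δ_pos
  have hδs : δ ≤ s := by
    have h1 := h.model.le_reach.trans ((reach_le_sdr h.model.isCompact.isClosed δ).trans hs)
    by_contra! hlt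
    rw [ENNReal.ofReal_le_ofReal_iff'] at h1
    rcases h1 with h1 | h1 <;> linarith [h.δ_lt]
  have hs0 : 0 < s := hδ.trans_le hδs
  set η := 1000 * s ^ 4 / δ ^ 4 * ε with hη
  have hq : 1 ≤ s / δ := (one_le_div hδ).2 hδs
  have hη0 : 1000 * ε ≤ η := by
    rw [hη, mul_div_assoc, ← div_pow]
    have := one_le_pow₀ (n := 4) hq
    nlinarith
  -- the two comparisons of radii require `η δ³` to exceed `372 ε s³` and `732 ε s⁴ / δ`
  have hη1 : ∀ r, 0 < r → r ≤ s → (45 * ε + 16 * ε * r / δ) * (12 * r ^ 3) ≤ η * δ ^ 3 := by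
    intro r hr hrs
    have h45 : 45 * ε ≤ 45 * ε * (s / δ) := le_mul_of_one_le_right (by positivity) hq
    calc (45 * ε + 16 * ε * r / δ) * (12 * r ^ 3)
        ≤ (45 * ε * (s / δ) + 16 * ε * s / δ) * (12 * s ^ 3) := by
          gcongr
      _ = 732 * s ^ 4 / δ * ε := by ring
      _ ≤ 1000 * s ^ 4 / δ * ε := by gcongr; norm_num
      _ = η * δ ^ 3 := by rw [hη]; field_simp
  have hη2 : ∀ r, 0 < r → r ≤ s → 31 * ε * (12 * r ^ 3) ≤ η * δ ^ 3 := by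
    intro r hr hrs
    refine le_trans ?_ (hη1 r hr hrs)
    gcongr
    linarith [show 0 ≤ 16 * ε * r / δ by positivity]
  have hη_nn : 0 ≤ η := by linarith
  set σ := sdr δ M (intrinsicDist M) with hσ
  set σ' := sdr δ K (intrinsicDist (cthickening ε K)) with hσ'
  have hσtop : σ ≠ ⊤ := ne_top_of_le_ne_top ENNReal.ofReal_ne_top hs
  have hmtop : min σ' (ENNReal.ofReal s) ≠ ⊤ :=
    ne_top_of_le_ne_top ENNReal.ofReal_ne_top (min_le_right _ _)
  have hadd : ∀ r : ℝ, ENNReal.ofReal r ≤ ENNReal.ofReal (r - η) + ENNReal.ofReal η := fun r => by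
    have := ENNReal.ofReal_add_le (p := r - η) (q := η)
    rwa [sub_add_cancel] at this
  -- an admissible radius larger than `η` remains admissible for the other set when decreased by `η`
  have h1 : σ ≤ min σ' (ENNReal.ofReal s) + ENNReal.ofReal η := by
    rw [min_add]
    refine le_min (iSup₂_le fun r hr => ?_) (hs.trans le_self_add)
    have hr : IsAdmissible δ M (intrinsicDist M) r := hr
    have hrs : r ≤ s := (ENNReal.ofReal_le_ofReal_iff hs0.le).1 (hr.le_sdr.trans hs)
    rcases le_or_gt r η with hle | hlt
    · exact (ENNReal.ofReal_le_ofReal hle).trans le_add_self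
    · refine (hadd r).trans ?_
      gcongr
      exact (h.isAdmissible_offset hr (by linarith) hlt (hη2 r hr.1 hrs)).le_sdr
  have h2 : min σ' (ENNReal.ofReal s) ≤ σ + ENNReal.ofReal η := by
    rw [hσ', sdr, iSup₂_inf_eq]
    refine iSup₂_le fun r hr => ?_
    have hr : IsAdmissible δ K (intrinsicDist (cthickening ε K)) r := hr
    change min (ENNReal.ofReal r) (ENNReal.ofReal s) ≤ _
    rw [← ENNReal.ofReal_min]
    have hr' := hr.mono (lt_min hr.1 hs0) (min_le_left _ _)
    rcases le_or_gt (min r s) η with hle | hlt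
    · exact (ENNReal.ofReal_le_ofReal hle).trans le_add_self
    · refine (hadd _).trans ?_
      gcongr
      exact (h.isAdmissible_of_offset hr' (by linarith) hlt
        (hη1 _ hr'.1 (min_le_right _ _))).le_sdr
  have h1' := ENNReal.toReal_mono (by finiteness) h1
  have h2' := ENNReal.toReal_mono (by finiteness) h2
  rw [ENNReal.toReal_add (by assumption) ENNReal.ofReal_ne_top, ENNReal.toReal_ofReal hη_nn]
    at h1' h2'
  rw [abs_sub_le_iff]
  unfold plugInSdr trueSdr
  constructor <;> linarith

end IsCloseTo
end Stability

/-! ### Risk bounds and rates -/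

section Risk

variable {D d k : ℕ}

/-- No measurability is needed: `F - f` is dominated by a measurable function, constant on each of
the measurable hulls of `A` and of its complement. -/
lemma lintegral_le_lintegral_add {α : Type*} [MeasurableSpace α] (μ : Measure α)
    {F f : α → ℝ≥0∞} {A : Set α} {c₁ c₂ : ℝ≥0∞} (h₁ : ∀ x ∈ A, F x ≤ f x + c₁)
    (h₂ : ∀ x, F x ≤ f x + c₂) :
    ∫⁻ x, F x ∂μ ≤ ∫⁻ x, f x ∂μ + (c₁ * μ A + c₂ * μ Aᶜ) := by
  set g : α → ℝ≥0∞ := fun x => (toMeasurable μ A).indicator (fun _ => c₁) x +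
    (toMeasurable μ Aᶜ).indicator (fun _ => c₂) x with hg
  have hm₁ : Measurable ((toMeasurable μ A).indicator fun _ => c₁) :=
    measurable_const.indicator (measurableSet_toMeasurable _ _)
  have hm₂ : Measurable ((toMeasurable μ Aᶜ).indicator fun _ => c₂) :=
    measurable_const.indicator (measurableSet_toMeasurable _ _)
  calc ∫⁻ x, F x ∂μ ≤ ∫⁻ x, f x + g x ∂μ := by
        refine lintegral_mono fun x => ?_
        by_cases hx : x ∈ A
        · refine (h₁ x hx).trans ?_
          rw [hg]
          dsimp only
          rw [Set.indicator_of_mem (subset_toMeasurable μ A hx)]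
          gcongr
          exact le_self_add
        · refine (h₂ x).trans ?_
          rw [hg]
          dsimp only
          rw [Set.indicator_of_mem (subset_toMeasurable μ Aᶜ hx)]
          gcongr
          exact le_add_self
    _ = ∫⁻ x, f x ∂μ + ∫⁻ x, g x ∂μ := lintegral_add_right _ (hm₁.add hm₂)
    _ = ∫⁻ x, f x ∂μ + (c₁ * μ A + c₂ * μ Aᶜ) := by
        rw [hg, lintegral_add_left hm₁, lintegral_indicator_const (measurableSet_toMeasurable _ _),
          lintegral_indicator_const (measurableSet_toMeasurable _ _), measure_toMeasurable,
          measure_toMeasurable]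

lemma abs_plugInSdr_sub_trueSdr_le {δ ε s : ℝ} {M : Set (E D)} (hs : 0 ≤ s)
    (h : sdr δ M (intrinsicDist M) ≤ ENNReal.ofReal s) (K : Set (E D)) :
    |plugInSdr δ ε s K - trueSdr δ M| ≤ 2 * s := by
  have h1 : plugInSdr δ ε s K ≤ s := ENNReal.toReal_le_of_le_ofReal hs (min_le_right _ _)
  have h2 : trueSdr δ M ≤ s := ENNReal.toReal_le_of_le_ofReal hs h
  have h3 : 0 ≤ plugInSdr δ ε s K := ENNReal.toReal_nonneg
  have h4 : 0 ≤ trueSdr δ M := ENNReal.toReal_nonneg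
  rw [abs_sub_le_iff]
  constructor <;> linarith

/-- A range of precisions, depending on the parameters of the model only, on which the stability of
the spherical distortion radius applies. -/
lemma exists_isCloseTo {k : ℕ} (hk : 2 ≤ k) {ρ δ : ℝ} {L : ℕ → ℝ} (hL : 0 < L 2) (hδ : 0 < δ)
    (hδρ : δ < ρ) :
    ∃ ε₀ : ℝ, 0 < ε₀ ∧ ∀ (d D : ℕ) (ε : ℝ), 0 < ε → ε ≤ ε₀ → ∀ M K : Set (E D),
      IsModelManifold d k ρ L M → Metric.hausdorffEDist M K ≤ ENNReal.ofReal ε →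
      IsCloseTo d k ρ L δ ε M K := by
  refine ⟨min (1 / (64 * L 2)) (min (δ / 8) ((ρ - δ) / 4)),
    lt_min (by positivity) (lt_min (by positivity) (by linarith)), ?_⟩
  intro d D ε hε hle M K hM hMK
  obtain ⟨h1, h2, h3⟩ : ε ≤ 1 / (64 * L 2) ∧ ε ≤ δ / 8 ∧ ε ≤ (ρ - δ) / 4 := by
    simpa only [le_min_iff] using hle
  refine ⟨hM, hk, hL, hδ, hδρ, hε, ?_, by linarith, by linarith, by linarith, hMK⟩
  calc 8 * ε ≤ 8 * (1 / (64 * L 2)) := by gcongr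
    _ = 1 / (8 * L 2) := by field_simp; norm_num

/-- Bound on the risk of the plug-in estimators of the spherical distortion radius and of the
reach. -/
lemma risk_le {ρ δ ε s : ℝ} {L : ℕ → ℝ} {n : ℕ} {P : Measure (E D)}
    (hs0 : 0 < s) (hd : 1 ≤ d) (hk : 2 ≤ k) (hδ : 0 < δ) (hδρ : δ < ρ)
    (hM : IsModelManifold d k ρ L P.support)
    (hs : sdr δ P.support (intrinsicDist P.support) ≤ ENNReal.ofReal s)
    {Mhat : (Fin n → E D) → Set (E D)} {A : Set (Fin n → E D)}
    (hA : ∀ X ∈ A, IsCloseTo d k ρ L δ ε P.support (Mhat X)) :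
    risk n P (fun X => plugInSdr δ ε s (Mhat X)) (trueSdr δ P.support) ≤
      ENNReal.ofReal (1000 * s ^ 4 / δ ^ 4 * ε) * sampleLaw n P A +
        ENNReal.ofReal (2 * s) * sampleLaw n P Aᶜ ∧
    ∀ Rhat : (Fin n → E D) → ℝ,
      risk n P (fun X => min (Rhat X) (plugInSdr δ ε s (Mhat X))) (reach P.support).toReal ≤
        risk n P Rhat (minCurvatureRadius P.support).toReal +
        (ENNReal.ofReal (1000 * s ^ 4 / δ ^ 4 * ε) * sampleLaw n P A +
          ENNReal.ofReal (2 * s) * sampleLaw n P Aᶜ) := by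
  have h1 : ∀ X ∈ A, |plugInSdr δ ε s (Mhat X) - trueSdr δ P.support| ≤
      1000 * s ^ 4 / δ ^ 4 * ε := fun X hX => (hA X hX).abs_plugInSdr_sub_le hs
  have h2 : ∀ X, |plugInSdr δ ε s (Mhat X) - trueSdr δ P.support| ≤ 2 * s := fun X =>
    abs_plugInSdr_sub_trueSdr_le hs0.le hs _
  constructor
  · refine (lintegral_le_lintegral_add (f := fun _ => 0) (A := A) _
      (c₁ := ENNReal.ofReal (1000 * s ^ 4 / δ ^ 4 * ε)) (c₂ := ENNReal.ofReal (2 * s))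
      (fun X hX => ?_) fun X => ?_).trans_eq (by rw [lintegral_zero, zero_add])
    · rw [zero_add]
      exact ENNReal.ofReal_le_ofReal (h1 X hX)
    · rw [zero_add]
      exact ENNReal.ofReal_le_ofReal (h2 X)
  · intro Rhat
    have hR : minCurvatureRadius P.support ≠ ⊤ :=
      minCurvatureRadius_ne_top hM.isCompact hM.isConnected.nonempty hM.isSubmanifold hd hk
    have hreach : (reach P.support).toReal =
        min (minCurvatureRadius P.support).toReal (trueSdr δ P.support) := by
      rw [reach_eq_min hM.isCompact hM.isSubmanifold hk (hδ.trans hδρ) hδρ.le hM.le_reach,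
        ENNReal.toReal_min hR (ne_top_of_le_ne_top ENNReal.ofReal_ne_top hs)]
      rfl
    have h3 : ∀ X, |min (Rhat X) (plugInSdr δ ε s (Mhat X)) - (reach P.support).toReal| ≤
        |Rhat X - (minCurvatureRadius P.support).toReal| +
          |plugInSdr δ ε s (Mhat X) - trueSdr δ P.support| := fun X => by
      rw [hreach]
      exact (abs_min_sub_min_le_max _ _ _ _).trans
        (max_le_add_of_nonneg (abs_nonneg _) (abs_nonneg _))
    refine lintegral_le_lintegral_add _ (fun X hX => ?_) fun X => ?_
    · rw [← ENNReal.ofReal_add (abs_nonneg _) ((abs_nonneg _).trans (h1 X hX))]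
      exact ENNReal.ofReal_le_ofReal ((h3 X).trans (by gcongr; exact h1 X hX))
    · rw [← ENNReal.ofReal_add (abs_nonneg _) (by positivity)]
      exact ENNReal.ofReal_le_ofReal ((h3 X).trans (by gcongr; exact h2 X))

lemma tendsto_log_div_rpow {p : ℝ} (hp : 0 < p) :
    Tendsto (fun n : ℕ => (Real.log n / n) ^ p) atTop (𝓝 0) := by
  have h1 : Tendsto (fun n : ℕ => Real.log n / n) atTop (𝓝 0) :=
    Real.isLittleO_log_id_atTop.tendsto_div_nhds_zero.comp tendsto_natCast_atTop_atTop
  simpa [Real.zero_rpow hp.ne'] using h1.rpow_const (Or.inr hp.le)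

end Risk
end ReachEst

open ReachEst in
theorem mainTheorem1 :
    ∃ C : ℝ, 0 < C ∧
    ∀ (d D k : ℕ), 1 ≤ d → 2 ≤ k →
    ∀ (ρ fmin fmax : ℝ) (L : ℕ → ℝ), 0 < ρ → 0 < fmin → 0 < L 2 →
      -- the spherical distortion radii are uniformly bounded over the model
      (∃ S : ℝ, ∀ P : Measure (E D), InModel d k ρ L fmin fmax P →
        ∀ δ : ℝ, δ ≤ ρ →
          sdr δ P.support (intrinsicDist P.support) ≤ ENNReal.ofReal S) ∧
      ∀ δ : ℝ, 0 < δ → δ < ρ →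
        -- the reach is determined by the curvature and the spherical distortion radius
        (∀ P : Measure (E D), InModel d k ρ L fmin fmax P →
          minCurvatureRadius P.support ≠ ⊤ ∧
          reach P.support =
            min (minCurvatureRadius P.support) (sdr δ P.support (intrinsicDist P.support))) ∧
        ∀ smax : ℝ, 0 < smax →
          -- risk of the plug-in estimators of the spherical distortion radius and of the reach
          (∃ ε₀ : ℝ, 0 < ε₀ ∧
            ∀ (n : ℕ) (ε : ℝ), 0 < ε → ε ≤ ε₀ →
            ∀ P : Measure (E D), InModel d k ρ L fmin fmax P →
              sdr δ P.support (intrinsicDist P.support) ≤ ENNReal.ofReal smax →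
            ∀ (Mhat : (Fin n → E D) → Set (E D)) (A : Set (Fin n → E D)),
              (∀ X ∈ A, Metric.hausdorffEDist P.support (Mhat X) ≤ ENNReal.ofReal ε) →
              risk n P (fun X => plugInSdr δ ε smax (Mhat X)) (trueSdr δ P.support) ≤
                ENNReal.ofReal (C * smax ^ 4 / δ ^ 4 * ε) * sampleLaw n P A +
                  ENNReal.ofReal (2 * smax) * sampleLaw n P Aᶜ ∧
              ∀ Rhat : (Fin n → E D) → ℝ,
                risk n P (fun X => min (Rhat X) (plugInSdr δ ε smax (Mhat X)))
                    (reach P.support).toReal ≤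
                  risk n P Rhat (minCurvatureRadius P.support).toReal +
                  (ENNReal.ofReal (C * smax ^ 4 / δ ^ 4 * ε) * sampleLaw n P A +
                    ENNReal.ofReal (2 * smax) * sampleLaw n P Aᶜ)) ∧
          -- rates obtained from support estimators (and curvature estimators) with known rates
          (∀ κ : ℝ, 0 < κ → ∃ (K : ℝ) (n₀ : ℕ), 0 < K ∧
            ∀ n : ℕ, n₀ ≤ n →
            ∀ P : Measure (E D), InModel d k ρ L fmin fmax P →
              sdr δ P.support (intrinsicDist P.support) ≤ ENNReal.ofReal smax →
            ∀ (Mhat : (Fin n → E D) → Set (E D)) (A : Set (Fin n → E D)) (ε : ℝ),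
              ε = κ * (Real.log n / n) ^ ((k : ℝ) / d) →
              (∀ X ∈ A, Metric.hausdorffEDist P.support (Mhat X) ≤ ENNReal.ofReal ε) →
              sampleLaw n P Aᶜ ≤ ENNReal.ofReal (κ * (Real.log n / n) ^ ((k : ℝ) / d)) →
              risk n P (fun X => plugInSdr δ ε smax (Mhat X)) (trueSdr δ P.support) ≤
                ENNReal.ofReal (K * (Real.log n / n) ^ ((k : ℝ) / d)) ∧
              (sdr δ P.support (intrinsicDist P.support) ≤ minCurvatureRadius P.support →
                risk n P (fun X => plugInSdr δ ε smax (Mhat X)) (reach P.support).toReal ≤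
                  ENNReal.ofReal (K * (Real.log n / n) ^ ((k : ℝ) / d))) ∧
              ∀ Rhat : (Fin n → E D) → ℝ,
                risk n P Rhat (minCurvatureRadius P.support).toReal ≤
                  ENNReal.ofReal (κ * (Real.log n / n) ^ (((k : ℝ) - 2) / d)) →
                risk n P (fun X => min (Rhat X) (plugInSdr δ ε smax (Mhat X)))
                    (reach P.support).toReal ≤
                  ENNReal.ofReal (K * (Real.log n / n) ^ (((k : ℝ) - 2) / d))) := by
  refine ⟨1000, by norm_num, ?_⟩
  intro d D k hd hk ρ fmin fmax L hρ hfmin hL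
  refine ⟨exists_sdr_le_of_inModel d D k hd hk ρ fmin fmax L hρ hfmin hL, ?_⟩
  intro δ hδ hδρ
  refine ⟨fun P hP => ?_, fun smax hs => ?_⟩
  · have hM := hP.support_mem
    exact ⟨minCurvatureRadius_ne_top hM.isCompact hM.isConnected.nonempty hM.isSubmanifold hd hk,
      reach_eq_min hM.isCompact hM.isSubmanifold hk hρ hδρ.le hM.le_reach⟩
  obtain ⟨ε₀, hε₀, hclose⟩ := exists_isCloseTo hk hL hδ hδρ
  have hrisk : ∀ (n : ℕ) (ε : ℝ), 0 < ε → ε ≤ ε₀ →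
      ∀ P : Measure (E D), InModel d k ρ L fmin fmax P →
        sdr δ P.support (intrinsicDist P.support) ≤ ENNReal.ofReal smax →
      ∀ (Mhat : (Fin n → E D) → Set (E D)) (A : Set (Fin n → E D)),
        (∀ X ∈ A, Metric.hausdorffEDist P.support (Mhat X) ≤ ENNReal.ofReal ε) → _ :=
    fun n ε hε hle P hP hsP Mhat A hA => risk_le hs hd hk hδ hδρ hP.support_mem hsP
      fun X hX => hclose d D ε hε hle _ _ hP.support_mem (hA X hX)
  refine ⟨⟨ε₀, hε₀, hrisk⟩, fun κ hκ => ?_⟩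
  have hd0 : (0 : ℝ) < d := by exact_mod_cast hd
  have hk2 : (2 : ℝ) ≤ k := by exact_mod_cast hk
  set ζ := 1000 * smax ^ 4 / δ ^ 4 with hζ
  have hζ0 : 0 < ζ := by positivity
  obtain ⟨n₁, hn₁⟩ := eventually_atTop.1 ((tendsto_log_div_rpow (p := (k : ℝ) / d)
    (by positivity)).eventually (eventually_le_nhds (by positivity : 0 < ε₀ / κ)))
  -- `n ≥ 2` makes `log n / n` lie in `(0, 1]`
  refine ⟨ζ * κ + 2 * smax * κ + κ, max n₁ 2, by positivity, ?_⟩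
  intro n hn P hP hsP Mhat A ε hεn hA hAc
  have hn2 : (2 : ℝ) ≤ n := by exact_mod_cast (le_max_right _ _).trans hn
  set a := Real.log n / n with ha
  have ha0 : 0 < a := div_pos (Real.log_pos (by linarith)) (by linarith)
  have ha1 : a ≤ 1 := by
    rw [ha, div_le_one (by linarith)]
    linarith [Real.log_le_sub_one_of_pos (by linarith : (0 : ℝ) < n)]
  set x := a ^ ((k : ℝ) / d) with hx
  set y := a ^ (((k : ℝ) - 2) / d) with hy
  have hx0 : 0 < x := Real.rpow_pos_of_pos ha0 _
  have hxy : x ≤ y := Real.rpow_le_rpow_of_exponent_ge ha0 ha1 (by gcongr; linarith)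
  have hε : 0 < ε := by rw [hεn]; positivity
  have hεle : ε ≤ ε₀ := by
    have := hn₁ n ((le_max_left _ _).trans hn)
    rw [le_div_iff₀ hκ] at this
    rw [hεn]
    linarith
  obtain ⟨h1, h2⟩ := hrisk n ε hε hεle P hP hsP Mhat A hA
  have hprob : IsProbabilityMeasure P := hP.isProbabilityMeasure
  have hlaw : IsProbabilityMeasure (sampleLaw n P) := by
    unfold sampleLaw
    infer_instance
  have h3 : ENNReal.ofReal (ζ * ε) * sampleLaw n P A +
      ENNReal.ofReal (2 * smax) * sampleLaw n P Aᶜ ≤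
      ENNReal.ofReal ((ζ * κ + 2 * smax * κ) * x) := by
    calc _ ≤ ENNReal.ofReal (ζ * ε) * 1 + ENNReal.ofReal (2 * smax) * ENNReal.ofReal (κ * x) := by
          gcongr
          exact prob_le_one
      _ = ENNReal.ofReal ((ζ * κ + 2 * smax * κ) * x) := by
          rw [mul_one, ← ENNReal.ofReal_mul (by positivity),
            ← ENNReal.ofReal_add (by positivity) (by positivity), hεn]
          congr 1
          ring
  have h4 := h1.trans (h3.trans (ENNReal.ofReal_le_ofReal
    (mul_le_mul_of_nonneg_right (le_add_of_nonneg_right hκ.le) hx0.le)))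
  refine ⟨h4, fun hle => ?_, fun Rhat hR => ?_⟩
  · have hM := hP.support_mem
    rw [reach_eq_min hM.isCompact hM.isSubmanifold hk hρ hδρ.le hM.le_reach, min_eq_right hle]
    exact h4
  · refine (h2 Rhat).trans ((add_le_add hR h3).trans ?_)
    rw [← ENNReal.ofReal_add (by positivity) (by positivity)]
    refine ENNReal.ofReal_le_ofReal ?_
    calc κ * y + (ζ * κ + 2 * smax * κ) * x ≤ κ * y + (ζ * κ + 2 * smax * κ) * y := by gcongr
      _ = (ζ * κ + 2 * smax * κ + κ) * y := by ring
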